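/- Let $M$ be a smooth (Hausdorff) manifold of dimension $2n+1$ with a contact form $\lambda$, $\xi=\ker\lambda$, and Reeb vector field $R_\lambda$. All submanifolds below are connected embedded Legendrian submanifolds. A graded bridge $(\ell,\alpha)$ from $R$ to $R'$ is a path $\ell$ from $R$ to $R'$ with a continuous family $\alpha(t)$ of Lagrangian subspaces of $(\xi_{\ell(t)},d\lambda)$ with $\alpha(0)=T_{\ell(0)}R$, $\alpha(1)=T_{\ell(1)}R'$. A Reeb chord from $R$ to $R'$ is a pair $(\gamma,T)$ with $T\in\mathbb R$, $\dot\gamma=T R_\lambda(\gamma)$ on $[0,1]$, $\gamma(0)\in R$, $\gamma(1)\in R'$; with $\phi^s$ the (local) Reeb flow, it is nondegenerate if $d\phi^{T}(T_{\gamma(0)}R)\pitchfork T_{\gamma(1)}R'$ in $\xi_{\gamma(1)}$. For a nondegenerate chord let $\beta_\gamma$ be the path of Lagrangian subspaces from $T_{\gamma(0)}R$ to $T_{\gamma(1)}R'$ over $\gamma$ given by $d\phi^{Tt}(T_{\gamma(0)}R)$, $t\in[0,1]$, followed by the reverse of a path $\alpha^-$ in $\mathrm{Lag}(\xi_{\gamma(1)})$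 from $\alpha^-(0)=T_{\gamma(1)}R'$ to $\alpha^-(1)=d\phi^{T}(T_{\gamma(0)}R)$ which is transversal to $T_{\gamma(1)}R'$ for $t>0$ and for which $-(\alpha^-)'(0)$ is positive definite. Let $\pi_2(\ell;\gamma)$ be the set of homotopy classes of bounding squares, i.e. continuous $w:[0,1]^2\to M$ with $w(0,t)=\ell(t)$, $w(1,t)=\gamma(t)$, $w(s,0)\in R$, $w(s,1)\in R'$. For $R_0,\dots,R_k$ $(k\ge 1)$ and chords $\gamma_i$ from $R_{i-1}$ to $R_i$ $(1\le i\le k)$ and $\gamma_0$ from $R_0$ to $R_k$, let $\pi_2(\vec R;\vec\gamma)$ be the set of homotopy classes of polygons: maps of a disc with $k+1$ boundary punctures (compactified by intervals), whose oriented boundary runs through $R_0$, $\gamma_0$, then $R_k$, $\gamma_k$ backward, $R_{k-1}$, …, $R_1$, $\gamma_1$ backward. Let $\mu_1$ be the Maslov index, in a symplectic trivialization of $w^*\xi$, of the loop of Lagrangian subspaces over the (counterclockwise) boundary of a bounding square $w$ given by $\alpha$ run backward, $TR$ along $w(s,0)$, $\beta_\gamma$, and $TR'$ along $w(s,1)$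 run backward. Let $\mu_{k+1}$ be the Maslov index of the loop over the boundary of a polygon given by the $TR_i$ along the boundary arcs, $\beta_{\gamma_0}$ at $\gamma_0$, and $\beta_{\gamma_i}$ run backward at $\gamma_i$, $1\le i\le k$. Given graded bridges $\ell_{(i-1)i}$ from $R_{i-1}$ to $R_i$, bounding squares $w_i$ of $(\ell_{(i-1)i},\gamma_i)$ and a polygon $u$, gluing the $w_i$ to $u$ along the $\gamma_i$ gives a bounding square of $(\ell_{0k},\gamma_0)$, where the graded bridge $\ell_{0k}$ is the concatenation of $\ell_{01},\dots,\ell_{(k-1)k}$ with arcs in $R_1,\dots,R_{k-1}$ graded by the tangent spaces $TR_i$. Its class is written $([w_1]\#\cdots\#[w_k])\#[u]$. Proposition. Such gluings always exist. For nondegenerate chords, $\mu_1:\pi_2(\ell;\gamma)\to\mathbb Z$ and $\mu_{k+1}:\pi_2(\vec R;\vec\gamma)\to\mathbb Z$ are well defined (independent of all choices and of the representative), and $\{\mu_k\}_{k\ge1}$ is an abstract index with values in the additive monoid $(\mathbb Z,+)$: for all $k\ge1$ and all classes, $$\sum_{i=1}^{k}\mu_1([w_i])+\mu_{k+1}(B)=\mu_1\big(([w_1]\#\cdots\#[w_k])\#B\big).$$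 -/

import Mathlib

open Set Filter Topology
open scoped Manifold ContDiff

local notation "𝕀" => unitInterval

noncomputable section

namespace LegendrianIndex

/-! ## Contact forms -/

/-- The model vector space of a `(2n+1)`-dimensional manifold. -/
abbrev Model (n : ℕ) : Type := EuclideanSpace ℝ (Fin (2 * n + 1))

section Contact

variable {n : ℕ} {M : Type*} [TopologicalSpace M] [ChartedSpace (Model n) M]

/-- The expression of a one-form `α` in the preferred chart at `x₀`, i.e. the pull-back of `α` by the
inverse of this chart. -/
def localForm (α : ∀ x : M, TangentSpace (𝓡 (2 * n + 1)) x →L[ℝ] ℝ) (x₀ : M) :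
    Model n → (Model n →L[ℝ] ℝ) := fun y =>
  (α ((extChartAt (𝓡 (2 * n + 1)) x₀).symm y)).comp
    (mfderiv 𝓘(ℝ, Model n) (𝓡 (2 * n + 1)) (extChartAt (𝓡 (2 * n + 1)) x₀).symm y)

/-- The exterior derivative `dα` of a one-form at the point `x`, computed in the preferred chart at
`x` (through which the tangent space at `x` is identified with the model space):
`dα(v, w) = D_v α(w) - D_w α(v)`. -/
def extDerivAt (α : ∀ x : M, TangentSpace (𝓡 (2 * n + 1)) x →L[ℝ] ℝ) (x : M) :
    TangentSpace (𝓡 (2 * n + 1)) x →L[ℝ] TangentSpace (𝓡 (2 * n + 1)) x →L[ℝ] ℝ :=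
  let A : Model n →L[ℝ] Model n →L[ℝ] ℝ :=
    fderiv ℝ (localForm α x) (extChartAt (𝓡 (2 * n + 1)) x x)
  (A - A.flip : Model n →L[ℝ] Model n →L[ℝ] ℝ)

end Contact

/-- A contact form on a manifold of dimension `2n+1`: a smooth one-form `λ`, nowhere zero, such that
`dλ` is nondegenerate on the hyperplane field `ξ = ker λ`. -/
structure ContactForm (n : ℕ) (M : Type*) [TopologicalSpace M] [ChartedSpace (Model n) M] where
  form : ∀ x : M, TangentSpace (𝓡 (2 * n + 1)) x →L[ℝ] ℝ
  smooth : ∀ x₀ : M,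
    ContDiffOn ℝ ∞ (localForm form x₀) (extChartAt (𝓡 (2 * n + 1)) x₀).target
  ne_zero : ∀ x, form x ≠ 0
  nondegenerate : ∀ x v, form x v = 0 →
    (∀ w, form x w = 0 → extDerivAt form x v w = 0) → v = 0

section Main

variable {n : ℕ} {M : Type*} [TopologicalSpace M] [ChartedSpace (Model n) M]

namespace ContactForm

variable (lam : ContactForm n M)

/-- The two-form `dλ` at `x`. -/
def d (x : M) :
    TangentSpace (𝓡 (2 * n + 1)) x →L[ℝ] TangentSpace (𝓡 (2 * n + 1)) x →L[ℝ] ℝ :=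
  extDerivAt lam.form x

theorem d_self (x : M) (v : TangentSpace (𝓡 (2 * n + 1)) x) : lam.d x v v = 0 :=
  sub_self _

theorem d_swap (x : M) (v w : TangentSpace (𝓡 (2 * n + 1)) x) :
    lam.d x v w = - lam.d x w v := by
  have h := lam.d_self x (v + w)
  simp only [map_add, add_apply, d_self] at h
  linarith

/-- At every point there is exactly one vector `v` with `λ(v) = 1` and `dλ(v, ·) = 0`. -/
theorem existsUnique_reeb (x : M) :
    ∃! v : TangentSpace (𝓡 (2 * n + 1)) x, lam.form x v = 1 ∧ ∀ w, lam.d x v w = 0 := by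
  obtain ⟨z, hz⟩ : ∃ z, lam.form x z = 1 := by
    by_contra! h
    apply lam.ne_zero x
    ext v
    by_contra hv
    refine h ((lam.form x v)⁻¹ • v) ?_
    rw [map_smul, smul_eq_mul]
    exact inv_mul_cancel₀ hv
  let K : Submodule ℝ (TangentSpace (𝓡 (2 * n + 1)) x) := (lam.form x).toLinearMap.ker
  have : FiniteDimensional ℝ (TangentSpace (𝓡 (2 * n + 1)) x) :=
    inferInstanceAs (FiniteDimensional ℝ (Model n))
  let B : K →ₗ[ℝ] Module.Dual ℝ K :=
    { toFun := fun v => (lam.d x v).toLinearMap.domRestrict K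
      map_add' := fun v w => by ext; simp
      map_smul' := fun c v => by ext; simp }
  have hB : Function.Injective B := by
    rw [injective_iff_map_eq_zero]
    intro v hv
    have hv' : (v : TangentSpace (𝓡 (2 * n + 1)) x) = 0 := by
      refine lam.nondegenerate x v v.2 fun w hw => ?_
      exact congrArg (fun g : Module.Dual ℝ K => g ⟨w, hw⟩) hv
    exact Subtype.ext hv'
  have hBs : Function.Surjective B :=
    (LinearMap.injective_iff_surjective_of_finrank_eq_finrank
      (Subspace.dual_finrank_eq (K := ℝ) (V := K)).symm).1 hB
  obtain ⟨u, hu⟩ := hBs ((lam.d x z).toLinearMap.domRestrict K)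
  have hu' : ∀ w, lam.form x w = 0 → lam.d x u w = lam.d x z w := fun w hw =>
    congrArg (fun g : Module.Dual ℝ K => g ⟨w, hw⟩) hu
  have hu0 : lam.form x u = 0 := u.2
  have key : ∀ w, lam.d x (z - u) w = 0 := by
    intro w
    have h1 : lam.d x (z - u) (w - lam.form x w • (z - u)) = 0 := by
      have := hu' (w - lam.form x w • (z - u)) (by simp [hz, hu0])
      rw [map_sub (lam.d x), sub_apply, this, sub_self]
    rw [map_sub, map_smul, d_self, smul_zero, sub_zero] at h1
    exact h1
  refine ⟨z - u, ⟨by simp [hz, hu0], key⟩, ?_⟩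
  rintro v ⟨hv1, hv2⟩
  refine sub_eq_zero.1 (lam.nondegenerate x _ (by simp [hv1, hz, hu0]) fun w _ => ?_)
  have : lam.d x (v - (z - u)) w = 0 := by
    rw [map_sub (lam.d x), sub_apply, hv2, key, sub_self]
  exact this

/-- The Reeb vector field `R_λ`: `λ(R_λ) = 1`, `dλ(R_λ, ·) = 0`. -/
def reeb (x : M) : TangentSpace (𝓡 (2 * n + 1)) x :=
  (lam.existsUnique_reeb x).choose

theorem reeb_spec (x : M) :
    lam.form x (lam.reeb x) = 1 ∧ ∀ w, lam.d x (lam.reeb x) w = 0 :=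
  (lam.existsUnique_reeb x).choose_spec.1

/-- Lagrangian subspaces of the symplectic vector space `(ξ_x, dλ)`. -/
def IsLagrangian (x : M) (V : Submodule ℝ (TangentSpace (𝓡 (2 * n + 1)) x)) : Prop :=
  (∀ v ∈ V, lam.form x v = 0) ∧ (∀ v ∈ V, ∀ w ∈ V, lam.d x v w = 0) ∧
    Module.finrank ℝ V = n

end ContactForm

/-- Points of the Grassmann bundle of `TM`: a point of `M` with a subspace of its tangent space. -/
abbrev Plane (n : ℕ) (M : Type*) [TopologicalSpace M] [ChartedSpace (Model n) M] : Type _ :=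
  (x : M) × Submodule ℝ (TangentSpace (𝓡 (2 * n + 1)) x)

variable [IsManifold (𝓡 (2 * n + 1)) ∞ M]

/-- `P` is a continuous section of `c^*Λ`, where `Λ → M` is the bundle of Lagrangian Grassmannians of
`(ξ, dλ)` and `c` is a path in `M`: each `P t` is a Lagrangian subspace of `ξ_{c(t)}`, and locally
in `t` these subspaces are spanned by continuous vector fields along `c`. -/
def IsLagrangianSection (lam : ContactForm n M) (c : 𝕀 → M) (P : 𝕀 → Plane n M) : Prop :=
  (∀ t, (P t).1 = c t ∧ lam.IsLagrangian (P t).1 (P t).2) ∧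
  ∀ t₀ : 𝕀, ∃ U ∈ 𝓝 t₀, ∃ v : Fin n → ∀ t : 𝕀, TangentSpace (𝓡 (2 * n + 1)) (c t),
    (∀ i, ContinuousOn
      (fun t => (⟨c t, v i t⟩ : TangentBundle (𝓡 (2 * n + 1)) M)) U) ∧
    ∀ t ∈ U, P t = ⟨c t, Submodule.span ℝ (range fun i => v i t)⟩

/-- The tangent space at `x` of a submanifold `R ⊆ M`: it consists of the velocities at `x` of the
curves that run inside `R`. -/
def tangentAt (R : Set M) (x : M) : Submodule ℝ (TangentSpace (𝓡 (2 * n + 1)) x) :=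
  Submodule.span ℝ {v | ∃ (c : ℝ → M) (v₀ : TangentSpace (𝓡 (2 * n + 1)) (c 0)),
    (∀ t, c t ∈ R) ∧
    HasMFDerivAt 𝓘(ℝ, ℝ) (𝓡 (2 * n + 1)) c 0 ((1 : ℝ →L[ℝ] ℝ).smulRight v₀) ∧
    (⟨c 0, v₀⟩ : TangentBundle (𝓡 (2 * n + 1)) M) = ⟨x, v⟩}

/-- A connected Legendrian submanifold of `(M, λ)`: a connected subset which is an embedded smooth
`n`-dimensional submanifold (it has slice charts) and is tangent to `ξ = ker λ`. -/
structure Legendrian (lam : ContactForm n M) where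
  carrier : Set M
  connected : IsConnected carrier
  slice : ∀ x ∈ carrier, ∃ φ ∈ IsManifold.maximalAtlas (𝓡 (2 * n + 1)) ∞ M, x ∈ φ.source ∧
    ∃ W : Submodule ℝ (Model n), Module.finrank ℝ W = n ∧
      ∀ y ∈ φ.source, (y ∈ carrier ↔ φ y ∈ W)
  tangent : ∀ x ∈ carrier, ∀ v ∈ tangentAt (n := n) carrier x, lam.form x v = 0

variable {lam : ContactForm n M}

/-- The Gauss map `x ↦ T_x R`. -/
def Legendrian.gauss (R : Legendrian lam) (x : M) : Plane n M := ⟨x, tangentAt R.carrier x⟩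

/-! ## Graded bridges and Reeb chords -/

/-- A graded bridge from `R` to `R'`: a path `ℓ` from `R` to `R'` with a Lagrangian section along
it, which starts at the tangent space of `R` and ends at the tangent space of `R'`. -/
structure GradedBridge (R R' : Legendrian lam) where
  path : C(𝕀, M)
  source_mem : path 0 ∈ R.carrier
  target_mem : path 1 ∈ R'.carrier
  grading : 𝕀 → Plane n M
  isSection : IsLagrangianSection lam path grading
  grading_zero : grading 0 = R.gauss (path 0)
  grading_one : grading 1 = R'.gauss (path 1)

/-- An iso-speed Reeb chord `(γ, T)` from `R` to `R'`: `γ' = T R_λ(γ)` on `[0,1]`, where `T` may have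
any sign. -/
structure ReebChord (R R' : Legendrian lam) where
  path : C(𝕀, M)
  period : ℝ
  source_mem : path 0 ∈ R.carrier
  target_mem : path 1 ∈ R'.carrier
  isIntegralCurve : IsMIntegralCurveOn (IccExtend zero_le_one path)
    (fun x => period • lam.reeb x) (Icc 0 1)

variable {R R' : Legendrian lam}

namespace ReebChord

/-- `Φ t = φ^{T t}`, the flow of `T R_λ` for times `t` near `[0,1]`, is defined and smooth near the
starting point of the chord `(γ, T)`; its trajectory through that point is the chord. -/
def IsLocalFlow (γ : ReebChord R R') (Φ : ℝ → M → M) : Prop :=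
  ∃ ε > (0 : ℝ), ∃ U : Set M, IsOpen U ∧ γ.path 0 ∈ U ∧
    ContMDiffOn (𝓘(ℝ, ℝ).prod (𝓡 (2 * n + 1))) (𝓡 (2 * n + 1)) ∞
      (fun p : ℝ × M => Φ p.1 p.2) (Ioo (-ε) (1 + ε) ×ˢ U) ∧
    (∀ x ∈ U, Φ 0 x = x) ∧
    (∀ x ∈ U, IsMIntegralCurveOn (fun t => Φ t x)
      (fun y => γ.period • lam.reeb y) (Ioo (-ε) (1 + ε))) ∧
    ∀ t : 𝕀, Φ t (γ.path 0) = γ.path t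

/-- The Lagrangian path `α_γ(t) = dφ^{T t}(T_{γ(0)} R)` along the chord. -/
def transport (γ : ReebChord R R') (Φ : ℝ → M → M) (t : 𝕀) : Plane n M :=
  ⟨Φ t (γ.path 0),
    (tangentAt R.carrier (γ.path 0)).map
      (mfderiv (𝓡 (2 * n + 1)) (𝓡 (2 * n + 1)) (Φ t) (γ.path 0)).toLinearMap⟩

/-- Nondegeneracy of a Reeb chord: `dφ^T(T_{γ(0)} R)` and `T_{γ(1)} R'` are transversal in `ξ_{γ(1)}`.
Both are Lagrangian in `ξ_{γ(1)}`, so this means that they meet only in `0`. -/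
def Nondegenerate (γ : ReebChord R R') : Prop :=
  ∃ Φ, γ.IsLocalFlow Φ ∧ ∃ V : Submodule ℝ (TangentSpace (𝓡 (2 * n + 1)) (γ.path 1)),
    γ.transport Φ 1 = ⟨γ.path 1, V⟩ ∧ V ⊓ tangentAt R'.carrier (γ.path 1) = ⊥

/-- The path `α⁻` of Lagrangian subspaces of `ξ_{γ(1)}` used at the end point of the chord: it runs
from `T_{γ(1)} R'` to `dφ^T(T_{γ(0)} R)`, stays transversal to `T_{γ(1)} R'` for positive times, and
`-(α⁻)'` is positively directed at its start. The velocity of `α⁻` at `0` is the quadratic form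
`v ↦ dλ(v, c'(0))` on `T_{γ(1)} R'`, where `c` is a curve with `c(0) = v` and `c(t) ∈ α⁻(t)`. -/
def IsClosingPath (γ : ReebChord R R') (Φ : ℝ → M → M)
    (K : 𝕀 → Submodule ℝ (TangentSpace (𝓡 (2 * n + 1)) (γ.path 1))) : Prop :=
  IsLagrangianSection lam (fun _ => γ.path 1) (fun t => ⟨γ.path 1, K t⟩) ∧
  K 0 = tangentAt R'.carrier (γ.path 1) ∧
  γ.transport Φ 1 = ⟨γ.path 1, K 1⟩ ∧
  (∀ t : 𝕀, 0 < t → K t ⊓ tangentAt R'.carrier (γ.path 1) = ⊥) ∧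
  ∀ v ∈ tangentAt R'.carrier (γ.path 1), v ≠ 0 →
    ∃ (c : ℝ → TangentSpace (𝓡 (2 * n + 1)) (γ.path 1))
      (c' : TangentSpace (𝓡 (2 * n + 1)) (γ.path 1)),
      c 0 = v ∧ (∀ t : 𝕀, c t ∈ K t) ∧ HasDerivWithinAt c c' (Icc 0 1) 0 ∧
        lam.d (γ.path 1) v c' < 0

end ReebChord

/-! ## Rotation of Lagrangian paths in a symplectic trivialization -/

/-- A continuous symplectic frame of `w^*ξ`, i.e. a symplectic trivialization of this bundle. -/
structure SymplecticFrame (lam : ContactForm n M) {X : Type*} [TopologicalSpace X] (w : X → M) where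
  e : Fin n → ∀ z : X, TangentSpace (𝓡 (2 * n + 1)) (w z)
  f : Fin n → ∀ z : X, TangentSpace (𝓡 (2 * n + 1)) (w z)
  continuous_e : ∀ i,
    Continuous fun z => (⟨w z, e i z⟩ : TangentBundle (𝓡 (2 * n + 1)) M)
  continuous_f : ∀ i,
    Continuous fun z => (⟨w z, f i z⟩ : TangentBundle (𝓡 (2 * n + 1)) M)
  form_e : ∀ i z, lam.form (w z) (e i z) = 0
  form_f : ∀ i z, lam.form (w z) (f i z) = 0
  d_e_e : ∀ i j z, lam.d (w z) (e i z) (e j z) = 0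
  d_f_f : ∀ i j z, lam.d (w z) (f i z) (f j z) = 0
  d_e_f : ∀ i j z, lam.d (w z) (e i z) (f j z) = if i = j then 1 else 0

namespace SymplecticFrame

variable {X : Type*} [TopologicalSpace X] {w : X → M}

/-- `θ` is a phase of the Lagrangian plane `P ⊆ ξ_{w(z)}` in the trivialization `F`. If `v₁, …, v_n` is
a basis of `P`, with `v_j = ∑ a_ij e_i + b_ij f_i`, and `D = det(a_ij + √-1 b_ij)`, this means that
`D² / |D|² = exp(2π√-1 θ)`; the left hand side is the map `Lag(ℝ²ⁿ) → S¹` whose degree on loops is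
the Maslov index. -/
def HasPhase (F : SymplecticFrame lam w) (z : X) (P : Plane n M) (θ : ℝ) : Prop :=
  ∃ v : Fin n → TangentSpace (𝓡 (2 * n + 1)) (w z),
    P = ⟨w z, Submodule.span ℝ (range v)⟩ ∧
    ∃ D : ℂ, D = Matrix.det (Matrix.of fun i j : Fin n =>
        ((lam.d (w z) (v j) (F.f i z) : ℝ) : ℂ) +
          ((lam.d (w z) (F.e i z) (v j) : ℝ) : ℂ) * Complex.I) ∧
      (D / (‖D‖ : ℂ)) ^ 2 = Complex.exp (2 * Real.pi * θ * Complex.I)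

/-- Along the path `σ` in the domain, the path `P` of Lagrangian planes has total rotation `r`: some
continuous phase of `P` increases by `r`. For a loop this is its Maslov index. -/
def HasRotation (F : SymplecticFrame lam w) (σ : 𝕀 → X) (P : 𝕀 → Plane n M) (r : ℝ) : Prop :=
  ∃ θ : C(𝕀, ℝ), (∀ t, F.HasPhase (σ t) (P t) (θ t)) ∧ r = θ 1 - θ 0

end SymplecticFrame

/-! ## Bounding squares and their Maslov index -/

/-- Bounding squares, with the compact-open topology: continuous maps `w : [0,1]² → M` with
`w(s,0) ∈ R`, `w(s,1) ∈ R'`, `w(0,t) = ℓ(t)` and `w(1,t) = γ(t)`. -/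
abbrev Square (ℓ : GradedBridge R R') (γ : ReebChord R R') : Type _ :=
  {w : C(𝕀 × 𝕀, M) // (∀ s, w (s, 0) ∈ R.carrier) ∧ (∀ s, w (s, 1) ∈ R'.carrier) ∧
    (∀ t, w (0, t) = ℓ.path t) ∧ (∀ t, w (1, t) = γ.path t)}

/-- `π₂(ℓ; γ)`: homotopy classes of bounding squares. -/
abbrev SquareClass (ℓ : GradedBridge R R') (γ : ReebChord R R') : Type _ :=
  ZerothHomotopy (Square ℓ γ)

/-- `m` is the Maslov index of the bounding square `w`, i.e. of the loop of Lagrangians over the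
boundary of the square, run counterclockwise:
`ℓ` backward with the grading `α_ℓ`, then `T R` along the bottom, `α_γ` up the right side, then the
closing path from `dφ^T(T_{γ(0)} R)` to `T_{γ(1)} R'` (this is `α⁻` run backward) over the corner
`(1,1)`, and `T R'` along the top, run backward. A side that is run backward counts with a minus sign. -/
def IsSquareIndex {ℓ : GradedBridge R R'} {γ : ReebChord R R'} (w : Square ℓ γ) (m : ℤ) : Prop :=
  ∃ (F : SymplecticFrame lam w.1) (Φ : ℝ → M → M)
    (K : 𝕀 → Submodule ℝ (TangentSpace (𝓡 (2 * n + 1)) (γ.path 1)))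
    (left bottom right corner top : ℝ),
    γ.IsLocalFlow Φ ∧ γ.IsClosingPath Φ K ∧
    F.HasRotation (fun t => (0, t)) ℓ.grading left ∧
    F.HasRotation (fun s => (s, 0)) (fun s => R.gauss (w.1 (s, 0))) bottom ∧
    F.HasRotation (fun t => (1, t)) (γ.transport Φ) right ∧
    F.HasRotation (fun _ => (1, 1)) (fun t => ⟨γ.path 1, K t⟩) corner ∧
    F.HasRotation (fun s => (s, 1)) (fun s => R'.gauss (w.1 (s, 1))) top ∧
    (m : ℝ) = - left + bottom + right - corner - top

/-! ## Polygons and their Maslov index -/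

/-- The affine parametrization of the `j`-th of `N` subintervals of `[0,1]` of equal length,
`t ↦ (j + t) / N` (for `j < N` this lies in `[0,1]`). -/
def sub (N j : ℕ) (t : 𝕀) : 𝕀 := projIcc (0 : ℝ) 1 zero_le_one (((j : ℝ) + t) / N)

variable {k : ℕ}

/-- Polygons, with the compact-open topology. A disc with boundary arcs on `R_0, …, R_{k+1}` and
`k + 2` boundary punctures, each of them compactified by an interval on which the map is the
asymptotic Reeb chord, is written as a square: `u` maps the bottom side to `R_0`, the top side to
`R_{k+1}`, is the output chord `γ₀` from `R_0` to `R_{k+1}` on the right side, and on the left side,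
cut into `2k + 1` intervals, runs alternately through the input chords `γ_i` from `R_i` to `R_{i+1}`
for `i = 0, …, k`, and inside `R_1, …, R_k`. -/
abbrev Polygon (R : Fin (k + 2) → Legendrian lam)
    (γ : ∀ i : Fin (k + 1), ReebChord (R i.castSucc) (R i.succ))
    (γ₀ : ReebChord (R 0) (R (Fin.last (k + 1)))) : Type _ :=
  {u : C(𝕀 × 𝕀, M) // (∀ s, u (s, 0) ∈ (R 0).carrier) ∧
    (∀ s, u (s, 1) ∈ (R (Fin.last (k + 1))).carrier) ∧
    (∀ t, u (1, t) = γ₀.path t) ∧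
    (∀ (i : Fin (k + 1)) (t : 𝕀), u (0, sub (2 * k + 1) (2 * (i : ℕ)) t) = (γ i).path t) ∧
    (∀ (i : Fin k) (t : 𝕀),
      u (0, sub (2 * k + 1) (2 * (i : ℕ) + 1) t) ∈ (R i.succ.castSucc).carrier)}

/-- `π₂(R⃗; γ⃗)`: homotopy classes of polygons. -/
abbrev PolygonClass (R : Fin (k + 2) → Legendrian lam)
    (γ : ∀ i : Fin (k + 1), ReebChord (R i.castSucc) (R i.succ))
    (γ₀ : ReebChord (R 0) (R (Fin.last (k + 1)))) : Type _ :=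
  ZerothHomotopy (Polygon R γ γ₀)

/-- `m` is the Maslov index of the polygon `u`, i.e. of the loop of Lagrangians over its boundary, run
counterclockwise: the tangent spaces of the `R_i` over the boundary arcs; at the output chord the
path `α_γ` followed by the closing path, as for bounding squares; and at each input chord, which is
run backward, the reverse of that path. -/
def IsPolygonIndex {R : Fin (k + 2) → Legendrian lam}
    {γ : ∀ i : Fin (k + 1), ReebChord (R i.castSucc) (R i.succ)}
    {γ₀ : ReebChord (R 0) (R (Fin.last (k + 1)))} (u : Polygon R γ γ₀) (m : ℤ) : Prop :=
  ∃ (F : SymplecticFrame lam u.1) (Φ₀ : ℝ → M → M)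
    (K₀ : 𝕀 → Submodule ℝ (TangentSpace (𝓡 (2 * n + 1)) (γ₀.path 1)))
    (Φ : Fin (k + 1) → ℝ → M → M)
    (K : ∀ i : Fin (k + 1), 𝕀 → Submodule ℝ (TangentSpace (𝓡 (2 * n + 1)) ((γ i).path 1)))
    (bottom right corner top : ℝ) (chord closing : Fin (k + 1) → ℝ) (arc : Fin k → ℝ),
    γ₀.IsLocalFlow Φ₀ ∧ γ₀.IsClosingPath Φ₀ K₀ ∧
    (∀ i, (γ i).IsLocalFlow (Φ i) ∧ (γ i).IsClosingPath (Φ i) (K i)) ∧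
    F.HasRotation (fun s => (s, 0)) (fun s => (R 0).gauss (u.1 (s, 0))) bottom ∧
    F.HasRotation (fun t => (1, t)) (γ₀.transport Φ₀) right ∧
    F.HasRotation (fun _ => (1, 1)) (fun t => ⟨γ₀.path 1, K₀ t⟩) corner ∧
    F.HasRotation (fun s => (s, 1))
      (fun s => (R (Fin.last (k + 1))).gauss (u.1 (s, 1))) top ∧
    (∀ i : Fin (k + 1), F.HasRotation (fun t => (0, sub (2 * k + 1) (2 * (i : ℕ)) t))
      ((γ i).transport (Φ i)) (chord i)) ∧
    (∀ i : Fin (k + 1), F.HasRotation (fun _ => (0, sub (2 * k + 1) (2 * (i : ℕ)) 1))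
      (fun t => ⟨(γ i).path 1, K i t⟩) (closing i)) ∧
    (∀ i : Fin k, F.HasRotation (fun t => (0, sub (2 * k + 1) (2 * (i : ℕ) + 1) t))
      (fun t => (R i.succ.castSucc).gauss (u.1 (0, sub (2 * k + 1) (2 * (i : ℕ) + 1) t))) (arc i)) ∧
    (m : ℝ) = bottom + (right - corner) - top
      - ∑ i, (chord i - closing i) - ∑ i, arc i

/-! ## Gluing and abstract indices -/

/-- The graded bridge `ℓ₀` from `R_0` to `R_{k+1}` is a concatenation
`ℓ_0 # c_1 # ℓ_1 # c_2 # … # c_k # ℓ_k` of the given graded bridges `ℓ_i` from `R_i` to `R_{i+1}` with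
paths `c_i` in `R_i`, which are graded by the tangent spaces of `R_i`. -/
def IsCompositeBridge {R : Fin (k + 2) → Legendrian lam}
    (ℓ : ∀ i : Fin (k + 1), GradedBridge (R i.castSucc) (R i.succ))
    (ℓ₀ : GradedBridge (R 0) (R (Fin.last (k + 1)))) : Prop :=
  (∀ (i : Fin (k + 1)) (t : 𝕀),
    ℓ₀.path (sub (2 * k + 1) (2 * (i : ℕ)) t) = (ℓ i).path t ∧
    ℓ₀.grading (sub (2 * k + 1) (2 * (i : ℕ)) t) = (ℓ i).grading t) ∧
  (∀ (i : Fin k) (t : 𝕀),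
    ℓ₀.path (sub (2 * k + 1) (2 * (i : ℕ) + 1) t) ∈ (R i.succ.castSucc).carrier ∧
    ℓ₀.grading (sub (2 * k + 1) (2 * (i : ℕ) + 1) t) =
      (R i.succ.castSucc).gauss (ℓ₀.path (sub (2 * k + 1) (2 * (i : ℕ) + 1) t)))

/-- The bounding square `W` is obtained by gluing the bounding squares `w_i` to the polygon `u` along
the input chords `γ_i`: the right half of `W` is `u`, the left half contains `w_0, …, w_k`, placed one
above another at the heights of the chords, and maps the strip between `w_{i-1}` and `w_i` into `R_i`.
So, up to homotopy in `R_i`, the arc `c_i` on the left side of this strip is the concatenation of the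
top side of `w_{i-1}`, the arc of `u` in `R_i`, and the bottom side of `w_i` run backward. -/
def IsGluing {R : Fin (k + 2) → Legendrian lam}
    {ℓ : ∀ i : Fin (k + 1), GradedBridge (R i.castSucc) (R i.succ)}
    {γ : ∀ i : Fin (k + 1), ReebChord (R i.castSucc) (R i.succ)}
    {ℓ₀ : GradedBridge (R 0) (R (Fin.last (k + 1)))}
    {γ₀ : ReebChord (R 0) (R (Fin.last (k + 1)))}
    (w : ∀ i, Square (ℓ i) (γ i)) (u : Polygon R γ γ₀) (W : Square ℓ₀ γ₀) : Prop :=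
  IsCompositeBridge ℓ ℓ₀ ∧
  (∀ s t, W.1 (sub 2 1 s, t) = u.1 (s, t)) ∧
  (∀ (i : Fin (k + 1)) (s t : 𝕀),
    W.1 (sub 2 0 s, sub (2 * k + 1) (2 * (i : ℕ)) t) = (w i).1 (s, t)) ∧
  (∀ (i : Fin k) (s t : 𝕀),
    W.1 (sub 2 0 s, sub (2 * k + 1) (2 * (i : ℕ) + 1) t) ∈ (R i.succ.castSucc).carrier)

/-- The gluing map on homotopy classes: the class `c` is `(a_0 # … # a_k) # B`. -/
def IsGluedClass {R : Fin (k + 2) → Legendrian lam}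
    {ℓ : ∀ i : Fin (k + 1), GradedBridge (R i.castSucc) (R i.succ)}
    {γ : ∀ i : Fin (k + 1), ReebChord (R i.castSucc) (R i.succ)}
    {ℓ₀ : GradedBridge (R 0) (R (Fin.last (k + 1)))}
    {γ₀ : ReebChord (R 0) (R (Fin.last (k + 1)))}
    (a : ∀ i, SquareClass (ℓ i) (γ i)) (B : PolygonClass R γ γ₀) (c : SquareClass ℓ₀ γ₀) :
    Prop :=
  ∃ (w : ∀ i, Square (ℓ i) (γ i)) (u : Polygon R γ γ₀) (W : Square ℓ₀ γ₀),
    (∀ i, Quotient.mk _ (w i) = a i) ∧ Quotient.mk _ u = B ∧ Quotient.mk _ W = c ∧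
    IsGluing w u W

/-- A graded bridged link with `k + 2` components `R_0, …, R_{k+1}`: a tuple of connected Legendrian
submanifolds with a graded bridge `ℓ_ij` from `R_i` to `R_j` for each pair of components. (The
components need not be disjoint.) -/
structure GradedBridgedLink (lam : ContactForm n M) (k : ℕ) where
  comp : Fin (k + 2) → Legendrian lam
  bridge : ∀ i j, GradedBridge (comp i) (comp j)

/-- A collection `{I_k}` of maps with values in `A`: the map `one` is `I_1`, on the classes of bounding
squares; `poly E γ γ₀` is `I_{k+2}`, on the classes of polygons on a graded bridged link `E` with
`k + 2` components, which have `k + 1` input chords and one output chord. -/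
structure IndexSystem (lam : ContactForm n M) (A : Type*) where
  one : ∀ {R R' : Legendrian lam} (ℓ : GradedBridge R R') (γ : ReebChord R R'),
    SquareClass ℓ γ → A
  poly : ∀ {k : ℕ} (E : GradedBridgedLink lam k)
    (γ : ∀ i : Fin (k + 1), ReebChord (E.comp i.castSucc) (E.comp i.succ))
    (γ₀ : ReebChord (E.comp 0) (E.comp (Fin.last (k + 1)))), PolygonClass E.comp γ γ₀ → A

/-- Abstract index with values in a monoid `A` (whose operation, which need not be commutative, is
written additively): whenever `c` is glued from `a_0, …, a_k` and `B`, with nondegenerate chords,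
`I_1(a_0) + … + I_1(a_k) + I_{k+2}(B) = I_1(c)`. -/
def IndexSystem.IsAbstractIndex {A : Type*} [AddMonoid A] (ind : IndexSystem lam A) : Prop :=
  ∀ (k : ℕ) (E : GradedBridgedLink lam k)
    (γ : ∀ i : Fin (k + 1), ReebChord (E.comp i.castSucc) (E.comp i.succ))
    (γ₀ : ReebChord (E.comp 0) (E.comp (Fin.last (k + 1)))),
    (∀ i, (γ i).Nondegenerate) → γ₀.Nondegenerate →
    ∀ (a : ∀ i : Fin (k + 1), SquareClass (E.bridge i.castSucc i.succ) (γ i))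
      (B : PolygonClass E.comp γ γ₀)
      (c : SquareClass (E.bridge 0 (Fin.last (k + 1))) γ₀),
      IsGluedClass a B c →
      (List.ofFn fun i => ind.one _ _ (a i)).sum + ind.poly E γ γ₀ B = ind.one _ _ c

/-- `ind` is the Maslov system on classes with nondegenerate chords: on bounding squares it is the
Maslov index, and on polygons the polygonal Maslov index. In particular each of these indices
exists and depends only on the homotopy class, not on the choices in its definition. -/
def IndexSystem.IsMaslov (ind : IndexSystem lam ℤ) : Prop :=
  (∀ (R R' : Legendrian lam) (ℓ : GradedBridge R R') (γ : ReebChord R R'), γ.Nondegenerate →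
    ∀ (w : Square ℓ γ) (m : ℤ), IsSquareIndex w m ↔ ind.one ℓ γ (Quotient.mk _ w) = m) ∧
  (∀ (k : ℕ) (E : GradedBridgedLink lam k)
    (γ : ∀ i : Fin (k + 1), ReebChord (E.comp i.castSucc) (E.comp i.succ))
    (γ₀ : ReebChord (E.comp 0) (E.comp (Fin.last (k + 1)))),
    (∀ i, (γ i).Nondegenerate) → γ₀.Nondegenerate →
    ∀ (u : Polygon E.comp γ γ₀) (m : ℤ),
      IsPolygonIndex u m ↔ ind.poly E γ γ₀ (Quotient.mk _ u) = m)

end Main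

end LegendrianIndex

end

/-!
The Maslov indices are computed as total rotations. In a symplectic frame of `ξ` a Lagrangian
plane has a coordinate matrix `Z = X + √-1 Y`, its Souriau matrix `Z Z̄⁻¹` is unitary and depends
on the plane alone, and the argument of the determinant of that matrix, in multiples of `2π`, is
its phase, defined up to integers. Along a path of planes the phase has a continuous lift, whose
increment is the rotation of the path, and the Maslov index of a loop in a trivialization is the
sum of the rotations of its pieces. A change of frame has the form `z ↦ a z + b z̄`, and it alters
the phase of each plane by the argument of `det a / conj (det a)` and a contribution of `1 + a⁻¹ b
Ū`. The latter matrix lies in the star-shaped set `1 + logDomain n`, where the determinant has a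
canonical argument. Hence over a simply connected base the phases in two frames differ by a
function of point and plane (`SymplecticFrame.exists_shift`), so the rotation of a closed chain of
paths of planes (`IsCycle`) does not depend on the frame, and it is an integer. Frames over
squares and over cubes are glued from local ones (`exists_isFrameOn_cube`); a frame over the cube
of a homotopy shows that the rotation of a cycle is invariant under homotopy
(`rotation_homotopy`).

The planes in question do vary continuously. The tangent spaces of a Legendrian submanifold are
Lagrangian: as `λ` pulls back to zero, so does `dλ` (`Legendrian.isLagSec_gauss`). The Reeb flow
preserves `λ` and `dλ` (`lamAt_omegaAt_flow`), and since `M` is Hausdorff any two local flows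
agree near the chord, so the transported planes are well defined (`transport_congr`).

The remaining choice is that of the closing path `α⁻` at the end of a chord. One exists, linear in
a pair of dual bases of the two transversal planes (`exists_isClosing`). For uniqueness, choose a
frame in which `α⁻` starts at `ℝⁿ` and ends at `√-1 ℝⁿ`. For `t > 0` transversality to `ℝⁿ` means
that the Souriau matrix `U(t)` does not have the eigenvalue `1`; for small `t` the matrix `-U(t)`
does not have it either. On unitary matrices without this eigenvalue the Cayley transform gives a
canonical phase. So the rotation is determined by the difference between the canonical phases of
`-U(t)` and `U(t)` at one small `t`, and this is given by the signs of the velocity form, which is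
negative definite (`rotation_adapted`). Hence it is the same for all closing paths
(`rotation_unique`). Together these facts give the indices of squares and polygons
(`exists_squareIndex`, `exists_polygonIndex`).

Gluing puts the squares beside the polygon along the chords. Between consecutive squares there
remains a gap; three of its sides, one from each of the two squares and an arc of the polygon, lie
in the same `R_i`, and it is filled inside `R_i` by retracting a square onto these three sides
(`exists_gluing`). For the additivity (`index_gluing`), take one frame over the glued square. The
rotations along the chords and the closing paths occur in the squares and in the polygon with
opposite signs, and the boundaries of the fillings rotate by zero because the fillings lie in a
single Legendrian submanifold each. What is left is the rotation along the boundary of the glued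
square.
-/

set_option linter.unusedSectionVars false

noncomputable section

namespace LegendrianIndex

/-! ### One-forms and their derivatives in charts -/

section Geometry

theorem two_le_infty : (2 : WithTop ℕ∞) ≤ ∞ := by
  exact WithTop.coe_le_coe.2 (le_top : (2 : ℕ∞) ≤ ⊤)

variable {n : ℕ} {M : Type*} [TopologicalSpace M] [ChartedSpace (Model n) M]
  [IsManifold (𝓡 (2 * n + 1)) ∞ M]

/-- The coordinates of tangent vectors at `y` in the preferred chart at `x₀`. -/
def coord (x₀ y : M) : Model n →L[ℝ] Model n :=
  mfderiv (𝓡 (2 * n + 1)) 𝓘(ℝ, Model n) (extChartAt (𝓡 (2 * n + 1)) x₀) y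

theorem coord_symm_comp {x₀ : M} {q : Model n}
    (hq : q ∈ (extChartAt (𝓡 (2 * n + 1)) x₀).target) (v : Model n) :
    mfderiv 𝓘(ℝ, Model n) (𝓡 (2 * n + 1)) (extChartAt (𝓡 (2 * n + 1)) x₀).symm q
      (coord x₀ ((extChartAt (𝓡 (2 * n + 1)) x₀).symm q) v) = v := by
  have h := mfderivWithin_extChartAt_symm_comp_mfderiv_extChartAt (I := 𝓡 (2 * n + 1)) hq
  rw [ModelWithCorners.range_eq_univ, mfderivWithin_univ] at h
  exact DFunLike.congr_fun h v

theorem coord_comp_symm {x₀ : M} {q : Model n}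
    (hq : q ∈ (extChartAt (𝓡 (2 * n + 1)) x₀).target) (v : Model n) :
    coord x₀ ((extChartAt (𝓡 (2 * n + 1)) x₀).symm q)
      (mfderiv 𝓘(ℝ, Model n) (𝓡 (2 * n + 1)) (extChartAt (𝓡 (2 * n + 1)) x₀).symm q v) = v := by
  have h := mfderiv_extChartAt_comp_mfderivWithin_extChartAt_symm (I := 𝓡 (2 * n + 1)) hq
  rw [ModelWithCorners.range_eq_univ, mfderivWithin_univ] at h
  exact DFunLike.congr_fun h v

theorem form_eq_localForm (α : ∀ x : M, TangentSpace (𝓡 (2 * n + 1)) x →L[ℝ] ℝ) {x₀ y : M}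
    (hy : y ∈ (extChartAt (𝓡 (2 * n + 1)) x₀).source) (v : Model n) :
    α y v = localForm α x₀ (extChartAt (𝓡 (2 * n + 1)) x₀ y) (coord x₀ y v) := by
  have h := coord_symm_comp ((extChartAt (𝓡 (2 * n + 1)) x₀).map_source hy) v
  have h2 := (extChartAt (𝓡 (2 * n + 1)) x₀).left_inv hy
  unfold localForm
  rw [h2] at h ⊢
  exact (congrArg (α y) h).symm

theorem mfderiv_eq_fderiv_chart {E : Type*} [NormedAddCommGroup E] [NormedSpace ℝ E]
    {g : E → M} {p : E} (hg : MDifferentiableAt 𝓘(ℝ, E) (𝓡 (2 * n + 1)) g p) :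
    mfderiv 𝓘(ℝ, E) (𝓡 (2 * n + 1)) g p =
      fderiv ℝ (fun q => extChartAt (𝓡 (2 * n + 1)) (g p) (g q)) p := by
  rw [hg.mfderiv]
  simp [writtenInExtChartAt, Function.comp_def]
  rfl

theorem fderiv_chart_comp {E : Type*} [NormedAddCommGroup E] [NormedSpace ℝ E]
    {g : E → M} {p : E} (hg : MDifferentiableAt 𝓘(ℝ, E) (𝓡 (2 * n + 1)) g p) {x₀ : M}
    (hx : g p ∈ (extChartAt (𝓡 (2 * n + 1)) x₀).source) (v : E) :
    fderiv ℝ (fun q => extChartAt (𝓡 (2 * n + 1)) x₀ (g q)) p v =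
      coord x₀ (g p) (mfderiv 𝓘(ℝ, E) (𝓡 (2 * n + 1)) g p v) := by
  rw [extChartAt_source] at hx
  have h1 := mfderiv_comp p (mdifferentiableAt_extChartAt (I := 𝓡 (2 * n + 1)) hx) hg
  have h2 : mfderiv 𝓘(ℝ, E) 𝓘(ℝ, Model n) (extChartAt (𝓡 (2 * n + 1)) x₀ ∘ g) p v =
      fderiv ℝ (fun q => extChartAt (𝓡 (2 * n + 1)) x₀ (g q)) p v := by
    rw [mfderiv_eq_fderiv]; rfl
  rw [← h2, h1]
  rfl

/-- The pull-back of a one-form under a map from a normed space. -/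
def pullbackForm {E : Type*} [NormedAddCommGroup E] [NormedSpace ℝ E]
    (α : ∀ x : M, TangentSpace (𝓡 (2 * n + 1)) x →L[ℝ] ℝ) (g : E → M) (q : E) : E →L[ℝ] ℝ :=
  (α (g q)).comp (mfderiv 𝓘(ℝ, E) (𝓡 (2 * n + 1)) g q)

theorem ContactForm.contDiffAt_localForm (lam : ContactForm n M) {x₀ y : M}
    (hy : y ∈ (extChartAt (𝓡 (2 * n + 1)) x₀).source) :
    ContDiffAt ℝ ∞ (localForm lam.form x₀) (extChartAt (𝓡 (2 * n + 1)) x₀ y) :=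
  (lam.smooth x₀).contDiffAt
    (extChartAt_target_mem_nhds' ((extChartAt (𝓡 (2 * n + 1)) x₀).map_source hy))

/-- In coordinates the pull-back of `λ` under `g` is `q ↦ A(ψ q) ∘ Dψ(q)`. Its derivative is the sum
of a term in `DA` and a term in the symmetric second derivative of `ψ`. -/
theorem hasFDerivAt_pullbackForm (lam : ContactForm n M) {E : Type*} [NormedAddCommGroup E]
    [NormedSpace ℝ E] {g : E → M} {p : E} (hg : ContMDiffAt 𝓘(ℝ, E) (𝓡 (2 * n + 1)) 2 g p) :
    DifferentiableAt ℝ (pullbackForm lam.form g) p ∧ ∀ u v : E,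
      fderiv ℝ (pullbackForm lam.form g) p u v - fderiv ℝ (pullbackForm lam.form g) p v u =
        lam.d (g p) (mfderiv 𝓘(ℝ, E) (𝓡 (2 * n + 1)) g p u)
          (mfderiv 𝓘(ℝ, E) (𝓡 (2 * n + 1)) g p v) := by
  set φ := extChartAt (𝓡 (2 * n + 1)) (g p) with hφ
  set A := localForm lam.form (g p) with hA
  set ψ : E → Model n := fun q => φ (g q) with hψdef
  have hsrc : g p ∈ φ.source := mem_extChartAt_source _
  have hψ : ContDiffAt ℝ 2 ψ p := by
    have h1 : ContMDiffAt (𝓡 (2 * n + 1)) 𝓘(ℝ, Model n) 2 φ (g p) :=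
      (contMDiffAt_extChartAt (n := ∞) (I := 𝓡 (2 * n + 1)) (x := g p)).of_le (two_le_infty)
    exact (h1.comp p hg).contDiffAt
  have hgd : ∀ᶠ q in 𝓝 p, MDifferentiableAt 𝓘(ℝ, E) (𝓡 (2 * n + 1)) g q :=
    ((contMDiffAt_iff_contMDiffAt_nhds (by simp)).1 hg).mono
      fun q hq => hq.mdifferentiableAt (by simp)
  have hev : pullbackForm lam.form g =ᶠ[𝓝 p] fun q => (A (ψ q)).comp (fderiv ℝ ψ q) := by
    have h2 : ∀ᶠ q in 𝓝 p, g q ∈ φ.source :=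
      hg.continuousAt.eventually (extChartAt_source_mem_nhds (g p))
    filter_upwards [hgd, h2] with q hq hq2
    ext v
    have := form_eq_localForm lam.form hq2 (mfderiv 𝓘(ℝ, E) (𝓡 (2 * n + 1)) g q v)
    rw [← fderiv_chart_comp hq hq2] at this
    exact this
  have hA' : HasFDerivAt A (fderiv ℝ A (ψ p)) (ψ p) :=
    ((lam.contDiffAt_localForm hsrc).differentiableAt (by simp)).hasFDerivAt
  have hψ1 : HasFDerivAt ψ (fderiv ℝ ψ p) p := (hψ.differentiableAt (by simp)).hasFDerivAt
  have hψ2 : HasFDerivAt (fderiv ℝ ψ) (fderiv ℝ (fderiv ℝ ψ) p) p :=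
    ((hψ.fderiv_right (m := 1) (by norm_num)).differentiableAt (by simp)).hasFDerivAt
  have hB := (hA'.comp p hψ1).clm_comp hψ2
  have hB' := hB.congr_of_eventuallyEq hev
  refine ⟨hB'.differentiableAt, fun u v => ?_⟩
  -- The second derivative of `ψ` is symmetric and drops out of the antisymmetrization.
  have hsymm : IsSymmSndFDerivAt ℝ ψ p := hψ.isSymmSndFDerivAt (by simp)
  rw [hB'.fderiv, mfderiv_eq_fderiv_chart hgd.self_of_nhds]
  have h3 := hsymm.eq u v
  simp only [add_apply, ContinuousLinearMap.comp_apply, ContinuousLinearMap.compL_apply,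
    ContinuousLinearMap.flip_apply, h3, ContactForm.d, extDerivAt, Function.comp_apply]
  change _ = fderiv ℝ A (ψ p) (fderiv ℝ ψ p u) (fderiv ℝ ψ p v) -
    fderiv ℝ A (ψ p) (fderiv ℝ ψ p v) (fderiv ℝ ψ p u)
  ring

/-- Chart independence of the exterior derivative: `dλ` may be computed in any preferred chart. -/
theorem d_eq_localForm (lam : ContactForm n M) {x₀ y : M}
    (hy : y ∈ (extChartAt (𝓡 (2 * n + 1)) x₀).source) (v w : Model n) :
    lam.d y v w =
      fderiv ℝ (localForm lam.form x₀) (extChartAt (𝓡 (2 * n + 1)) x₀ y)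
        (coord x₀ y v) (coord x₀ y w) -
      fderiv ℝ (localForm lam.form x₀) (extChartAt (𝓡 (2 * n + 1)) x₀ y)
        (coord x₀ y w) (coord x₀ y v) := by
  have ht := (extChartAt (𝓡 (2 * n + 1)) x₀).map_source hy
  have hg : ContMDiffAt 𝓘(ℝ, Model n) (𝓡 (2 * n + 1)) 2 (extChartAt (𝓡 (2 * n + 1)) x₀).symm
      (extChartAt (𝓡 (2 * n + 1)) x₀ y) :=
    ((contMDiffOn_extChartAt_symm (n := ∞) x₀).contMDiffAt
      (extChartAt_target_mem_nhds' ht)).of_le (two_le_infty)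
  have h := (hasFDerivAt_pullbackForm lam hg).2 (coord x₀ y v) (coord x₀ y w)
  have h1 := coord_symm_comp ht v
  have h2 := coord_symm_comp ht w
  rw [(extChartAt (𝓡 (2 * n + 1)) x₀).left_inv hy] at h h1 h2
  rw [show localForm lam.form x₀ =
    pullbackForm lam.form (extChartAt (𝓡 (2 * n + 1)) x₀).symm from rfl,
    h, h1, h2]

end Geometry

/-! ### Continuous fields of vectors along maps -/

section Sections

theorem contDiff_flip {E : Type*} [NormedAddCommGroup E] [NormedSpace ℝ E] {m : WithTop ℕ∞} :
    ContDiff ℝ m (fun B : E →L[ℝ] E →L[ℝ] ℝ => B.flip) := by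
  refine IsBoundedLinearMap.contDiff
    (IsLinearMap.with_bound ⟨fun _ _ => rfl, fun _ _ => rfl⟩ 1 fun B => ?_)
  rw [one_mul, ContinuousLinearMap.opNorm_flip]

open Bundle

variable {n : ℕ} {M : Type*} [TopologicalSpace M] [ChartedSpace (Model n) M]
  [IsManifold (𝓡 (2 * n + 1)) ∞ M] {Y : Type*} [TopologicalSpace Y]

/-- `λ_x` as a linear form on the model space. -/
def ContactForm.lamAt (lam : ContactForm n M) (x : M) : Model n →L[ℝ] ℝ := lam.form x

/-- `dλ_x` as a bilinear form on the model space. -/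
def ContactForm.omegaAt (lam : ContactForm n M) (x : M) : Model n →L[ℝ] Model n →L[ℝ] ℝ := lam.d x

/-- The Reeb vector at `x` as an element of the model space. -/
def ContactForm.reebAt (lam : ContactForm n M) (x : M) : Model n := lam.reeb x

theorem ContactForm.omegaAt_self (lam : ContactForm n M) (x : M) (v : Model n) :
    lam.omegaAt x v v = 0 := lam.d_self x v

theorem ContactForm.omegaAt_swap (lam : ContactForm n M) (x : M) (v w : Model n) :
    lam.omegaAt x v w = - lam.omegaAt x w v := lam.d_swap x v w

theorem ContactForm.lamAt_reebAt (lam : ContactForm n M) (x : M) :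
    lam.lamAt x (lam.reebAt x) = 1 := (lam.reeb_spec x).1

theorem ContactForm.omegaAt_reebAt (lam : ContactForm n M) (x : M) (w : Model n) :
    lam.omegaAt x (lam.reebAt x) w = 0 := (lam.reeb_spec x).2 w

theorem ContactForm.omegaAt_nondegenerate (lam : ContactForm n M) {x : M} {v : Model n}
    (hv : lam.lamAt x v = 0) (h : ∀ w, lam.lamAt x w = 0 → lam.omegaAt x v w = 0) : v = 0 :=
  lam.nondegenerate x v hv h

theorem lamAt_eq_localForm (lam : ContactForm n M) {x₀ y : M}
    (hy : y ∈ (extChartAt (𝓡 (2 * n + 1)) x₀).source) (v : Model n) :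
    lam.lamAt y v = localForm lam.form x₀ (extChartAt (𝓡 (2 * n + 1)) x₀ y) (coord x₀ y v) :=
  form_eq_localForm lam.form hy v

theorem omegaAt_eq_localForm (lam : ContactForm n M) {x₀ y : M}
    (hy : y ∈ (extChartAt (𝓡 (2 * n + 1)) x₀).source) (v w : Model n) :
    lam.omegaAt y v w =
      fderiv ℝ (localForm lam.form x₀) (extChartAt (𝓡 (2 * n + 1)) x₀ y)
        (coord x₀ y v) (coord x₀ y w) -
      fderiv ℝ (localForm lam.form x₀) (extChartAt (𝓡 (2 * n + 1)) x₀ y)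
        (coord x₀ y w) (coord x₀ y v) :=
  d_eq_localForm lam hy v w

/-- The tangent vector `v` at `x`, as a point of the tangent bundle. -/
abbrev tvec (x : M) (v : Model n) : TangentBundle (𝓡 (2 * n + 1)) M := ⟨x, v⟩

theorem trivializationAt_tvec {x₀ x : M} (hx : x ∈ (extChartAt (𝓡 (2 * n + 1)) x₀).source)
    (v : Model n) :
    trivializationAt (Model n) (TangentSpace (𝓡 (2 * n + 1))) x₀ (tvec x v) =
      (x, coord x₀ x v) := by
  rw [extChartAt_source] at hx
  have h := TangentBundle.continuousLinearMapAt_trivializationAt (I := 𝓡 (2 * n + 1)) hx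
  have hb : x ∈ (trivializationAt (Model n)
      (TangentSpace (𝓡 (2 * n + 1)) : M → Type _) x₀).baseSet := by
    simpa using hx
  have h2 : (trivializationAt (Model n) (TangentSpace (𝓡 (2 * n + 1))) x₀ (tvec x v)).2 =
      coord x₀ x v := by
    have h3 := DFunLike.congr_fun h v
    have h4 := congrFun (Trivialization.coe_linearMapAt_of_mem (R := ℝ) _ hb) v
    exact h4.symm.trans h3
  refine Prod.ext ?_ h2
  exact Trivialization.coe_fst' _ hb

/-- A vector field along `c` is continuous if and only if `c` is and the coordinates of the vectors
in a fixed chart are. -/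
theorem continuousWithinAt_tvec_iff {c : Y → M} {v : Y → Model n} {S : Set Y} {t₀ : Y} {x₀ : M}
    (hx : c t₀ ∈ (extChartAt (𝓡 (2 * n + 1)) x₀).source) :
    ContinuousWithinAt (fun t => tvec (c t) (v t)) S t₀ ↔
      ContinuousWithinAt c S t₀ ∧ ContinuousWithinAt (fun t => coord x₀ (c t) (v t)) S t₀ := by
  set e := trivializationAt (Model n) (TangentSpace (𝓡 (2 * n + 1)) : M → Type _) x₀
  have hb : e.baseSet = (extChartAt (𝓡 (2 * n + 1)) x₀).source := by simp [e]
  have key : ContinuousWithinAt c S t₀ →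
      (ContinuousWithinAt (fun t => tvec (c t) (v t)) S t₀ ↔
        ContinuousWithinAt (fun t => (c t, coord x₀ (c t) (v t))) S t₀) := by
    intro hc
    have hev : ∀ᶠ t in 𝓝[S] t₀, c t ∈ (extChartAt (𝓡 (2 * n + 1)) x₀).source :=
      hc.eventually ((isOpen_extChartAt_source x₀).mem_nhds hx)
    rw [e.toOpenPartialHomeomorph.continuousWithinAt_iff_continuousWithinAt_comp_left]
    · refine Filter.EventuallyEq.congr_continuousWithinAt ?_ ?_
      · filter_upwards [hev] with t ht
        exact trivializationAt_tvec ht _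
      · exact trivializationAt_tvec hx _
    · exact e.mem_source.2 (hb ▸ hx)
    · filter_upwards [hev] with t ht
      exact e.mem_source.2 (hb ▸ ht)
  constructor
  · intro h
    have hc : ContinuousWithinAt c S t₀ :=
      (FiberBundle.continuous_proj (Model n)
        (TangentSpace (𝓡 (2 * n + 1)) : M → Type _)).continuousAt.comp_continuousWithinAt h
    exact ⟨hc, ((key hc).1 h).snd⟩
  · rintro ⟨hc, h⟩
    exact (key hc).2 (hc.prodMk h)

/-- `v` is a continuous vector field along `c` over the set `S`. -/
def IsField (c : Y → M) (v : Y → Model n) (S : Set Y) : Prop :=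
  ContinuousOn (fun t => tvec (c t) (v t)) S

variable {c : Y → M} {S : Set Y}

theorem isField_iff {v : Y → Model n} : IsField c v S ↔ ContinuousOn c S ∧ ∀ t₀ ∈ S,
    ContinuousWithinAt (fun t => coord (c t₀) (c t) (v t)) S t₀ := by
  constructor
  · intro h
    exact ⟨fun t ht => ((continuousWithinAt_tvec_iff (mem_extChartAt_source (c t))).1 (h t ht)).1,
      fun t ht => ((continuousWithinAt_tvec_iff (mem_extChartAt_source (c t))).1 (h t ht)).2⟩
  · rintro ⟨h1, h2⟩ t ht
    exact (continuousWithinAt_tvec_iff (mem_extChartAt_source (c t))).2 ⟨h1 t ht, h2 t ht⟩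

theorem IsField.continuousOn {v : Y → Model n} (h : IsField c v S) : ContinuousOn c S :=
  (isField_iff.1 h).1

theorem IsField.mono {v : Y → Model n} (h : IsField c v S) {T : Set Y} (hT : T ⊆ S) :
    IsField c v T := ContinuousOn.mono h hT

theorem IsField.congr {v w : Y → Model n} (h : IsField c v S) (hw : ∀ t ∈ S, w t = v t) :
    IsField c w S :=
  ContinuousOn.congr h fun t ht => by simp only [hw t ht]

theorem IsField.comp {Z : Type*} [TopologicalSpace Z] {v : Y → Model n} (h : IsField c v S)
    {σ : Z → Y} {T : Set Z} (hσ : ContinuousOn σ T) (hm : MapsTo σ T S) :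
    IsField (fun z => c (σ z)) (fun z => v (σ z)) T :=
  ContinuousOn.comp (g := fun t => tvec (c t) (v t)) h hσ hm

theorem IsField.zero (hc : ContinuousOn c S) : IsField (n := n) c (fun _ => 0) S :=
  isField_iff.2 ⟨hc, fun t _ => by simpa using continuousWithinAt_const⟩

theorem IsField.add {v w : Y → Model n} (hv : IsField c v S) (hw : IsField c w S) :
    IsField c (fun t => v t + w t) S := by
  rw [isField_iff] at *
  exact ⟨hv.1, fun t ht => by
    simp only [map_add]; exact (hv.2 t ht).add (hw.2 t ht)⟩

theorem IsField.smul {v : Y → Model n} {a : Y → ℝ} (ha : ContinuousOn a S) (hv : IsField c v S) :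
    IsField c (fun t => a t • v t) S := by
  rw [isField_iff] at *
  exact ⟨hv.1, fun t ht => by
    simp only [map_smul]; exact (ha t ht).smul (hv.2 t ht)⟩

theorem IsField.sub {v w : Y → Model n} (hv : IsField c v S) (hw : IsField c w S) :
    IsField c (fun t => v t - w t) S := by
  simpa [sub_eq_add_neg] using hv.add (hw.smul (continuousOn_const (c := (-1 : ℝ))))

theorem IsField.sum {ι : Type*} (s : Finset ι) {v : ι → Y → Model n} (hc : ContinuousOn c S)
    (hv : ∀ i ∈ s, IsField c (v i) S) : IsField c (fun t => ∑ i ∈ s, v i t) S := by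
  classical
  induction s using Finset.induction_on with
  | empty => simpa using IsField.zero hc
  | insert i s hi ih =>
    simp only [Finset.sum_insert hi]
    exact (hv i (by simp)).add (ih fun j hj => hv j (by simp [hj]))

theorem IsField.lamAt (lam : ContactForm n M) {v : Y → Model n} (hv : IsField c v S) :
    ContinuousOn (fun t => lam.lamAt (c t) (v t)) S := by
  intro t₀ ht₀
  have hc := hv.continuousOn t₀ ht₀
  have hsrc := mem_extChartAt_source (I := 𝓡 (2 * n + 1)) (c t₀)
  have hev : ∀ᶠ t in 𝓝[S] t₀, c t ∈ (extChartAt (𝓡 (2 * n + 1)) (c t₀)).source :=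
    hc.eventually ((isOpen_extChartAt_source _).mem_nhds hsrc)
  have hA := (lam.contDiffAt_localForm hsrc).continuousAt.comp_continuousWithinAt (f := fun t =>
    extChartAt (𝓡 (2 * n + 1)) (c t₀) (c t))
    ((continuousAt_extChartAt (I := 𝓡 (2 * n + 1)) (c t₀)).comp_continuousWithinAt hc)
  refine (hA.clm_apply ((isField_iff.1 hv).2 t₀ ht₀)).congr_of_eventuallyEq ?_ ?_
  · filter_upwards [hev] with t ht using lamAt_eq_localForm _ ht _
  · exact lamAt_eq_localForm _ hsrc _

theorem IsField.omegaAt (lam : ContactForm n M) {v w : Y → Model n} (hv : IsField c v S)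
    (hw : IsField c w S) : ContinuousOn (fun t => lam.omegaAt (c t) (v t) (w t)) S := by
  intro t₀ ht₀
  have hc := hv.continuousOn t₀ ht₀
  have hsrc := mem_extChartAt_source (I := 𝓡 (2 * n + 1)) (c t₀)
  have hev : ∀ᶠ t in 𝓝[S] t₀, c t ∈ (extChartAt (𝓡 (2 * n + 1)) (c t₀)).source :=
    hc.eventually ((isOpen_extChartAt_source _).mem_nhds hsrc)
  have hA := ((lam.contDiffAt_localForm hsrc).continuousAt_fderiv (by simp)).comp_continuousWithinAt
    (f := fun t => extChartAt (𝓡 (2 * n + 1)) (c t₀) (c t))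
    ((continuousAt_extChartAt (I := 𝓡 (2 * n + 1)) (c t₀)).comp_continuousWithinAt hc)
  have h1 := (isField_iff.1 hv).2 t₀ ht₀
  have h2 := (isField_iff.1 hw).2 t₀ ht₀
  refine (((hA.clm_apply h1).clm_apply h2).sub
    ((hA.clm_apply h2).clm_apply h1)).congr_of_eventuallyEq ?_ ?_
  · filter_upwards [hev] with t ht using omegaAt_eq_localForm _ ht _ _
  · exact omegaAt_eq_localForm _ hsrc _ _

/-- The vector field near `x₀` whose coordinates in the chart at `x₀` are constant. -/
def constField (x₀ : M) (u : Model n) (y : M) : Model n :=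
  mfderiv 𝓘(ℝ, Model n) (𝓡 (2 * n + 1)) (extChartAt (𝓡 (2 * n + 1)) x₀).symm
    (extChartAt (𝓡 (2 * n + 1)) x₀ y) u

theorem coord_constField {x₀ y : M} (hy : y ∈ (extChartAt (𝓡 (2 * n + 1)) x₀).source)
    (u : Model n) : coord x₀ y (constField x₀ u y) = u := by
  have h := coord_comp_symm ((extChartAt (𝓡 (2 * n + 1)) x₀).map_source hy) u
  rwa [(extChartAt (𝓡 (2 * n + 1)) x₀).left_inv hy] at h

theorem constField_coord {x₀ y : M} (hy : y ∈ (extChartAt (𝓡 (2 * n + 1)) x₀).source)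
    (v : Model n) : constField x₀ (coord x₀ y v) y = v := by
  have h := coord_symm_comp ((extChartAt (𝓡 (2 * n + 1)) x₀).map_source hy) v
  rwa [(extChartAt (𝓡 (2 * n + 1)) x₀).left_inv hy] at h

theorem isField_constField (x₀ : M) (u : Model n) :
    IsField id (constField x₀ u) (extChartAt (𝓡 (2 * n + 1)) x₀).source := by
  intro t ht
  refine (continuousWithinAt_tvec_iff (c := id) ht).2 ⟨continuousWithinAt_id, ?_⟩
  exact (continuousWithinAt_const (b := u)).congr (fun y hy => coord_constField hy u)
    (coord_constField ht u)

/-- The Reeb vector field is smooth: in a chart it solves a linear system with smooth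
coefficients. -/
theorem contMDiff_reeb (lam : ContactForm n M) :
    ContMDiff (𝓡 (2 * n + 1)) (𝓡 (2 * n + 1)).tangent ∞
      (fun x => (⟨x, lam.reeb x⟩ : TangentBundle (𝓡 (2 * n + 1)) M)) := by
  intro x₀
  rw [Bundle.contMDiffAt_section]
  set φ := extChartAt (𝓡 (2 * n + 1)) x₀
  set A := localForm lam.form x₀
  -- In coordinates the Reeb vector is the only solution of the system `λ(R) λ + dλ(R, ·) = λ`.
  let L : Model n → Model n →L[ℝ] Model n →L[ℝ] ℝ := fun q =>
    (A q).smulRight (A q) + (fderiv ℝ A q - (fderiv ℝ A q).flip)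
  have hL : ∀ y ∈ φ.source, ∀ u w, L (φ y) (coord x₀ y u) (coord x₀ y w) =
      lam.lamAt y u * lam.lamAt y w + lam.omegaAt y u w := by
    intro y hy u w
    simp only [L, add_apply, ContinuousLinearMap.smulRight_apply, smul_apply,
      ContinuousLinearMap.flip_apply, sub_apply, smul_eq_mul]
    rw [lamAt_eq_localForm lam hy u, lamAt_eq_localForm lam hy w, omegaAt_eq_localForm lam hy]
  have hinj : ∀ y ∈ φ.source, Function.Injective (L (φ y)) := by
    intro y hy
    rw [injective_iff_map_eq_zero]
    intro u hu
    have h1 : ∀ w, lam.lamAt y (constField x₀ u y) * lam.lamAt y w +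
        lam.omegaAt y (constField x₀ u y) w = 0 := by
      intro w
      rw [← hL y hy, coord_constField hy, hu]; rfl
    have h2 := h1 (lam.reebAt y)
    rw [lam.lamAt_reebAt, lam.omegaAt_swap, lam.omegaAt_reebAt] at h2
    have h0 : lam.lamAt y (constField x₀ u y) = 0 := by linarith
    have h3 := lam.omegaAt_nondegenerate h0 fun w _ => by
      have := h1 w; rw [h0, zero_mul, zero_add] at this; exact this
    rw [← coord_constField hy u, h3, map_zero]
  have hinv : ∀ y ∈ φ.source, (L (φ y)).IsInvertible := by
    intro y hy
    have hf : Module.finrank ℝ (Model n) = Module.finrank ℝ (Model n →L[ℝ] ℝ) := by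
      rw [← LinearEquiv.finrank_eq
        (LinearMap.toContinuousLinearMap (𝕜 := ℝ) (E := Model n) (F' := ℝ))]
      exact (Subspace.dual_finrank_eq).symm
    refine ⟨(LinearMap.linearEquivOfInjective (L (φ y)).toLinearMap (hinj y hy)
      hf).toContinuousLinearEquiv, ?_⟩
    ext u w
    rfl
  have hR : ∀ y ∈ φ.source, coord x₀ y (lam.reebAt y) = (L (φ y)).inverse (A (φ y)) := by
    intro y hy
    obtain ⟨e, he⟩ := hinv y hy
    rw [← he, ContinuousLinearMap.inverse_equiv]
    symm
    rw [ContinuousLinearEquiv.coe_coe, ContinuousLinearEquiv.symm_apply_eq]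
    ext u
    rw [← ContinuousLinearEquiv.coe_coe, he, ← coord_constField hy u, hL y hy,
      lam.lamAt_reebAt, lam.omegaAt_reebAt, lamAt_eq_localForm lam hy]
    simp [A, φ]
  have hx : x₀ ∈ φ.source := mem_extChartAt_source _
  have hA : ContDiffAt ℝ ∞ A (φ x₀) := lam.contDiffAt_localForm hx
  have hdA : ContDiffAt ℝ ∞ (fderiv ℝ A) (φ x₀) := hA.fderiv_right (m := ∞) (by simp)
  have hLs : ContDiffAt ℝ ∞ L (φ x₀) := by
    refine (hA.smulRight hA).add (hdA.sub ?_)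
    exact contDiff_flip.contDiffAt.comp (φ x₀) hdA
  have hG : ContDiffAt ℝ ∞ (fun q => (L q).inverse (A q)) (φ x₀) :=
    (((hinv x₀ hx).contDiffAt_map_inverse).comp _ hLs).clm_apply hA
  have hG' : ContMDiffAt (𝓡 (2 * n + 1)) 𝓘(ℝ, Model n) ∞
      (fun y => (L (φ y)).inverse (A (φ y))) x₀ :=
    hG.contMDiffAt.comp x₀ (contMDiffAt_extChartAt (I := 𝓡 (2 * n + 1)))
  refine hG'.congr_of_eventuallyEq ?_
  filter_upwards [extChartAt_source_mem_nhds (I := 𝓡 (2 * n + 1)) x₀] with y hy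
  rw [← hR y hy]
  exact congrArg Prod.snd (trivializationAt_tvec hy _)

theorem isField_reebAt (lam : ContactForm n M) : IsField id lam.reebAt univ :=
  (contMDiff_reeb lam).continuous.continuousOn

end Sections

/-! ### The local Reeb flow -/

section Flow

variable {n : ℕ} {M : Type*} [TopologicalSpace M] [ChartedSpace (Model n) M]
  [IsManifold (𝓡 (2 * n + 1)) ∞ M]

/-- The derivative of a map from a normed space to `M`, with values in the model space. -/
def dAt {E : Type*} [NormedAddCommGroup E] [NormedSpace ℝ E] (g : E → M) (q : E) :
    E →L[ℝ] Model n := mfderiv 𝓘(ℝ, E) (𝓡 (2 * n + 1)) g q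

/-- The derivative of a self-map of `M`, as an endomorphism of the model space. -/
def dMap (f : M → M) (x : M) : Model n →L[ℝ] Model n :=
  mfderiv (𝓡 (2 * n + 1)) (𝓡 (2 * n + 1)) f x

section

variable {E : Type*} [NormedAddCommGroup E] [NormedSpace ℝ E]

theorem coord_dAt {g : E → M} {p : E} (hg : MDifferentiableAt 𝓘(ℝ, E) (𝓡 (2 * n + 1)) g p) {x₀ : M}
    (hx : g p ∈ (extChartAt (𝓡 (2 * n + 1)) x₀).source) (v : E) :
    coord x₀ (g p) (dAt g p v) = fderiv ℝ (fun q => extChartAt (𝓡 (2 * n + 1)) x₀ (g q)) p v :=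
  (fderiv_chart_comp hg hx v).symm

theorem dAt_comp {E' : Type*} [NormedAddCommGroup E'] [NormedSpace ℝ E'] {g : E → M} {F : E' → E}
    {p : E'} (hg : MDifferentiableAt 𝓘(ℝ, E) (𝓡 (2 * n + 1)) g (F p))
    {F' : E' →L[ℝ] E} (hF : HasFDerivAt F F' p) (u : E') :
    dAt (n := n) (fun q => g (F q)) p u = dAt g (F p) (F' u) := by
  have h := (hg.hasMFDerivAt.comp p hF.hasMFDerivAt).mfderiv
  exact DFunLike.congr_fun h u

/-- A smooth family of tangent vectors is continuous. -/
theorem isField_dAt {Ω : Set E} (hΩ : IsOpen Ω) {g : E → M}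
    (hg : ContMDiffOn 𝓘(ℝ, E) (𝓡 (2 * n + 1)) ∞ g Ω) (u : E) :
    IsField (n := n) g (fun q => dAt g q u) Ω := by
  rw [isField_iff]
  refine ⟨hg.continuousOn, fun p hp => ?_⟩
  have hgp := hg.contMDiffAt (hΩ.mem_nhds hp)
  have h1 : ContDiffAt ℝ ∞ (fun q => extChartAt (𝓡 (2 * n + 1)) (g p) (g q)) p :=
    ((contMDiffAt_extChartAt (n := ∞) (I := 𝓡 (2 * n + 1)) (x := g p)).comp p hgp).contDiffAt
  have h2 := (h1.continuousAt_fderiv (by simp)).clm_apply (continuousAt_const (y := u))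
  refine (h2.congr ?_).continuousWithinAt
  have hev : ∀ᶠ q in 𝓝 p, g q ∈ (extChartAt (𝓡 (2 * n + 1)) (g p)).source :=
    hgp.continuousAt.eventually (extChartAt_source_mem_nhds (g p))
  filter_upwards [hev, hΩ.mem_nhds hp] with q hq hq2
  exact (coord_dAt ((hg.contMDiffAt (hΩ.mem_nhds hq2)).mdifferentiableAt (by simp)) hq u).symm

theorem omegaAt_dAt (lam : ContactForm n M) {g : E → M} {p : E}
    (hg : ContMDiffAt 𝓘(ℝ, E) (𝓡 (2 * n + 1)) ∞ g p) (u v : E) :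
    lam.omegaAt (g p) (dAt g p u) (dAt g p v) =
      fderiv ℝ (pullbackForm lam.form g) p u v - fderiv ℝ (pullbackForm lam.form g) p v u :=
  ((hasFDerivAt_pullbackForm lam (hg.of_le two_le_infty)).2 u v).symm

theorem differentiableAt_pullbackForm (lam : ContactForm n M) {g : E → M} {p : E}
    (hg : ContMDiffAt 𝓘(ℝ, E) (𝓡 (2 * n + 1)) ∞ g p) :
    DifferentiableAt ℝ (pullbackForm lam.form g) p :=
  (hasFDerivAt_pullbackForm lam (hg.of_le two_le_infty)).1

end

/-- A point of the Grassmann bundle, given by a point of `M` and a subspace of the model space. -/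
abbrev plane (x : M) (V : Submodule ℝ (Model n)) : Plane n M := ⟨x, V⟩

theorem plane_inj {x y : M} {V W : Submodule ℝ (Model n)} :
    plane x V = plane y W ↔ x = y ∧ V = W := by
  constructor
  · intro h
    obtain ⟨h1, h2⟩ := Sigma.mk.inj h
    subst h1
    exact ⟨rfl, eq_of_heq h2⟩
  · rintro ⟨rfl, rfl⟩
    rfl

variable {lam : ContactForm n M} {R R' : Legendrian lam}

theorem transport_eq (γ : ReebChord R R') (Φ : ℝ → M → M) (t : 𝕀) :
    γ.transport Φ t = plane (Φ t (γ.path 0))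
      ((show Submodule ℝ (Model n) from tangentAt R.carrier (γ.path 0)).map
        (dMap (Φ t) (γ.path 0)).toLinearMap) := rfl

/-- The local flow does not depend on choices near the chord. This uses the uniqueness of integral
curves, which holds because `M` is Hausdorff. -/
theorem transport_congr [T2Space M] {γ : ReebChord R R'} {Φ Φ' : ℝ → M → M}
    (h : γ.IsLocalFlow Φ) (h' : γ.IsLocalFlow Φ') : γ.transport Φ = γ.transport Φ' := by
  obtain ⟨ε, hε, U, hU, hxU, -, h0, hint, -⟩ := h
  obtain ⟨ε', hε', U', hU', hxU', -, h0', hint', -⟩ := h'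
  have hv : ContMDiff (𝓡 (2 * n + 1)) (𝓡 (2 * n + 1)).tangent 1
      (fun x => (⟨x, γ.period • lam.reeb x⟩ : TangentBundle (𝓡 (2 * n + 1)) M)) :=
    ((contMDiff_reeb lam).of_le (m := 1) (by exact WithTop.coe_le_coe.2 le_top)).const_smul_section
  funext t
  have hev : Φ t =ᶠ[𝓝 (γ.path 0)] Φ' t := by
    filter_upwards [hU.mem_nhds hxU, hU'.mem_nhds hxU'] with x hx hx'
    have ht := t.2
    refine isMIntegralCurveOn_Ioo_eqOn_of_contMDiff_boundaryless (I := 𝓡 (2 * n + 1)) (t₀ := 0)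
      (a := - min ε ε') (b := 1 + min ε ε') ?_ hv
      ((hint x hx).mono (Ioo_subset_Ioo (by simp) (by simp)))
      ((hint' x hx').mono (Ioo_subset_Ioo (by simp) (by simp)))
      (by rw [h0 x hx, h0' x hx']) ?_
    · constructor <;> [skip; skip] <;> have := lt_min hε hε' <;> linarith
    · have := lt_min hε hε'
      constructor <;> [have := ht.1; have := ht.2] <;> linarith
  rw [transport_eq, transport_eq, plane_inj]
  refine ⟨hev.self_of_nhds, ?_⟩
  have : dMap (n := n) (Φ t) (γ.path 0) = dMap (Φ' t) (γ.path 0) := hev.mfderiv_eq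
  rw [this]

/-- A local flow, written as a smooth map of time and chart coordinates of the initial point. -/
theorem exists_flow_coord {γ : ReebChord R R'} {Φ : ℝ → M → M} (h : γ.IsLocalFlow Φ) :
    ∃ ε > (0 : ℝ), ∃ V : Set (Model n), IsOpen V ∧
      extChartAt (𝓡 (2 * n + 1)) (γ.path 0) (γ.path 0) ∈ V ∧
      V ⊆ (extChartAt (𝓡 (2 * n + 1)) (γ.path 0)).target ∧
      ContMDiffOn 𝓘(ℝ, ℝ × Model n) (𝓡 (2 * n + 1)) ∞
        (fun p : ℝ × Model n => Φ p.1 ((extChartAt (𝓡 (2 * n + 1)) (γ.path 0)).symm p.2))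
        (Ioo (-ε) (1 + ε) ×ˢ V) ∧
      (∀ q ∈ V, Φ 0 ((extChartAt (𝓡 (2 * n + 1)) (γ.path 0)).symm q) =
        (extChartAt (𝓡 (2 * n + 1)) (γ.path 0)).symm q) ∧
      ∀ q ∈ V, ∀ t ∈ Ioo (-ε) (1 + ε),
        dAt (n := n) (fun s : ℝ => Φ s ((extChartAt (𝓡 (2 * n + 1)) (γ.path 0)).symm q)) t 1 =
          γ.period • lam.reebAt (Φ t ((extChartAt (𝓡 (2 * n + 1)) (γ.path 0)).symm q)) := by
  obtain ⟨ε, hε, U, hU, hxU, hs, h0, hint, -⟩ := h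
  set φ := extChartAt (𝓡 (2 * n + 1)) (γ.path 0)
  have hφ : ContMDiffOn 𝓘(ℝ, Model n) (𝓡 (2 * n + 1)) ∞ φ.symm φ.target :=
    contMDiffOn_extChartAt_symm (γ.path 0)
  refine ⟨ε, hε, φ.target ∩ φ.symm ⁻¹' U,
    hφ.continuousOn.isOpen_inter_preimage (isOpen_extChartAt_target _) hU, ?_, inter_subset_left,
    ?_, ?_, ?_⟩
  · refine ⟨mem_extChartAt_target _, ?_⟩
    rw [mem_preimage, extChartAt_to_inv]
    exact hxU
  · refine hs.comp (f := fun p : ℝ × Model n => (p.1, φ.symm p.2)) ?_ ?_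
    · refine ContMDiffOn.prodMk contDiff_fst.contMDiff.contMDiffOn ?_
      exact hφ.comp contDiff_snd.contMDiff.contMDiffOn fun p hp => hp.2.1
    · rintro ⟨t, q⟩ ⟨ht, hq⟩
      exact ⟨ht, hq.2⟩
  · exact fun q hq => h0 _ hq.2
  · intro q hq t ht
    have h1 := (hint _ hq.2 t ht).hasMFDerivAt (Ioo_mem_nhds ht.1 ht.2)
    have h2 := DFunLike.congr_fun h1.mfderiv (1 : ℝ)
    refine Eq.trans h2 ?_
    exact one_smul ℝ _

/-- The Reeb flow preserves `λ` and `dλ`: for `B = g^*λ` on the product of the time axis and a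
chart, `B(∂_t)` is constant and `dB(∂_t, ·) = 0`, so `∂_t` of the remaining components vanishes. -/
theorem lamAt_omegaAt_flow {γ : ReebChord R R'} {Φ : ℝ → M → M} (h : γ.IsLocalFlow Φ) (t : 𝕀) :
    (∀ v, lam.lamAt (Φ t (γ.path 0)) (dMap (Φ t) (γ.path 0) v) = lam.lamAt (γ.path 0) v) ∧
    ∀ v w, lam.omegaAt (Φ t (γ.path 0)) (dMap (Φ t) (γ.path 0) v) (dMap (Φ t) (γ.path 0) w) =
      lam.omegaAt (γ.path 0) v w := by
  obtain ⟨ε, hε, V, hV, hxV, hVt, hs, h0, hint⟩ := exists_flow_coord h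
  set φ := extChartAt (𝓡 (2 * n + 1)) (γ.path 0) with hφdef
  set g : ℝ × Model n → M := fun p => Φ p.1 (φ.symm p.2) with hg
  have hΩ : IsOpen (Ioo (-ε) (1 + ε) ×ˢ V) := isOpen_Ioo.prod hV
  have ht : (t : ℝ) ∈ Ioo (-ε) (1 + ε) := ⟨by have := t.2.1; linarith, by have := t.2.2; linarith⟩
  have h0t : (0 : ℝ) ∈ Ioo (-ε) (1 + ε) := ⟨by linarith, by linarith⟩
  set B := pullbackForm lam.form g with hB
  have hgs : ∀ p ∈ Ioo (-ε) (1 + ε) ×ˢ V, ContMDiffAt 𝓘(ℝ, ℝ × Model n) (𝓡 (2 * n + 1)) ∞ g p :=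
    fun p hp => hs.contMDiffAt (hΩ.mem_nhds hp)
  have hgd : ∀ p ∈ Ioo (-ε) (1 + ε) ×ˢ V, MDifferentiableAt 𝓘(ℝ, ℝ × Model n) (𝓡 (2 * n + 1)) g p :=
    fun p hp => (hgs p hp).mdifferentiableAt (by simp)
  have hBv : ∀ p u, B p u = lam.lamAt (g p) (dAt g p u) := fun p u => rfl
  have hdt : ∀ p ∈ Ioo (-ε) (1 + ε) ×ˢ V, dAt g p (1, 0) = γ.period • lam.reebAt (g p) := by
    rintro ⟨s, q⟩ hp
    have hF : HasFDerivAt (fun s : ℝ => (s, q)) (ContinuousLinearMap.inl ℝ ℝ (Model n)) s :=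
      hasFDerivAt_prodMk_left s q
    have h1 := dAt_comp (n := n) (F := fun s : ℝ => (s, q)) (g := g) (p := s) (hgd _ hp) hF 1
    rw [← hint q hp.2 s hp.1]
    exact h1.symm
  -- `B(∂_t) = T λ(R_λ) = T` is constant, where `T` is the period of the chord.
  have hBt : ∀ p ∈ Ioo (-ε) (1 + ε) ×ˢ V, B p (1, 0) = γ.period := by
    intro p hp
    rw [hBv, hdt p hp, map_smul, lam.lamAt_reebAt, smul_eq_mul, mul_one]
  have hBd : ∀ p ∈ Ioo (-ε) (1 + ε) ×ˢ V, DifferentiableAt ℝ B p :=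
    fun p hp => differentiableAt_pullbackForm lam (hgs p hp)
  -- `∂_t B(u) = dB(∂_t, u) + ∂_u (B(∂_t))`, and both terms vanish.
  have hBdt : ∀ p ∈ Ioo (-ε) (1 + ε) ×ˢ V, ∀ u, fderiv ℝ B p (1, 0) u = 0 := by
    intro p hp u
    have h1 := omegaAt_dAt lam (hgs p hp) (1, 0) u
    rw [hdt p hp, map_smul, smul_apply, lam.omegaAt_reebAt, smul_zero] at h1
    have h2 : fderiv ℝ B p u (1, 0) = 0 := by
      have h3 : HasFDerivAt (fun p => B p (1, 0)) ((fderiv ℝ B p).flip (1, 0)) p := by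
        simpa using (hBd p hp).hasFDerivAt.clm_apply (hasFDerivAt_const ((1 : ℝ), (0 : Model n)) p)
      have h4 : HasFDerivAt (fun p => B p (1, 0)) (0 : ℝ × Model n →L[ℝ] ℝ) p :=
        (hasFDerivAt_const γ.period p).congr_of_eventuallyEq
          (by filter_upwards [hΩ.mem_nhds hp] with p' hp' using hBt p' hp')
      exact DFunLike.congr_fun (h3.unique h4) u
    linarith
  have hconst : ∀ q ∈ V, ∀ u, B (t, q) u = B (0, q) u := by
    intro q hq u
    have hd : ∀ s ∈ Ioo (-ε) (1 + ε), HasDerivAt (fun s : ℝ => B (s, q) u) 0 s := by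
      intro s hs'
      have hF : HasDerivAt (fun s : ℝ => (s, q)) ((1 : ℝ), (0 : Model n)) s :=
        (hasDerivAt_id s).prodMk (hasDerivAt_const s q)
      have h1 : HasDerivAt (fun s : ℝ => B (s, q)) (fderiv ℝ B (s, q) (1, 0)) s :=
        HasFDerivAt.comp_hasDerivAt (l := B) (f := fun s : ℝ => (s, q)) s
          (hBd (s, q) ⟨hs', hq⟩).hasFDerivAt hF
      have h2 := h1.clm_apply (hasDerivAt_const s u)
      simpa [hBdt (s, q) ⟨hs', hq⟩ u] using h2
    exact isOpen_Ioo.is_const_of_deriv_eq_zero isPreconnected_Ioo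
      (fun s hs' => (hd s hs').differentiableAt.differentiableWithinAt)
      (fun s hs' => (hd s hs').deriv) ht h0t
  -- The pull-backs of `λ` under the time slices of `g` agree, hence so do those of `dλ`.
  have hslice : ∀ s ∈ Ioo (-ε) (1 + ε), ∀ q ∈ V, ∀ u,
      dAt (n := n) (fun q => g (s, q)) q u = dAt g (s, q) (0, u) := by
    intro s hs' q hq u
    have hF : HasFDerivAt (fun q : Model n => (s, q)) (ContinuousLinearMap.inr ℝ ℝ (Model n)) q :=
      hasFDerivAt_prodMk_right s q
    exact dAt_comp (n := n) (F := fun q : Model n => (s, q)) (g := g) (p := q)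
      (hgd _ ⟨hs', hq⟩) hF u
  have hsl : ∀ s ∈ Ioo (-ε) (1 + ε), ∀ q ∈ V,
      ContMDiffAt 𝓘(ℝ, Model n) (𝓡 (2 * n + 1)) ∞ (fun q => g (s, q)) q := by
    intro s hs' q hq
    exact (hgs (s, q) ⟨hs', hq⟩).comp q (contDiff_prodMk_right s).contMDiff.contMDiffAt
  have hpb : ∀ q ∈ V, pullbackForm lam.form (fun q => g (t, q)) q =
      pullbackForm lam.form (fun q => g (0, q)) q := by
    intro q hq
    ext u
    have h1 : ∀ s ∈ Ioo (-ε) (1 + ε), pullbackForm lam.form (fun q => g (s, q)) q u =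
        B (s, q) (0, u) := by
      intro s hs'
      rw [hBv, ← hslice s hs' q hq]
      rfl
    rw [h1 t ht, h1 0 h0t, hconst q hq]
  set q₀ := φ (γ.path 0) with hq₀
  have hq0 : φ.symm q₀ = γ.path 0 := extChartAt_to_inv _
  -- In the chart, the derivative of a time slice is the derivative of the flow.
  have hD : ∀ s ∈ Ioo (-ε) (1 + ε), ∀ v,
      dAt (n := n) (fun q => g (s, q)) q₀ (coord (γ.path 0) (γ.path 0) v) =
        dMap (Φ s) (γ.path 0) v := by
    intro s hs' v
    have h1 : MDifferentiableAt 𝓘(ℝ, Model n) (𝓡 (2 * n + 1)) (fun q => g (s, q)) q₀ :=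
      (hsl s hs' q₀ hxV).mdifferentiableAt (by simp)
    have h2 : MDifferentiableAt (𝓡 (2 * n + 1)) 𝓘(ℝ, Model n) φ (γ.path 0) :=
      mdifferentiableAt_extChartAt (mem_chart_source _ _)
    have h3 := mfderiv_comp (γ.path 0) (g := fun q => g (s, q)) (f := φ) h1 h2
    have h4 : (fun q => g (s, q)) ∘ φ =ᶠ[𝓝 (γ.path 0)] Φ s := by
      filter_upwards [extChartAt_source_mem_nhds (I := 𝓡 (2 * n + 1)) (γ.path 0)] with y hy
      simp only [hg, Function.comp_apply]
      rw [φ.left_inv hy]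
    have h5 := h4.mfderiv_eq (I := 𝓡 (2 * n + 1)) (I' := 𝓡 (2 * n + 1))
    exact (DFunLike.congr_fun (h5.symm.trans h3) v).symm
  have h0D : ∀ v, dAt (n := n) (fun q => g (0, q)) q₀ (coord (γ.path 0) (γ.path 0) v) = v := by
    intro v
    have h1 : (fun q => g (0, q)) =ᶠ[𝓝 q₀] φ.symm := by
      filter_upwards [hV.mem_nhds hxV] with q hq using h0 q hq
    have h2 := h1.mfderiv_eq (I := 𝓘(ℝ, Model n)) (I' := 𝓡 (2 * n + 1))
    have h3 := constField_coord (mem_extChartAt_source (I := 𝓡 (2 * n + 1)) (γ.path 0)) v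
    exact (DFunLike.congr_fun h2 (coord (γ.path 0) (γ.path 0) v)).trans h3
  have hgt : g (t, q₀) = Φ t (γ.path 0) := by simp only [hg, hq0]
  have hg0 : g (0, q₀) = γ.path 0 := by rw [← hq0]; exact h0 q₀ hxV
  constructor
  · intro v
    have h1 := DFunLike.congr_fun (hpb q₀ hxV) (coord (γ.path 0) (γ.path 0) v)
    change lam.lamAt (g (t, q₀)) (dAt (n := n) (fun q => g (t, q)) q₀ _) =
      lam.lamAt (g (0, q₀)) (dAt (n := n) (fun q => g (0, q)) q₀ _) at h1
    rwa [hD t ht, h0D, hgt, hg0] at h1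
  · intro v w
    have h1 := omegaAt_dAt lam (hsl t ht q₀ hxV) (coord (γ.path 0) (γ.path 0) v)
      (coord (γ.path 0) (γ.path 0) w)
    have h2 := omegaAt_dAt lam (hsl 0 h0t q₀ hxV) (coord (γ.path 0) (γ.path 0) v)
      (coord (γ.path 0) (γ.path 0) w)
    have h3 : pullbackForm lam.form (fun q => g (t, q)) =ᶠ[𝓝 q₀]
        pullbackForm lam.form (fun q => g (0, q)) := by
      filter_upwards [hV.mem_nhds hxV] with q hq using hpb q hq
    rw [h3.fderiv_eq, ← h2] at h1
    rwa [hD t ht, hD t ht, h0D, h0D, hgt, hg0] at h1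

theorem isField_flow {γ : ReebChord R R'} {Φ : ℝ → M → M} (h : γ.IsLocalFlow Φ) (v : Model n) :
    IsField (fun t : 𝕀 => Φ t (γ.path 0)) (fun t => dMap (Φ t) (γ.path 0) v) univ := by
  obtain ⟨ε, hε, V, hV, hxV, hVt, hs, h0, hint⟩ := exists_flow_coord h
  set φ := extChartAt (𝓡 (2 * n + 1)) (γ.path 0) with hφdef
  set q₀ := φ (γ.path 0) with hq₀
  have hq0 : φ.symm q₀ = γ.path 0 := extChartAt_to_inv _
  set g : ℝ × Model n → M := fun p => Φ p.1 (φ.symm p.2) with hg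
  have hΩ : IsOpen (Ioo (-ε) (1 + ε) ×ˢ V) := isOpen_Ioo.prod hV
  have hm : MapsTo (fun t : 𝕀 => ((t : ℝ), q₀)) univ (Ioo (-ε) (1 + ε) ×ˢ V) := fun t _ =>
    ⟨⟨by have := t.2.1; simp only; linarith, by have := t.2.2; simp only; linarith⟩, hxV⟩
  have h1 := (isField_dAt hΩ hs ((0 : ℝ), coord (γ.path 0) (γ.path 0) v)).comp
    (σ := fun t : 𝕀 => ((t : ℝ), q₀)) (T := univ) (by fun_prop) hm
  have hc : ∀ t : 𝕀, g ((t : ℝ), q₀) = Φ t (γ.path 0) := fun t => by simp only [hg, hq0]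
  have h1' : IsField (fun t : 𝕀 => Φ t (γ.path 0))
      (fun t => dAt (n := n) g ((t : ℝ), q₀) ((0 : ℝ), coord (γ.path 0) (γ.path 0) v)) univ := by
    have : (fun t : 𝕀 => Φ t (γ.path 0)) = fun t : 𝕀 => g ((t : ℝ), q₀) :=
      funext fun t => (hc t).symm
    rw [this]
    exact h1
  refine h1'.congr fun t _ => ?_
  have hgd : MDifferentiableAt 𝓘(ℝ, ℝ × Model n) (𝓡 (2 * n + 1)) g (t, q₀) :=
    (hs.contMDiffAt (hΩ.mem_nhds (hm (mem_univ t)))).mdifferentiableAt (by simp)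
  have hF : HasMFDerivAt (𝓡 (2 * n + 1)) 𝓘(ℝ, ℝ × Model n) (fun y => ((t : ℝ), φ y)) (γ.path 0)
      ((ContinuousLinearMap.inr ℝ ℝ (Model n)).comp (coord (γ.path 0) (γ.path 0))) := by
    have h2 : MDifferentiableAt (𝓡 (2 * n + 1)) 𝓘(ℝ, Model n) φ (γ.path 0) :=
      mdifferentiableAt_extChartAt (mem_chart_source _ _)
    exact (hasFDerivAt_prodMk_right (t : ℝ) q₀).hasMFDerivAt.comp (γ.path 0) h2.hasMFDerivAt
  have h3 := (hgd.hasMFDerivAt.comp (γ.path 0) hF).mfderiv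
  have h4 : g ∘ (fun y => ((t : ℝ), φ y)) =ᶠ[𝓝 (γ.path 0)] Φ t := by
    filter_upwards [extChartAt_source_mem_nhds (I := 𝓡 (2 * n + 1)) (γ.path 0)] with y hy
    simp only [hg, Function.comp_apply]
    rw [φ.left_inv hy]
  have h5 := h4.mfderiv_eq (I := 𝓡 (2 * n + 1)) (I' := 𝓡 (2 * n + 1))
  exact DFunLike.congr_fun (h5.symm.trans h3) v

end Flow

/-! ### Lagrangian sections from Legendrian submanifolds and from the flow -/

section LagrangianSections

variable {n : ℕ} {M : Type*} [TopologicalSpace M] [ChartedSpace (Model n) M]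
  [IsManifold (𝓡 (2 * n + 1)) ∞ M]

/-- The tangent space of `R ⊆ M` at `x` as a subspace of the model space. -/
def tanAt (R : Set M) (x : M) : Submodule ℝ (Model n) := tangentAt R x

theorem isLagrangian_iff {lam : ContactForm n M} {x : M} {V : Submodule ℝ (Model n)} :
    lam.IsLagrangian x V ↔ (∀ v ∈ V, lam.lamAt x v = 0) ∧
      (∀ v ∈ V, ∀ w ∈ V, lam.omegaAt x v w = 0) ∧ Module.finrank ℝ V = n := Iff.rfl

/-- Continuous Lagrangian sections over an arbitrary parameter space. Over the unit interval this is
`IsLagrangianSection` by definition. -/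
def IsLagSec (lam : ContactForm n M) {Y : Type*} [TopologicalSpace Y] (c : Y → M)
    (P : Y → Plane n M) : Prop :=
  (∀ t, (P t).1 = c t ∧ lam.IsLagrangian (P t).1 (P t).2) ∧
  ∀ t₀ : Y, ∃ U ∈ 𝓝 t₀, ∃ v : Fin n → Y → Model n, (∀ i, IsField c (v i) U) ∧
    ∀ t ∈ U, P t = plane (c t) (Submodule.span ℝ (range fun i => v i t))

theorem IsLagSec.comp {lam : ContactForm n M} {Y Z : Type*} [TopologicalSpace Y]
    [TopologicalSpace Z] {c : Y → M} {P : Y → Plane n M} (h : IsLagSec lam c P) {σ : Z → Y}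
    (hσ : Continuous σ) : IsLagSec lam (fun z => c (σ z)) (fun z => P (σ z)) := by
  refine ⟨fun z => h.1 (σ z), fun z => ?_⟩
  obtain ⟨U, hU, v, hv, hP⟩ := h.2 (σ z)
  exact ⟨σ ⁻¹' U, hσ.continuousAt hU, fun i t => v i (σ t),
    fun i => (hv i).comp hσ.continuousOn (mapsTo_preimage σ U), fun t ht => hP (σ t) ht⟩

theorem mem_of_hasDerivAt {E : Type*} [NormedAddCommGroup E] [NormedSpace ℝ E]
    [FiniteDimensional ℝ E] {W : Submodule ℝ E} {f : ℝ → E} {f' : E} (hf : HasDerivAt f f' 0)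
    (h : ∀ᶠ t in 𝓝 0, f t ∈ W) : f' ∈ W := by
  rw [hasDerivAt_iff_tendsto_slope] at hf
  refine W.closed_of_finiteDimensional.mem_of_tendsto hf ?_
  filter_upwards [nhdsWithin_le_nhds h] with t ht
  exact W.smul_mem _ (W.sub_mem ht h.self_of_nhds)

theorem smulRight_one_apply_one {E : Type*} [NormedAddCommGroup E] [NormedSpace ℝ E] (v : E) :
    (1 : ℝ →L[ℝ] ℝ).smulRight v 1 = v := by simp

theorem smulRight_one_apply {E : Type*} [NormedAddCommGroup E] [NormedSpace ℝ E] (f : ℝ →L[ℝ] E) :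
    (1 : ℝ →L[ℝ] ℝ).smulRight (f 1) = f := by
  ext; simp

/-- In a slice chart `φ` adapted to `R`, the tangent space of `R` is the image of the slice under
the derivative of `φ⁻¹`. -/
theorem tanAt_eq_map {R : Set M} {φ : OpenPartialHomeomorph M (Model n)}
    (hφ : φ ∈ IsManifold.maximalAtlas (𝓡 (2 * n + 1)) ∞ M) {W : Submodule ℝ (Model n)}
    (hW : ∀ y ∈ φ.source, (y ∈ R ↔ φ y ∈ W)) {y : M} (hy : y ∈ φ.source) (hyR : y ∈ R) :
    tanAt R y = W.map (dAt (n := n) φ.symm (φ y)).toLinearMap := by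
  have hψ : ContMDiffAt (𝓡 (2 * n + 1)) (𝓡 (2 * n + 1)) ∞ φ.symm (φ y) :=
    (contMDiffOn_symm_of_mem_maximalAtlas hφ).contMDiffAt (φ.open_target.mem_nhds (φ.map_source hy))
  have hψd : MDifferentiableAt 𝓘(ℝ, Model n) (𝓡 (2 * n + 1)) φ.symm (φ y) :=
    hψ.mdifferentiableAt (by simp)
  have hφd : MDifferentiableAt (𝓡 (2 * n + 1)) 𝓘(ℝ, Model n) φ y :=
    ((contMDiffOn_of_mem_maximalAtlas hφ).contMDiffAt (φ.open_source.mem_nhds hy)).mdifferentiableAt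
      (by simp)
  apply le_antisymm
  -- The image of a curve in `R` under `φ` stays in the linear subspace `W`, so its velocity
  -- is in `W`.
  · refine Submodule.span_le.2 ?_
    rintro v ⟨c, v₀, hcR, hc, hv⟩
    have hcy : c 0 = y := congrArg Bundle.TotalSpace.proj hv
    subst hcy
    obtain rfl : v₀ = v := by simpa using hv
    have hcc : ContinuousAt c 0 := hc.continuousAt
    have hf : DifferentiableAt ℝ (fun t => φ (c t)) 0 :=
      (hφd.comp (0 : ℝ) hc.mdifferentiableAt).differentiableAt
    have hsrc : ∀ᶠ t in 𝓝 (0 : ℝ), c t ∈ φ.source := hcc.eventually (φ.open_source.mem_nhds hy)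
    have h1 : deriv (fun t => φ (c t)) 0 ∈ W :=
      mem_of_hasDerivAt hf.hasDerivAt (by filter_upwards [hsrc] with t ht using (hW _ ht).1 (hcR t))
    refine ⟨_, h1, ?_⟩
    have h2 := dAt_comp (n := n) (p := (0 : ℝ)) hψd hf.hasFDerivAt 1
    have h3 : (fun t => φ.symm (φ (c t))) =ᶠ[𝓝 (0 : ℝ)] c := by
      filter_upwards [hsrc] with t ht using φ.left_inv ht
    have h4 := h3.mfderiv_eq (I := 𝓘(ℝ, ℝ)) (I' := 𝓡 (2 * n + 1))
    have h5 := DFunLike.congr_fun (h4.trans hc.mfderiv) (1 : ℝ)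
    exact (h2.symm.trans h5).trans (smulRight_one_apply_one (E := Model n) v₀)
  · rintro _ ⟨u, hu, rfl⟩
    suffices h : (show TangentSpace (𝓡 (2 * n + 1)) y from dAt (n := n) φ.symm (φ y) u) ∈
        tangentAt (n := n) R y from h
    refine Submodule.subset_span ?_
    -- A straight line in the slice; where it leaves the chart, it is continued by a constant, since
    -- `tangentAt` asks for curves that stay in `R` for all times.
    let c : ℝ → M := fun t =>
      open Classical in if φ y + t • u ∈ φ.target then φ.symm (φ y + t • u) else y
    have hc0 : c 0 = y := by
      simp only [c, zero_smul, add_zero, φ.map_source hy, if_true, φ.left_inv hy]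
    have hl : HasDerivAt (fun t : ℝ => φ y + t • u) u 0 := by
      simpa using ((hasDerivAt_id (0 : ℝ)).smul_const u).const_add (φ y)
    have hev : c =ᶠ[𝓝 0] fun t => φ.symm (φ y + t • u) := by
      have : ∀ᶠ t in 𝓝 (0 : ℝ), φ y + t • u ∈ φ.target := by
        refine hl.continuousAt.eventually (φ.open_target.mem_nhds ?_)
        simpa using φ.map_source hy
      filter_upwards [this] with t ht
      simp only [c, ht, if_true]
    have hψd' : MDifferentiableAt 𝓘(ℝ, Model n) (𝓡 (2 * n + 1)) φ.symm
        (φ y + (0 : ℝ) • u) := by simpa using hψd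
    have h1 : MDifferentiableAt 𝓘(ℝ, ℝ) (𝓡 (2 * n + 1)) (fun t : ℝ => φ.symm (φ y + t • u)) 0 :=
      MDifferentiableAt.comp (0 : ℝ) hψd' hl.hasFDerivAt.hasMFDerivAt.mdifferentiableAt
    have h2 := dAt_comp (n := n) (p := (0 : ℝ)) hψd' hl.hasFDerivAt 1
    have h3 : MDifferentiableAt 𝓘(ℝ, ℝ) (𝓡 (2 * n + 1)) c 0 :=
      h1.congr_of_eventuallyEq hev
    have h4 : mfderiv 𝓘(ℝ, ℝ) (𝓡 (2 * n + 1)) c 0 (1 : ℝ) = dAt (n := n) φ.symm (φ y) u := by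
      have h5 := DFunLike.congr_fun (hev.mfderiv_eq (I := 𝓘(ℝ, ℝ)) (I' := 𝓡 (2 * n + 1))) (1 : ℝ)
      refine (h5.trans h2).trans ?_
      rw [zero_smul, add_zero, ContinuousLinearMap.toSpanSingleton_apply, one_smul]
    refine ⟨c, dAt (n := n) φ.symm (φ y) u, ?_, ?_, ?_⟩
    · intro t
      by_cases ht : φ y + t • u ∈ φ.target
      · simp only [c, ht, if_true]
        rw [hW _ (φ.map_target ht), φ.right_inv ht]
        exact W.add_mem ((hW y hy).1 hyR) (W.smul_mem t hu)
      · simp only [c, ht, if_false]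
        exact hyR
    · have h6 := h3.hasMFDerivAt
      rw [← h4]
      exact h6.congr_mfderiv (smulRight_one_apply (E := Model n) _).symm
    · change tvec (c 0) _ = tvec y _
      rw [hc0]

theorem dAt_symm_injective {φ : OpenPartialHomeomorph M (Model n)}
    (hφ : φ ∈ IsManifold.maximalAtlas (𝓡 (2 * n + 1)) ∞ M) {q : Model n} (hq : q ∈ φ.target) :
    Function.Injective (dAt (n := n) φ.symm q) := by
  have hψ : MDifferentiableAt (𝓡 (2 * n + 1)) (𝓡 (2 * n + 1)) φ.symm q :=
    ((contMDiffOn_symm_of_mem_maximalAtlas hφ).contMDiffAt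
      (φ.open_target.mem_nhds hq)).mdifferentiableAt (by simp)
  have hφd : MDifferentiableAt (𝓡 (2 * n + 1)) (𝓡 (2 * n + 1)) φ (φ.symm q) :=
    ((contMDiffOn_of_mem_maximalAtlas hφ).contMDiffAt
      (φ.open_source.mem_nhds (φ.map_target hq))).mdifferentiableAt (by simp)
  have h1 : φ ∘ φ.symm =ᶠ[𝓝 q] id := by
    filter_upwards [φ.open_target.mem_nhds hq] with p hp using φ.right_inv hp
  have h2 := (mfderiv_comp q hφd hψ).symm.trans
    (h1.mfderiv_eq (I := 𝓡 (2 * n + 1)) (I' := 𝓡 (2 * n + 1)))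
  rw [mfderiv_id] at h2
  exact Function.LeftInverse.injective (g := mfderiv (𝓡 (2 * n + 1)) (𝓡 (2 * n + 1)) φ (φ.symm q))
    fun u => DFunLike.congr_fun h2 u

variable {lam : ContactForm n M} {R R' : Legendrian lam}

/-- The tangent spaces of a Legendrian submanifold are Lagrangian: the pull-back of `λ` to the slice
vanishes, hence so does its exterior derivative. -/
theorem Legendrian.isLagrangian_tanAt (R : Legendrian lam) {x : M} (hx : x ∈ R.carrier) :
    lam.IsLagrangian x (tanAt R.carrier x) := by
  obtain ⟨φ, hφ, hxφ, W, hWn, hW⟩ := R.slice x hx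
  have htan := tanAt_eq_map hφ hW hxφ hx
  refine isLagrangian_iff.2 ⟨R.tangent x hx, ?_, ?_⟩
  · set B := pullbackForm lam.form φ.symm
    have hs : ContMDiffAt 𝓘(ℝ, Model n) (𝓡 (2 * n + 1)) ∞ φ.symm (φ x) :=
      (contMDiffOn_symm_of_mem_maximalAtlas hφ).contMDiffAt
        (φ.open_target.mem_nhds (φ.map_source hxφ))
    have hB : DifferentiableAt ℝ B (φ x) := differentiableAt_pullbackForm lam hs
    have h0 : ∀ u ∈ W, ∀ v ∈ W, fderiv ℝ B (φ x) u v = 0 := by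
      intro u hu v hv
      have hl : HasDerivAt (fun t : ℝ => φ x + t • u) u 0 := by
        simpa using ((hasDerivAt_id (0 : ℝ)).smul_const u).const_add (φ x)
      have h1 : HasDerivAt (fun t : ℝ => B (φ x + t • u) v) (fderiv ℝ B (φ x) u v) 0 := by
        have h2 : HasDerivAt (fun t : ℝ => B (φ x + t • u)) (fderiv ℝ B (φ x) u) 0 :=
          HasFDerivAt.comp_hasDerivAt (l := B) (f := fun t : ℝ => φ x + t • u) 0
            (by simpa using hB.hasFDerivAt) hl
        simpa using h2.clm_apply (hasDerivAt_const 0 v)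
      refine h1.unique ((hasDerivAt_const (0 : ℝ) (0 : ℝ)).congr_of_eventuallyEq ?_)
      have hev : ∀ᶠ t in 𝓝 (0 : ℝ), φ x + t • u ∈ φ.target := by
        refine hl.continuousAt.eventually (φ.open_target.mem_nhds ?_)
        simpa using φ.map_source hxφ
      filter_upwards [hev] with t ht
      have hR : φ.symm (φ x + t • u) ∈ R.carrier := by
        rw [hW _ (φ.map_target ht), φ.right_inv ht]
        exact W.add_mem ((hW x hxφ).1 hx) (W.smul_mem t hu)
      refine R.tangent _ hR _ ?_
      change _ ∈ tanAt R.carrier _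
      rw [tanAt_eq_map hφ hW (φ.map_target ht) hR, φ.right_inv ht]
      exact ⟨v, hv, rfl⟩
    rw [htan]
    rintro _ ⟨u, hu, rfl⟩ _ ⟨v, hv, rfl⟩
    have h1 := omegaAt_dAt lam hs u v
    rw [h0 u hu v hv, h0 v hv u hu, sub_zero, φ.left_inv hxφ] at h1
    exact h1
  · rw [htan]
    refine Eq.trans ?_ hWn
    exact (Submodule.equivMapOfInjective _
      (dAt_symm_injective hφ (φ.map_source hxφ)) W).finrank_eq.symm

theorem range_map_span {ι : Type*} {W : Submodule ℝ (Model n)} {u : ι → Model n}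
    (hu : Submodule.span ℝ (range u) = W) (f : Model n →L[ℝ] Model n) :
    W.map f.toLinearMap = Submodule.span ℝ (range fun i => f (u i)) := by
  rw [← hu, Submodule.map_span, ← range_comp]
  rfl

theorem span_eq_of_finrank {V : Submodule ℝ (Model n)} {v : Fin n → Model n}
    (hli : LinearIndependent ℝ v) (hv : ∀ j, v j ∈ V) (hV : Module.finrank ℝ V = n) :
    Submodule.span ℝ (range v) = V := by
  refine Submodule.eq_of_le_of_finrank_eq (Submodule.span_le.2 ?_) ?_
  · rintro _ ⟨j, rfl⟩
    exact hv j
  · rw [finrank_span_eq_card hli, Fintype.card_fin, hV]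

theorem exists_span_of_finrank {W : Submodule ℝ (Model n)} (hW : Module.finrank ℝ W = n) :
    ∃ u : Fin n → Model n, Submodule.span ℝ (range u) = W := by
  let b := Module.finBasisOfFinrankEq ℝ W hW
  refine ⟨fun i => b i, ?_⟩
  have h := congrArg (Submodule.map W.subtype) b.span_eq
  rw [Submodule.map_span, ← range_comp, Submodule.map_top, Submodule.range_subtype] at h
  exact h

/-- The Gauss map of a Legendrian submanifold is a continuous Lagrangian section over every map into
it. -/
theorem Legendrian.isLagSec_gauss (R : Legendrian lam) {Y : Type*} [TopologicalSpace Y] {c : Y → M}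
    (hc : Continuous c) (hR : ∀ t, c t ∈ R.carrier) : IsLagSec lam c fun t => R.gauss (c t) := by
  refine ⟨fun t => ⟨rfl, R.isLagrangian_tanAt (hR t)⟩, fun t₀ => ?_⟩
  obtain ⟨φ, hφ, hxφ, W, hWn, hW⟩ := R.slice (c t₀) (hR t₀)
  obtain ⟨u, hu⟩ := exists_span_of_finrank hWn
  refine ⟨c ⁻¹' φ.source, hc.continuousAt (φ.open_source.mem_nhds hxφ),
    fun i t => dAt φ.symm (φ (c t)) (u i), fun i => ?_, fun t ht => ?_⟩
  · have h1 : IsField (n := n) (fun t => φ.symm (φ (c t))) (fun t => dAt φ.symm (φ (c t)) (u i))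
        (c ⁻¹' φ.source) :=
      (isField_dAt φ.open_target (contMDiffOn_symm_of_mem_maximalAtlas hφ) (u i)).comp
        (σ := fun t => φ (c t)) (φ.continuousOn.comp hc.continuousOn (mapsTo_preimage _ _))
        fun t ht => φ.map_source ht
    refine ContinuousOn.congr h1 fun t ht => ?_
    simp only [φ.left_inv (show c t ∈ φ.source from ht)]
  · change plane (c t) (tanAt R.carrier (c t)) = _
    rw [plane_inj]
    exact ⟨rfl, (tanAt_eq_map hφ hW ht (hR t)).trans (range_map_span hu _)⟩

/-- The images of `T_{γ(0)} R` under the linearized Reeb flow form a continuous Lagrangian section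
over the chord, since the flow preserves `λ` and `dλ`. -/
theorem isLagSec_transport {γ : ReebChord R R'} {Φ : ℝ → M → M} (h : γ.IsLocalFlow Φ) :
    IsLagSec lam γ.path (γ.transport Φ) := by
  have hL := isLagrangian_iff.1 (R.isLagrangian_tanAt γ.source_mem)
  have hpath : ∀ t : 𝕀, Φ t (γ.path 0) = γ.path t := by
    obtain ⟨ε, hε, U, hU, hxU, -, h0, hint, hp⟩ := h
    exact hp
  refine ⟨fun t => ⟨hpath t, ?_⟩, fun t₀ => ?_⟩
  · obtain ⟨h1, h2⟩ := lamAt_omegaAt_flow h t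
    refine isLagrangian_iff.2 ⟨?_, ?_, ?_⟩
    · rintro _ ⟨v, hv, rfl⟩
      exact (h1 v).trans (hL.1 v hv)
    · rintro _ ⟨v, hv, rfl⟩ _ ⟨w, hw, rfl⟩
      exact (h2 v w).trans (hL.2.1 v hv w hw)
    · change Module.finrank ℝ ((tanAt R.carrier (γ.path 0)).map
        (dMap (Φ t) (γ.path 0)).toLinearMap) = n
      refine Eq.trans ?_ hL.2.2
      let f : tanAt (n := n) R.carrier (γ.path 0) →ₗ[ℝ] Model n :=
        (dMap (Φ t) (γ.path 0)).toLinearMap.domRestrict _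
      have hf : Function.Injective f := by
        rw [injective_iff_map_eq_zero]
        rintro ⟨v, hv⟩ h0
        have h0' : dMap (Φ t) (γ.path 0) v = 0 := h0
        refine Subtype.ext (lam.omegaAt_nondegenerate (hL.1 v hv) fun w _ => ?_)
        rw [← h2, h0', map_zero, zero_apply]
      have := LinearMap.finrank_range_of_inj hf
      rwa [LinearMap.range_domRestrict] at this
  · obtain ⟨u, hu⟩ := exists_span_of_finrank hL.2.2
    refine ⟨univ, univ_mem, fun i t => dMap (Φ t) (γ.path 0) (u i), fun i => ?_, fun t _ => ?_⟩
    · have h1 := isField_flow h (u i)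
      have : (fun t : 𝕀 => Φ t (γ.path 0)) = γ.path := funext hpath
      rwa [this] at h1
    · rw [transport_eq, plane_inj]
      exact ⟨hpath t, range_map_span hu _⟩

end LagrangianSections

/-! ### Symplectic frames over squares and cubes -/

section Frames

variable {n : ℕ} {M : Type*} [TopologicalSpace M] [ChartedSpace (Model n) M]
  [IsManifold (𝓡 (2 * n + 1)) ∞ M] {X : Type*} [TopologicalSpace X]

/-- The vectors `e i`, `f i` with `i < k` form a symplectic basis of a subspace of `ξ_x`. -/
structure IsSymplecticAt (lam : ContactForm n M) (x : M) (k : ℕ) (e f : ℕ → Model n) : Prop where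
  lam_e : ∀ i < k, lam.lamAt x (e i) = 0
  lam_f : ∀ i < k, lam.lamAt x (f i) = 0
  ee : ∀ i < k, ∀ j < k, lam.omegaAt x (e i) (e j) = 0
  ff : ∀ i < k, ∀ j < k, lam.omegaAt x (f i) (f j) = 0
  ef : ∀ i < k, ∀ j < k, lam.omegaAt x (e i) (f j) = if i = j then 1 else 0

namespace IsSymplecticAt

variable {lam : ContactForm n M} {x : M} {k : ℕ} {e f : ℕ → Model n}

theorem fe (h : IsSymplecticAt lam x k e f) {i j : ℕ} (hi : i < k) (hj : j < k) :
    lam.omegaAt x (f i) (e j) = if i = j then -1 else 0 := by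
  rw [lam.omegaAt_swap, h.ef j hj i hi]
  by_cases hij : i = j
  · simp [hij]
  · simp [hij, Ne.symm hij]

/-- The projection to the symplectic complement of `e i`, `f i` in `ξ` along these vectors and the
Reeb vector. -/
def proj (lam : ContactForm n M) (x : M) (k : ℕ) (e f : ℕ → Model n) (v : Model n) : Model n :=
  v - lam.lamAt x v • lam.reebAt x -
    ∑ i ∈ Finset.range k, (lam.omegaAt x v (f i) • e i - lam.omegaAt x v (e i) • f i)

theorem lamAt_proj (h : IsSymplecticAt lam x k e f) (v : Model n) :
    lam.lamAt x (proj lam x k e f v) = 0 := by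
  rw [proj, map_sub, map_sub, map_smul, lam.lamAt_reebAt, map_sum, Finset.sum_eq_zero]
  · simp
  · intro i hi
    rw [Finset.mem_range] at hi
    simp [h.lam_e i hi, h.lam_f i hi]

theorem omegaAt_proj (v w : Model n) :
    lam.omegaAt x (proj lam x k e f v) w = lam.omegaAt x v w -
      ∑ i ∈ Finset.range k, (lam.omegaAt x v (f i) * lam.omegaAt x (e i) w -
        lam.omegaAt x v (e i) * lam.omegaAt x (f i) w) := by
  simp only [proj, map_sub, map_smul, map_sum, sub_apply, smul_apply, lam.omegaAt_reebAt,
    FunLike.coe_sum, Finset.sum_apply, smul_eq_mul, mul_zero, sub_zero]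

theorem omegaAt_proj_e (h : IsSymplecticAt lam x k e f) (v : Model n) {j : ℕ} (hj : j < k) :
    lam.omegaAt x (proj lam x k e f v) (e j) = 0 := by
  rw [omegaAt_proj, Finset.sum_eq_single_of_mem j (Finset.mem_range.2 hj)]
  · simp [h.ee j hj j hj, h.fe hj hj]
  · intro i hi hij
    rw [Finset.mem_range] at hi
    simp [h.ee i hi j hj, h.fe hi hj, hij]

theorem omegaAt_proj_f (h : IsSymplecticAt lam x k e f) (v : Model n) {j : ℕ} (hj : j < k) :
    lam.omegaAt x (proj lam x k e f v) (f j) = 0 := by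
  rw [omegaAt_proj, Finset.sum_eq_single_of_mem j (Finset.mem_range.2 hj)]
  · simp [h.ff j hj j hj, h.ef j hj j hj]
  · intro i hi hij
    rw [Finset.mem_range] at hi
    simp [h.ff i hi j hj, h.ef i hi j hj, hij]

theorem omegaAt_proj_proj (h : IsSymplecticAt lam x k e f) (v w : Model n) :
    lam.omegaAt x (proj lam x k e f v) (proj lam x k e f w) =
      lam.omegaAt x (proj lam x k e f v) w := by
  conv_lhs => rw [lam.omegaAt_swap, omegaAt_proj, lam.omegaAt_swap, neg_sub]
  rw [Finset.sum_eq_zero, zero_sub, neg_neg]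
  intro i hi
  rw [Finset.mem_range] at hi
  rw [lam.omegaAt_swap x (e i), lam.omegaAt_swap x (f i), h.omegaAt_proj_e v hi,
    h.omegaAt_proj_f v hi]
  simp

/-- As long as `k < n`, the symplectic complement does not vanish. -/
theorem exists_proj (h : IsSymplecticAt lam x k e f) (hk : k < n) :
    ∃ v w, lam.omegaAt x (proj lam x k e f v) (proj lam x k e f w) ≠ 0 := by
  by_contra! hcon
  have h0 : ∀ v, proj lam x k e f v = 0 := fun v =>
    lam.omegaAt_nondegenerate (h.lamAt_proj v) fun w _ => by rw [← h.omegaAt_proj_proj, hcon]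
  let g : Unit ⊕ Fin k ⊕ Fin k → Model n :=
    Sum.elim (fun _ => lam.reebAt x) (Sum.elim (fun i => e i) fun i => f i)
  have hg : Submodule.span ℝ (range g) = ⊤ := by
    rw [eq_top_iff]
    intro v _
    have h1 := h0 v
    rw [proj, sub_sub, sub_eq_zero] at h1
    rw [h1]
    have hm : ∀ i, g i ∈ Submodule.span ℝ (range g) := fun i => Submodule.subset_span ⟨i, rfl⟩
    refine Submodule.add_mem _ (Submodule.smul_mem _ _ (hm (Sum.inl ())))
      (Submodule.sum_mem _ fun i hi => ?_)
    rw [Finset.mem_range] at hi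
    exact Submodule.sub_mem _ (Submodule.smul_mem _ _ (hm (Sum.inr (Sum.inl ⟨i, hi⟩))))
      (Submodule.smul_mem _ _ (hm (Sum.inr (Sum.inr ⟨i, hi⟩))))
  have h2 := finrank_range_le_card (R := ℝ) g
  rw [Set.finrank, hg, finrank_top] at h2
  simp at h2
  omega

/-- A full symplectic basis of `ξ_x` together with the Reeb vector spans the tangent space. -/
theorem proj_eq_zero (h : IsSymplecticAt lam x n e f) (v : Model n) :
    proj lam x n e f v = 0 := by
  let g : Unit ⊕ Fin n ⊕ Fin n → Model n :=
    Sum.elim (fun _ => lam.reebAt x) (Sum.elim (fun i => e i) fun i => f i)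
  have hli : LinearIndependent ℝ g := by
    rw [Fintype.linearIndependent_iff]
    intro c hc
    simp only [Fintype.sum_sum_type, g, Sum.elim_inl, Sum.elim_inr, Finset.univ_unique,
      Finset.sum_singleton] at hc
    have h1 := congrArg (lam.lamAt x) hc
    simp only [map_add, map_sum, map_smul, lam.lamAt_reebAt, h.lam_e _ (Fin.is_lt _),
      h.lam_f _ (Fin.is_lt _), smul_eq_mul, mul_zero, Finset.sum_const_zero, add_zero, mul_one,
      map_zero] at h1
    have h2 : ∀ j : Fin n, c (Sum.inr (Sum.inl j)) = 0 := fun j => by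
      have h3 := congrArg (fun u => lam.omegaAt x u (f j)) hc
      simpa [lam.omegaAt_reebAt, h.ef _ (Fin.is_lt _) _ (Fin.is_lt _),
        h.ff _ (Fin.is_lt _) _ (Fin.is_lt _), FunLike.coe_sum, Finset.sum_apply,
        Fin.val_inj] using h3
    have h3 : ∀ j : Fin n, c (Sum.inr (Sum.inr j)) = 0 := fun j => by
      have h3 := congrArg (fun u => lam.omegaAt x u (e j)) hc
      simpa [lam.omegaAt_reebAt, h.fe (Fin.is_lt _) (Fin.is_lt _),
        h.ee _ (Fin.is_lt _) _ (Fin.is_lt _), FunLike.coe_sum, Finset.sum_apply,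
        Fin.val_inj] using h3
    rintro (i | i | i)
    · exact h1
    · exact h2 i
    · exact h3 i
  have htop := hli.span_eq_top_of_card_eq_finrank' (by simp; ring)
  refine lam.omegaAt_nondegenerate (h.lamAt_proj v) fun w hw' => ?_
  clear hw'
  have hw : w ∈ Submodule.span ℝ (range g) := by rw [htop]; trivial
  induction hw using Submodule.span_induction with
  | mem u hu =>
    obtain ⟨i | i | i, rfl⟩ := hu
    · simp only [g, Sum.elim_inl]
      rw [lam.omegaAt_swap, lam.omegaAt_reebAt, neg_zero]
    · exact h.omegaAt_proj_e v i.2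
    · exact h.omegaAt_proj_f v i.2
  | zero => simp
  | add u u' _ _ h1 h2 => rw [map_add, h1, h2, add_zero]
  | smul a u _ h1 => rw [map_smul, h1, smul_zero]

theorem eq_sum (h : IsSymplecticAt lam x n e f) {v : Model n} (hv : lam.lamAt x v = 0) :
    v = ∑ i ∈ Finset.range n, (lam.omegaAt x v (f i) • e i + lam.omegaAt x (e i) v • f i) := by
  have h1 := h.proj_eq_zero v
  rw [proj, hv, zero_smul, sub_zero, sub_eq_zero] at h1
  conv_lhs => rw [h1]
  refine Finset.sum_congr rfl fun i _ => ?_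
  rw [lam.omegaAt_swap x (e i), neg_smul, sub_eq_add_neg]

theorem omegaAt_eq_sum (h : IsSymplecticAt lam x n e f) {v w : Model n} (hv : lam.lamAt x v = 0) :
    lam.omegaAt x v w = ∑ i ∈ Finset.range n, (lam.omegaAt x v (f i) * lam.omegaAt x (e i) w -
      lam.omegaAt x (e i) v * lam.omegaAt x w (f i)) := by
  have h1 := congrArg (fun u => lam.omegaAt x u w) (h.eq_sum hv)
  simp only [map_sum, map_add, map_smul, FunLike.coe_sum, Finset.sum_apply, add_apply, smul_apply,
    smul_eq_mul] at h1
  rw [h1]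
  refine Finset.sum_congr rfl fun i _ => ?_
  rw [lam.omegaAt_swap x w]
  ring

end IsSymplecticAt

/-- A continuous symplectic frame of rank `k` in `w^*ξ` over the set `S`. -/
structure IsFrameOn (lam : ContactForm n M) (w : X → M) (k : ℕ) (e f : ℕ → X → Model n)
    (S : Set X) : Prop where
  field_e : ∀ i < k, IsField w (e i) S
  field_f : ∀ i < k, IsField w (f i) S
  symp : ∀ z ∈ S, IsSymplecticAt lam (w z) k (fun i => e i z) fun i => f i z

theorem IsFrameOn.mono {lam : ContactForm n M} {w : X → M} {k : ℕ} {e f : ℕ → X → Model n}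
    {S T : Set X} (h : IsFrameOn lam w k e f S) (hT : T ⊆ S) : IsFrameOn lam w k e f T :=
  ⟨fun i hi => (h.field_e i hi).mono hT, fun i hi => (h.field_f i hi).mono hT,
    fun z hz => h.symp z (hT hz)⟩

theorem IsFrameOn.comp {lam : ContactForm n M} {w : X → M} {k : ℕ} {e f : ℕ → X → Model n}
    {S : Set X} (h : IsFrameOn lam w k e f S) {Z : Type*} [TopologicalSpace Z] {σ : Z → X}
    {T : Set Z} (hσ : ContinuousOn σ T) (hm : MapsTo σ T S) :
    IsFrameOn lam (fun z => w (σ z)) k (fun i z => e i (σ z)) (fun i z => f i (σ z)) T :=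
  ⟨fun i hi => (h.field_e i hi).comp hσ hm, fun i hi => (h.field_f i hi).comp hσ hm,
    fun z hz => h.symp (σ z) (hm hz)⟩

theorem IsFrameOn.isField_proj {lam : ContactForm n M} {w : X → M} {k : ℕ} {e f : ℕ → X → Model n}
    {S : Set X} (h : IsFrameOn lam w k e f S) {v : X → Model n} (hv : IsField w v S) :
    IsField w
      (fun z => IsSymplecticAt.proj lam (w z) k (fun i => e i z) (fun i => f i z) (v z)) S := by
  have hR : IsField w (fun z => lam.reebAt (w z)) S :=
    (isField_reebAt lam).comp hv.continuousOn (mapsTo_univ _ _)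
  refine (hv.sub (hR.smul (hv.lamAt lam))).sub (IsField.sum _ hv.continuousOn fun i hi => ?_)
  rw [Finset.mem_range] at hi
  exact ((h.field_e i hi).smul (hv.omegaAt lam (h.field_f i hi))).sub
    ((h.field_f i hi).smul (hv.omegaAt lam (h.field_e i hi)))

/-- Near every point, `ξ` has symplectic frames of every rank `k ≤ n` (Gram-Schmidt process). -/
theorem exists_isFrameOn_nhds (lam : ContactForm n M) (x₀ : M) {k : ℕ} (hk : k ≤ n) :
    ∃ U : Set M, IsOpen U ∧ x₀ ∈ U ∧ ∃ e f : ℕ → M → Model n, IsFrameOn lam id k e f U := by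
  induction k with
  | zero =>
    exact ⟨univ, isOpen_univ, mem_univ _, fun _ _ => (0 : Model n), fun _ _ => (0 : Model n),
      fun _ h => absurd h (Nat.not_lt_zero _), fun _ h => absurd h (Nat.not_lt_zero _),
      fun z _ => by constructor <;> simp⟩
  | succ k ih =>
    obtain ⟨U, hU, hxU, e, f, h⟩ := ih (by omega)
    obtain ⟨v, w, hvw⟩ := (h.symp x₀ hxU).exists_proj (by omega)
    set S := U ∩ (extChartAt (𝓡 (2 * n + 1)) x₀).source
    have hS : IsOpen S := hU.inter (isOpen_extChartAt_source x₀)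
    have hxS : x₀ ∈ S := ⟨hxU, mem_extChartAt_source _⟩
    have hc : ∀ u : Model n, IsField id (constField x₀ (coord x₀ x₀ u)) S := fun u =>
      (isField_constField x₀ _).mono inter_subset_right
    have hc0 : ∀ u : Model n, constField x₀ (coord x₀ x₀ u) x₀ = u :=
      fun u => constField_coord (mem_extChartAt_source _) u
    have h' := h.mono (T := S) inter_subset_left
    -- Two vectors at `x₀` that pair nontrivially are extended with constant chart coordinates and
    -- projected to the complement of the frame of rank `k`; near `x₀` they still pair nontrivially.
    let a : M → Model n := fun z => IsSymplecticAt.proj lam z k (fun i => e i z) (fun i => f i z)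
      (constField x₀ (coord x₀ x₀ v) z)
    let b : M → Model n := fun z => IsSymplecticAt.proj lam z k (fun i => e i z) (fun i => f i z)
      (constField x₀ (coord x₀ x₀ w) z)
    have ha : IsField id a S := h'.isField_proj (hc v)
    have hb : IsField id b S := h'.isField_proj (hc w)
    have hab : ContinuousOn (fun z => lam.omegaAt z (a z) (b z)) S := ha.omegaAt lam hb
    set U' := S ∩ (fun z => lam.omegaAt z (a z) (b z)) ⁻¹' {0}ᶜ
    have hU' : IsOpen U' := hab.isOpen_inter_preimage hS isOpen_compl_singleton
    have hUS : U' ⊆ S := inter_subset_left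
    have hne : ∀ z ∈ U', lam.omegaAt z (a z) (b z) ≠ 0 := fun z hz => hz.2
    refine ⟨U', hU', ⟨hxS, ?_⟩, Function.update e k a,
      Function.update f k fun z => (lam.omegaAt z (a z) (b z))⁻¹ • b z, ?_, ?_, ?_⟩
    · simp only [mem_preimage, mem_compl_iff, mem_singleton_iff, a, b, hc0]
      exact hvw
    · intro i hi
      rcases Nat.lt_succ_iff_lt_or_eq.1 hi with hik | rfl
      · rw [Function.update_of_ne hik.ne]
        exact (h'.field_e i hik).mono hUS
      · rw [Function.update_self]
        exact ha.mono hUS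
    · intro i hi
      rcases Nat.lt_succ_iff_lt_or_eq.1 hi with hik | rfl
      · rw [Function.update_of_ne hik.ne]
        exact (h'.field_f i hik).mono hUS
      · rw [Function.update_self]
        exact (hb.mono hUS).smul ((hab.mono hUS).inv₀ hne)
    · intro z hz
      have hs := h.symp z (hUS hz).1
      have ha0 : lam.lamAt z (a z) = 0 := hs.lamAt_proj _
      have hb0 : lam.lamAt z (b z) = 0 := hs.lamAt_proj _
      have hae : ∀ j < k, lam.omegaAt z (a z) (e j z) = 0 := fun j hj => hs.omegaAt_proj_e _ hj
      have haf : ∀ j < k, lam.omegaAt z (a z) (f j z) = 0 := fun j hj => hs.omegaAt_proj_f _ hj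
      have hbe : ∀ j < k, lam.omegaAt z (b z) (e j z) = 0 := fun j hj => hs.omegaAt_proj_e _ hj
      have hbf : ∀ j < k, lam.omegaAt z (b z) (f j z) = 0 := fun j hj => hs.omegaAt_proj_f _ hj
      have hea : ∀ j < k, lam.omegaAt z (e j z) (a z) = 0 := fun j hj => by
        rw [lam.omegaAt_swap, hae j hj, neg_zero]
      have heb : ∀ j < k, lam.omegaAt z (e j z) (b z) = 0 := fun j hj => by
        rw [lam.omegaAt_swap, hbe j hj, neg_zero]
      have hfb : ∀ j < k, lam.omegaAt z (f j z) (b z) = 0 := fun j hj => by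
        rw [lam.omegaAt_swap, hbf j hj, neg_zero]
      have hk' : ∀ i < k, i ≠ k := fun i hi => hi.ne
      constructor
      · intro i hi
        rcases Nat.lt_succ_iff_lt_or_eq.1 hi with hik | rfl
        · rw [Function.update_of_ne hik.ne]; exact hs.lam_e i hik
        · rw [Function.update_self]; exact ha0
      · intro i hi
        rcases Nat.lt_succ_iff_lt_or_eq.1 hi with hik | rfl
        · rw [Function.update_of_ne hik.ne]; exact hs.lam_f i hik
        · rw [Function.update_self, map_smul]; simp [hb0]
      · intro i hi j hj
        rcases Nat.lt_succ_iff_lt_or_eq.1 hi with hik | rfl <;>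
        rcases Nat.lt_succ_iff_lt_or_eq.1 hj with hjk | rfl
        · rw [Function.update_of_ne hik.ne, Function.update_of_ne hjk.ne]; exact hs.ee i hik j hjk
        · rw [Function.update_of_ne hik.ne, Function.update_self]; exact hea i hik
        · rw [Function.update_of_ne hjk.ne, Function.update_self]; exact hae j hjk
        · exact lam.omegaAt_self _ _
      · intro i hi j hj
        rcases Nat.lt_succ_iff_lt_or_eq.1 hi with hik | rfl <;>
        rcases Nat.lt_succ_iff_lt_or_eq.1 hj with hjk | rfl
        · rw [Function.update_of_ne hik.ne, Function.update_of_ne hjk.ne]; exact hs.ff i hik j hjk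
        · rw [Function.update_of_ne hik.ne, Function.update_self, map_smul]
          simp [hfb i hik]
        · rw [Function.update_of_ne hjk.ne, Function.update_self, map_smul]
          simp [hbf j hjk]
        · exact lam.omegaAt_self _ _
      · intro i hi j hj
        rcases Nat.lt_succ_iff_lt_or_eq.1 hi with hik | rfl <;>
        rcases Nat.lt_succ_iff_lt_or_eq.1 hj with hjk | rfl
        · rw [Function.update_of_ne hik.ne, Function.update_of_ne hjk.ne]; exact hs.ef i hik j hjk
        · rw [Function.update_of_ne hik.ne, Function.update_self, map_smul]
          simp [heb i hik, hik.ne]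
        · rw [Function.update_of_ne hjk.ne, Function.update_self]
          simp [haf j hjk, hjk.ne']
        · rw [Function.update_self, Function.update_self, map_smul, if_pos rfl, smul_eq_mul]
          exact inv_mul_cancel₀ (hne z hz)

/-- Transport of a vector `v ∈ ξ_{w y}` to `ξ_{w z}` with the coordinates in a frame kept. -/
def frameTransport (lam : ContactForm n M) (w : X → M) (e f : ℕ → X → Model n) (y z : X)
    (v : Model n) : Model n :=
  ∑ i ∈ Finset.range n, (lam.omegaAt (w y) v (f i y) • e i z + lam.omegaAt (w y) (e i y) v • f i z)

section

variable {lam : ContactForm n M} {w : X → M} {e f : ℕ → X → Model n} {S : Set X}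

theorem lamAt_frameTransport (h : IsFrameOn lam w n e f S) {y z : X} (hz : z ∈ S) (v : Model n) :
    lam.lamAt (w z) (frameTransport lam w e f y z v) = 0 := by
  rw [frameTransport, map_sum]
  refine Finset.sum_eq_zero fun i hi => ?_
  rw [Finset.mem_range] at hi
  simp [(h.symp z hz).lam_e i hi, (h.symp z hz).lam_f i hi]

theorem omegaAt_frameTransport (h : IsFrameOn lam w n e f S) {y z : X} (hy : y ∈ S) (hz : z ∈ S)
    {u v : Model n} (hu : lam.lamAt (w y) u = 0) :
    lam.omegaAt (w z) (frameTransport lam w e f y z u) (frameTransport lam w e f y z v) =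
      lam.omegaAt (w y) u v := by
  have hs := h.symp z hz
  have hf : ∀ j < n, ∀ u, lam.omegaAt (w z) (frameTransport lam w e f y z u) (f j z) =
      lam.omegaAt (w y) u (f j y) := by
    intro j hj u
    simp only [frameTransport, map_sum, FunLike.coe_sum, Finset.sum_apply, map_add, map_smul,
      add_apply, smul_apply, smul_eq_mul]
    rw [Finset.sum_eq_single_of_mem j (Finset.mem_range.2 hj)]
    · simp [hs.ef j hj j hj, hs.ff j hj j hj]
    · intro i hi hij
      rw [Finset.mem_range] at hi
      simp [hs.ef i hi j hj, hs.ff i hi j hj, hij]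
  have he : ∀ j < n, ∀ u, lam.omegaAt (w z) (e j z) (frameTransport lam w e f y z u) =
      lam.omegaAt (w y) (e j y) u := by
    intro j hj u
    simp only [frameTransport, map_sum, map_add, map_smul, smul_eq_mul]
    rw [Finset.sum_eq_single_of_mem j (Finset.mem_range.2 hj)]
    · simp [hs.ef j hj j hj, hs.ee j hj j hj]
    · intro i hi hij
      rw [Finset.mem_range] at hi
      simp [hs.ef j hj i hi, hs.ee j hj i hi, hij.symm]
  rw [hs.omegaAt_eq_sum (lamAt_frameTransport h hz u), (h.symp y hy).omegaAt_eq_sum hu]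
  refine Finset.sum_congr rfl fun i hi => ?_
  rw [Finset.mem_range] at hi
  rw [hf i hi, hf i hi, he i hi, he i hi]

theorem frameTransport_self (h : IsFrameOn lam w n e f S) {y : X} (hy : y ∈ S) {v : Model n}
    (hv : lam.lamAt (w y) v = 0) : frameTransport lam w e f y y v = v :=
  ((h.symp y hy).eq_sum hv).symm

theorem isField_frameTransport (h : IsFrameOn lam w n e f S) {ρ : X → X} (hρ : ContinuousOn ρ S)
    (hw : ContinuousOn w S) {T : Set X} (hTS : T ⊆ S) (hm : MapsTo ρ S T) {v : X → Model n}
    (hv : IsField w v T) :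
    IsField w (fun z => frameTransport lam w e f (ρ z) z (v (ρ z))) S := by
  refine IsField.sum _ hw fun i hi => ?_
  rw [Finset.mem_range] at hi
  have hv' := hv.comp hρ hm
  have hf := ((h.field_f i hi).mono hTS).comp hρ hm
  have he := ((h.field_e i hi).mono hTS).comp hρ hm
  exact ((h.field_e i hi).smul (hv'.omegaAt lam hf)).add
    ((h.field_f i hi).smul (he.omegaAt lam hv'))

/-- Frames over two closed sets can be glued if the second set retracts to the intersection: the
frame on the first set, restricted to the intersection, is extended to the second one with constant
coordinates along the fibres of the retraction. -/
theorem IsFrameOn.glue {w : X → M} (hw : Continuous w) {S₁ S₂ : Set X} (hS₁ : IsClosed S₁)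
    (hS₂ : IsClosed S₂) {ρ : X → X} (hρ : ContinuousOn ρ S₂) (hm : MapsTo ρ S₂ (S₁ ∩ S₂))
    (hid : ∀ z ∈ S₁ ∩ S₂, ρ z = z) {e f e' f' : ℕ → X → Model n} (h : IsFrameOn lam w n e f S₁)
    (h' : IsFrameOn lam w n e' f' S₂) : ∃ e'' f'', IsFrameOn lam w n e'' f'' (S₁ ∪ S₂) := by
  classical
  let T : (ℕ → X → Model n) → ℕ → X → Model n := fun g i z =>
    if z ∈ S₁ then g i z else frameTransport lam w e' f' (ρ z) z (g i (ρ z))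
  have hT2 : ∀ g : ℕ → X → Model n, ∀ i, (∀ z ∈ S₁, lam.lamAt (w z) (g i z) = 0) → ∀ z ∈ S₂,
      T g i z = frameTransport lam w e' f' (ρ z) z (g i (ρ z)) := by
    intro g i hg z hz
    by_cases hz1 : z ∈ S₁
    · simp only [T, hz1, if_true]
      rw [hid z ⟨hz1, hz⟩, frameTransport_self h' hz (hg z hz1)]
    · simp only [T, hz1, if_false]
  have hTf : ∀ g : ℕ → X → Model n, ∀ i, (∀ z ∈ S₁, lam.lamAt (w z) (g i z) = 0) →
      IsField w (g i) S₁ → IsField w (T g i) (S₁ ∪ S₂) := by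
    intro g i hg hgf
    refine ContinuousOn.union_of_isClosed ?_ ?_ hS₁ hS₂
    · exact hgf.congr fun z hz => by simp only [T, hz, if_true]
    · exact (isField_frameTransport h' hρ hw.continuousOn inter_subset_right hm
        (hgf.mono inter_subset_left)).congr (hT2 g i hg)
  have he : ∀ i < n, ∀ z ∈ S₁, lam.lamAt (w z) (e i z) = 0 :=
    fun i hi z hz => (h.symp z hz).lam_e i hi
  have hf : ∀ i < n, ∀ z ∈ S₁, lam.lamAt (w z) (f i z) = 0 :=
    fun i hi z hz => (h.symp z hz).lam_f i hi
  refine ⟨T e, T f, fun i hi => hTf e i (he i hi) (h.field_e i hi),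
    fun i hi => hTf f i (hf i hi) (h.field_f i hi), fun z hz => ?_⟩
  by_cases hz1 : z ∈ S₁
  · simp only [T, hz1, if_true]
    exact h.symp z hz1
  · have hz2 : z ∈ S₂ := hz.resolve_left hz1
    simp only [T, hz1, if_false]
    have hρ1 : ρ z ∈ S₁ := (hm hz2).1
    have hρ2 : ρ z ∈ S₂ := (hm hz2).2
    have hs := h.symp _ hρ1
    refine ⟨fun i _ => lamAt_frameTransport h' hz2 _, fun i _ => lamAt_frameTransport h' hz2 _,
      ?_, ?_, ?_⟩
    · intro i hi j hj
      rw [omegaAt_frameTransport h' hρ2 hz2 (he i hi _ hρ1)]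
      exact hs.ee i hi j hj
    · intro i hi j hj
      rw [omegaAt_frameTransport h' hρ2 hz2 (hf i hi _ hρ1)]
      exact hs.ff i hi j hj
    · intro i hi j hj
      rw [omegaAt_frameTransport h' hρ2 hz2 (he i hi _ hρ1)]
      exact hs.ef i hi j hj

end

/-- A property of intervals that is stable under concatenation and holds for all intervals of length
`1 / N` that start in `[0,1]` holds for `[0,1]`. -/
theorem interval_induction {p : ℝ → ℝ → Prop} {N : ℕ} (hN : 0 < N)
    (hsmall : ∀ a ∈ Icc (0 : ℝ) 1, p a (a + 1 / N))
    (hglue : ∀ a b c, a ≤ b → b ≤ c → p a b → p b c → p a c) : p 0 1 := by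
  have hN' : (0 : ℝ) < N := by exact_mod_cast hN
  have h : ∀ k : ℕ, k + 1 ≤ N → p 0 ((k + 1 : ℕ) / N) := by
    intro k
    induction k with
    | zero => intro _; simpa using hsmall 0 (by simp)
    | succ k ih =>
      intro hk
      have h1 := hsmall ((k + 1 : ℕ) / N) ⟨by positivity, by
        rw [div_le_one hN']; exact_mod_cast (by omega : k + 1 ≤ N)⟩
      have h2 : ((k + 1 : ℕ) : ℝ) / N + 1 / N = ((k + 1 + 1 : ℕ) : ℝ) / N := by push_cast; ring
      rw [h2] at h1
      refine hglue _ _ _ (by positivity) ?_ (ih (by omega)) h1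
      gcongr
      omega
  have h1 := h (N - 1) (by omega)
  rwa [Nat.sub_add_cancel hN, div_self hN'.ne'] at h1

/-- The bundle `w^*ξ` over a cube has a symplectic frame: the cube is subdivided into small cubes
with frames, which are glued in one direction after the other. -/
theorem exists_isFrameOn_cube (lam : ContactForm n M) {w : ℝ × ℝ × ℝ → M} (hw : Continuous w) :
    ∃ e f, IsFrameOn lam w n e f (Icc (0 : ℝ) 1 ×ˢ Icc (0 : ℝ) 1 ×ˢ Icc (0 : ℝ) 1) := by
  let good : Set (ℝ × ℝ × ℝ) → Prop := fun S => ∃ e f, IsFrameOn lam w n e f S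
  choose U hU hxU hF using fun x : M => exists_isFrameOn_nhds lam x (le_refl n)
  obtain ⟨δ, hδ, hball⟩ := lebesgue_number_lemma_of_metric
    (s := Icc (0 : ℝ) 1 ×ˢ Icc (0 : ℝ) 1 ×ˢ Icc (0 : ℝ) 1) (c := fun x => w ⁻¹' U x)
    (isCompact_Icc.prod (isCompact_Icc.prod isCompact_Icc)) (fun x => (hU x).preimage hw)
    fun z _ => mem_iUnion.2 ⟨w z, hxU (w z)⟩
  obtain ⟨N, hN⟩ := exists_nat_one_div_lt hδ
  have hN1 : 1 / ((N + 1 : ℕ) : ℝ) < δ := by push_cast; exact hN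
  set N' := N + 1
  have hsm : ∀ a ∈ Icc (0 : ℝ) 1, ∀ b ∈ Icc (0 : ℝ) 1, ∀ c ∈ Icc (0 : ℝ) 1,
      good (Icc a (a + 1 / N') ×ˢ Icc b (b + 1 / N') ×ˢ Icc c (c + 1 / N')) := by
    intro a ha b hb c hc
    obtain ⟨x, hx⟩ := hball (a, b, c) ⟨ha, hb, hc⟩
    obtain ⟨e, f, h⟩ := hF x
    have h1 := h.comp (σ := w) (T := w ⁻¹' U x) hw.continuousOn (mapsTo_preimage _ _)
    refine ⟨_, _, h1.mono (subset_trans ?_ hx)⟩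
    rintro ⟨a', b', c'⟩ ⟨ha', hb', hc'⟩
    have hd : ∀ s s' : ℝ, s' ∈ Icc s (s + 1 / N') → dist s' s < δ := by
      intro s s' hs
      rw [Real.dist_eq, abs_of_nonneg (by linarith [hs.1])]
      linarith [hs.2]
    rw [Metric.mem_ball, Prod.dist_eq, Prod.dist_eq]
    exact max_lt (hd _ _ ha') (max_lt (hd _ _ hb') (hd _ _ hc'))
  have hcl : ∀ {a b c d r s : ℝ}, IsClosed (Icc a b ×ˢ Icc c d ×ˢ Icc r s) :=
    fun {a b c d r s} => isClosed_Icc.prod (isClosed_Icc.prod isClosed_Icc)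
  have h3 : ∀ a ∈ Icc (0 : ℝ) 1, ∀ b ∈ Icc (0 : ℝ) 1,
      good (Icc a (a + 1 / N') ×ˢ Icc b (b + 1 / N') ×ˢ Icc 0 1) := by
    intro a ha b hb
    refine interval_induction
      (p := fun r s => good (Icc a (a + 1 / N') ×ˢ Icc b (b + 1 / N') ×ˢ Icc r s))
      N.succ_pos (fun c hc => hsm a ha b hb c hc) ?_
    rintro r s t hrs hst ⟨e, f, h⟩ ⟨e', f', h'⟩
    -- The retraction of the second box to the common face is a projection.
    obtain ⟨e'', f'', h''⟩ := h.glue hw hcl hcl (ρ := fun z => (z.1, z.2.1, s)) (by fun_prop)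
      (fun z hz => ⟨⟨hz.1, hz.2.1, hrs, le_rfl⟩, ⟨hz.1, hz.2.1, le_rfl, hst⟩⟩)
      (fun z hz => Prod.ext rfl (Prod.ext rfl (le_antisymm hz.2.2.2.1 hz.1.2.2.2))) h'
    refine ⟨e'', f'', h''.mono ?_⟩
    rw [← Set.prod_union, ← Set.prod_union, Icc_union_Icc_eq_Icc hrs hst]
  have h2 : ∀ a ∈ Icc (0 : ℝ) 1, good (Icc a (a + 1 / N') ×ˢ Icc 0 1 ×ˢ Icc 0 1) := by
    intro a ha
    refine interval_induction (p := fun r s => good (Icc a (a + 1 / N') ×ˢ Icc r s ×ˢ Icc 0 1))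
      N.succ_pos (fun b hb => h3 a ha b hb) ?_
    rintro r s t hrs hst ⟨e, f, h⟩ ⟨e', f', h'⟩
    obtain ⟨e'', f'', h''⟩ := h.glue hw hcl hcl (ρ := fun z => (z.1, s, z.2.2)) (by fun_prop)
      (fun z hz => ⟨⟨hz.1, ⟨hrs, le_rfl⟩, hz.2.2⟩, ⟨hz.1, ⟨le_rfl, hst⟩, hz.2.2⟩⟩)
      (fun z hz => Prod.ext rfl (Prod.ext (le_antisymm hz.2.2.1.1 hz.1.2.1.2) rfl)) h'
    refine ⟨e'', f'', h''.mono ?_⟩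
    rw [← Set.prod_union, ← Set.union_prod, Icc_union_Icc_eq_Icc hrs hst]
  refine interval_induction (p := fun r s => good (Icc r s ×ˢ Icc 0 1 ×ˢ Icc 0 1))
    N.succ_pos (fun a ha => h2 a ha) ?_
  rintro r s t hrs hst ⟨e, f, h⟩ ⟨e', f', h'⟩
  obtain ⟨e'', f'', h''⟩ := h.glue hw hcl hcl (ρ := fun z => (s, z.2.1, z.2.2)) (by fun_prop)
    (fun z hz => ⟨⟨⟨hrs, le_rfl⟩, hz.2⟩, ⟨⟨le_rfl, hst⟩, hz.2⟩⟩)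
    (fun z hz => Prod.ext (le_antisymm hz.2.1.1 hz.1.1.2) rfl) h'
  refine ⟨e'', f'', h''.mono ?_⟩
  rw [← Set.union_prod, Icc_union_Icc_eq_Icc hrs hst]

/-- A frame over the whole domain, as a symplectic trivialization. -/
def IsFrameOn.toSymplecticFrame {lam : ContactForm n M} {w : X → M} {e f : ℕ → X → Model n}
    (h : IsFrameOn lam w n e f univ) : SymplecticFrame lam w where
  e i z := e i z
  f i z := f i z
  continuous_e i := continuousOn_univ.1 (h.field_e i i.2)
  continuous_f i := continuousOn_univ.1 (h.field_f i i.2)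
  form_e i z := (h.symp z trivial).lam_e i i.2
  form_f i z := (h.symp z trivial).lam_f i i.2
  d_e_e i j z := (h.symp z trivial).ee i i.2 j j.2
  d_f_f i j z := (h.symp z trivial).ff i i.2 j j.2
  d_e_f i j z := ((h.symp z trivial).ef i i.2 j j.2).trans (by simp [Fin.val_inj])

theorem exists_symplecticFrame_cube (lam : ContactForm n M) (w : C(𝕀 × 𝕀 × 𝕀, M)) :
    Nonempty (SymplecticFrame lam w) := by
  let π : ℝ → 𝕀 := projIcc (0 : ℝ) 1 zero_le_one
  have hπ : Continuous π := continuous_projIcc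
  obtain ⟨e, f, h⟩ := exists_isFrameOn_cube lam (w := fun z => w (π z.1, π z.2.1, π z.2.2))
    (by fun_prop)
  have h1 := h.comp (σ := fun z : 𝕀 × 𝕀 × 𝕀 => ((z.1 : ℝ), (z.2.1 : ℝ), (z.2.2 : ℝ))) (T := univ)
    (by fun_prop) fun z _ => ⟨z.1.2, z.2.1.2, z.2.2.2⟩
  have h2 : ∀ t : 𝕀, π t = t := fun t => projIcc_val zero_le_one t
  simp only [h2] at h1
  exact ⟨h1.toSymplecticFrame⟩

/-- Restriction of a trivialization along a map. -/
def _root_.LegendrianIndex.SymplecticFrame.pull {lam : ContactForm n M} {w : X → M}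
    (F : SymplecticFrame lam w) {Z : Type*} [TopologicalSpace Z] (σ : C(Z, X)) :
    SymplecticFrame lam (fun z => w (σ z)) where
  e i z := F.e i (σ z)
  f i z := F.f i (σ z)
  continuous_e i := (F.continuous_e i).comp σ.continuous
  continuous_f i := (F.continuous_f i).comp σ.continuous
  form_e i z := F.form_e i (σ z)
  form_f i z := F.form_f i (σ z)
  d_e_e i j z := F.d_e_e i j (σ z)
  d_f_f i j z := F.d_f_f i j (σ z)
  d_e_f i j z := F.d_e_f i j (σ z)

theorem exists_symplecticFrame_square (lam : ContactForm n M) (w : C(𝕀 × 𝕀, M)) :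
    Nonempty (SymplecticFrame lam w) := by
  obtain ⟨F⟩ := exists_symplecticFrame_cube lam (w.comp ContinuousMap.snd)
  exact ⟨F.pull ⟨fun z => (0, z), by fun_prop⟩⟩

end Frames

/-! ### Winding of determinants along paths of matrices -/

section LinearAlgebra

open Matrix

variable {n : ℕ}

/-- Complex square matrices. -/
abbrev CMat (n : ℕ) : Type := Matrix (Fin n) (Fin n) ℂ

/-- The entrywise complex conjugate of a matrix. -/
def mconj (A : CMat n) : CMat n := A.map (starRingEnd ℂ)

theorem mconj_mul (A B : CMat n) : mconj (A * B) = mconj A * mconj B := Matrix.map_mul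

theorem mconj_one : mconj (1 : CMat n) = 1 := Matrix.map_one _ (map_zero _) (map_one _)

theorem det_mconj (A : CMat n) : (mconj A).det = starRingEnd ℂ A.det :=
  ((starRingEnd ℂ).map_det A).symm

theorem mconj_mconj (A : CMat n) : mconj (mconj A) = A := by
  ext; simp [mconj]

theorem mconj_conjTranspose (A : CMat n) : (mconj A)ᴴ = Aᵀ := by
  ext; simp [mconj]

theorem mconj_inv {A : CMat n} (hA : A.det ≠ 0) : mconj A⁻¹ = (mconj A)⁻¹ := by
  symm
  apply Matrix.inv_eq_right_inv
  rw [← mconj_mul, Matrix.mul_nonsing_inv _ (Ne.isUnit hA), mconj_one]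

theorem continuous_mconj : Continuous (mconj : CMat n → CMat n) :=
  Continuous.matrix_map continuous_id Complex.continuous_conj

theorem continuousAt_matInv {B : CMat n} (hd : B.det ≠ 0) : ContinuousAt Inv.inv B := by
  apply continuousAt_matrix_inv
  rw [Ring.inverse_eq_inv']
  exact continuousAt_inv₀ hd

theorem conj_ne_zero {z : ℂ} (hz : z ≠ 0) : starRingEnd ℂ z ≠ 0 := by
  simpa using hz

theorem div_norm_sq {D : ℂ} (hD : D ≠ 0) : (D / (‖D‖ : ℂ)) ^ 2 = D / starRingEnd ℂ D := by
  have h1 : (‖D‖ : ℂ) ≠ 0 := by simpa using hD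
  rw [div_pow, div_eq_div_iff (pow_ne_zero 2 h1) (conj_ne_zero hD)]
  rw [← Complex.mul_conj']
  ring

/-- The squared norm of a vector is positive definite. -/
theorem dotProduct_star_eq (y : Fin n → ℂ) : y ⬝ᵥ star y = ((∑ i, ‖y i‖ ^ 2 : ℝ) : ℂ) := by
  simp [dotProduct, Complex.mul_conj']

theorem dotProduct_star_vecMul (x : Fin n → ℂ) (A : CMat n) :
    (x ᵥ* A) ⬝ᵥ star (x ᵥ* A) = (x ᵥ* (A * Aᴴ)) ⬝ᵥ star x := by
  rw [star_vecMul, dotProduct_mulVec, vecMul_vecMul]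

/-- If `(a, b)` are the linear and antilinear part of a symplectic map, the matrices `a + s b V` are
regular: if `x (a + s b V) = 0`, then `|x a| = s |x b|`, whereas `|x a|² = |x b|² + |x|²`. So the
linear interpolation between the complex linear part of a symplectic map and the map itself
never degenerates on Lagrangian subspaces. -/
theorem det_add_smul_ne_zero {a b V : CMat n} (h : a * aᴴ - b * bᴴ = 1) (hV : V * Vᴴ = 1) {s : ℝ}
    (hs : s ∈ Icc (0 : ℝ) 1) : (a + (s : ℂ) • (b * V)).det ≠ 0 := by
  intro hdet
  obtain ⟨x, hx0, hx⟩ := exists_vecMul_eq_zero_iff.2 hdet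
  have h1 : x ᵥ* a = -((s : ℂ) • (x ᵥ* b ᵥ* V)) := by
    rw [vecMul_add, vecMul_smul, ← vecMul_vecMul] at hx
    exact eq_neg_of_add_eq_zero_left hx
  have h2 : (x ᵥ* a) ⬝ᵥ star (x ᵥ* a) = (s : ℂ) ^ 2 * ((x ᵥ* b) ⬝ᵥ star (x ᵥ* b)) := by
    have h3 := dotProduct_star_vecMul (x ᵥ* b) V
    rw [hV, vecMul_one] at h3
    rw [h1, ← h3]
    simp
    ring
  have h3 : (x ᵥ* a) ⬝ᵥ star (x ᵥ* a) = (x ᵥ* b) ⬝ᵥ star (x ᵥ* b) + x ⬝ᵥ star x := by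
    rw [dotProduct_star_vecMul, dotProduct_star_vecMul, ← add_dotProduct]
    congr 1
    rw [← sub_eq_iff_eq_add', ← vecMul_sub, h, vecMul_one]
  rw [h2, dotProduct_star_eq, dotProduct_star_eq] at h3
  have h4 : s ^ 2 * (∑ i, ‖(x ᵥ* b) i‖ ^ 2) = (∑ i, ‖(x ᵥ* b) i‖ ^ 2) + ∑ i, ‖x i‖ ^ 2 := by
    exact_mod_cast h3
  have h5 : 0 ≤ ∑ i, ‖(x ᵥ* b) i‖ ^ 2 := by positivity
  have h6 : ∑ i, ‖x i‖ ^ 2 ≤ 0 := by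
    have : s ^ 2 ≤ 1 := by nlinarith [hs.1, hs.2]
    nlinarith
  apply hx0
  funext i
  have h7 := Finset.single_le_sum (f := fun i => ‖x i‖ ^ 2) (fun i _ => by positivity)
    (Finset.mem_univ i)
  have h8 : ‖x i‖ ^ 2 ≤ 0 := h7.trans h6
  simpa using h8

/-- The matrices `W` for which no `1 + s W` with `0 ≤ s ≤ 1` is singular. This is an open
star-shaped set, on which `det (1 + W)` has a canonical continuous argument. -/
def logDomain (n : ℕ) : Set (CMat n) := {W | ∀ s ∈ Icc (0 : ℝ) 1, (1 + (s : ℂ) • W).det ≠ 0}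

theorem zero_mem_logDomain : (0 : CMat n) ∈ logDomain n := fun s _ => by simp

theorem starConvex_logDomain : StarConvex ℝ 0 (logDomain n) := by
  intro W hW a b ha hb hab s hs
  rw [smul_zero, zero_add, ← Complex.coe_smul b, smul_smul, ← Complex.ofReal_mul]
  exact hW _ ⟨mul_nonneg hs.1 hb, by nlinarith [hs.2, hs.1]⟩

theorem isOpen_logDomain : IsOpen (logDomain n) := by
  rw [isOpen_iff_mem_nhds]
  intro W hW
  refine isCompact_Icc.eventually_forall_of_forall_eventually
    (P := fun (W : CMat n) (s : ℝ) => (1 + (s : ℂ) • W).det ≠ 0) fun s hs => ?_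
  have hc : Continuous fun z : CMat n × ℝ => (1 + (z.2 : ℂ) • z.1).det := by fun_prop
  exact (hc.continuousAt (x := (W, s))).eventually (isOpen_ne.mem_nhds (hW s hs))

theorem exists_argDet (n : ℕ) : ∃ L : CMat n → ℝ, ContinuousOn L (logDomain n) ∧
    ∀ W ∈ logDomain n, (1 + W).det / starRingEnd ℂ (1 + W).det =
      Complex.exp (2 * Real.pi * L W * Complex.I) := by
  have : LocallyPathConnectedSpace (CMat n) :=
    inferInstanceAs (LocallyPathConnectedSpace (Fin n → Fin n → ℂ))
  have : ContractibleSpace (logDomain n) :=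
    starConvex_logDomain.contractibleSpace ⟨0, zero_mem_logDomain⟩
  have hsc : IsSimplyConnected (logDomain n) := by
    unfold IsSimplyConnected
    infer_instance
  have h1 : ∀ W ∈ logDomain n, (1 + W).det ≠ 0 := fun W hW => by simpa using hW 1 (by simp)
  obtain ⟨l, hl, he⟩ := Complex.exists_continuousOn_eqOn_exp_comp hsc isOpen_logDomain
    (g := fun W : CMat n => (1 + W).det) (by fun_prop) (by
      rintro ⟨W, hW, h0⟩
      exact h1 W hW h0)
  refine ⟨fun W => (l W).im / Real.pi, (Complex.continuous_im.comp_continuousOn hl).div_const _, ?_⟩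
  intro W hW
  have h2 : Complex.exp (l W) = (1 + W).det := he hW
  rw [← h2, ← Complex.exp_conj, ← Complex.exp_sub]
  congr 1
  have hpi : (Real.pi : ℂ) ≠ 0 := by exact_mod_cast Real.pi_ne_zero
  push_cast
  rw [Complex.sub_conj]
  push_cast
  field_simp

/-- A continuous argument, in full turns, of the square of `det (1 + W)` on `logDomain n`. -/
def argDet (W : CMat n) : ℝ := (exists_argDet n).choose W

theorem continuousOn_argDet : ContinuousOn (argDet (n := n)) (logDomain n) :=
  (exists_argDet n).choose_spec.1

theorem argDet_spec {W : CMat n} (hW : W ∈ logDomain n) :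
    (1 + W).det / starRingEnd ℂ (1 + W).det = Complex.exp (2 * Real.pi * argDet W * Complex.I) :=
  (exists_argDet n).choose_spec.2 W hW

theorem exp_two_pi_eq_iff {x y : ℝ} :
    Complex.exp (2 * Real.pi * x * Complex.I) = Complex.exp (2 * Real.pi * y * Complex.I) ↔
      ∃ m : ℤ, x = y + m := by
  rw [Complex.exp_eq_exp_iff_exists_int]
  have h : (2 * Real.pi * Complex.I : ℂ) ≠ 0 := Complex.two_pi_I_ne_zero
  refine exists_congr fun m => ?_
  constructor
  · intro h1
    have h2 : (2 * Real.pi * Complex.I : ℂ) * x =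
        (2 * Real.pi * Complex.I : ℂ) * ((y + m : ℝ) : ℂ) := by
      push_cast; linear_combination h1
    exact_mod_cast mul_left_cancel₀ h h2
  · rintro rfl
    push_cast
    ring

/-- Every map from a simply connected space to the circle of unit complex numbers, given as a
quotient `D / conj D`, has a continuous phase. -/
theorem exists_phase {Y : Type*} [TopologicalSpace Y] [SimplyConnectedSpace Y]
    [LocallyPathConnectedSpace Y] {q : Y → ℂ} (hq : Continuous q) (h1 : ∀ y, ‖q y‖ = 1) :
    ∃ θ : C(Y, ℝ), ∀ y, q y = Complex.exp (2 * Real.pi * θ y * Complex.I) := by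
  have hsc : IsSimplyConnected (univ : Set Y) := by
    unfold IsSimplyConnected
    exact (Homeomorph.Set.univ Y).toHomotopyEquiv.simplyConnectedSpace
  obtain ⟨l, hl, he⟩ := Complex.exists_continuousOn_eqOn_exp_comp hsc isOpen_univ (g := q)
    hq.continuousOn (by
      rintro ⟨y, _, h0⟩
      have := h1 y
      rw [h0] at this
      simp at this)
  have hlc : Continuous l := continuousOn_univ.1 hl
  refine ⟨⟨fun y => (l y).im / (2 * Real.pi), (Complex.continuous_im.comp hlc).div_const _⟩,
    fun y => ?_⟩
  have h2 : Complex.exp (l y) = q y := he (mem_univ y)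
  have h3 : (l y).re = 0 := by
    have h4 := h1 y
    rw [← h2, Complex.norm_exp] at h4
    exact Real.exp_eq_one_iff _ |>.1 h4
  rw [← h2]
  congr 1
  have hpi : (Real.pi : ℂ) ≠ 0 := by exact_mod_cast Real.pi_ne_zero
  have h4 : l y = ((l y).im : ℂ) * Complex.I := Complex.ext (by simp [h3]) (by simp)
  rw [h4]
  simp only [ContinuousMap.coe_mk, Complex.ofReal_div, Complex.ofReal_mul, Complex.ofReal_ofNat]
  field_simp

theorem norm_div_conj {D : ℂ} (hD : D ≠ 0) : ‖D / starRingEnd ℂ D‖ = 1 := by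
  rw [norm_div, RCLike.norm_conj, div_self (by simpa using hD)]

end LinearAlgebra

/-! ### The phase matrix of a Lagrangian subspace -/

section Phases

open Matrix

variable {n : ℕ} {M : Type*} [TopologicalSpace M] [ChartedSpace (Model n) M]
  [IsManifold (𝓡 (2 * n + 1)) ∞ M] {lam : ContactForm n M} {X : Type*} [TopologicalSpace X]
  {w : X → M}

namespace SymplecticFrame

variable (F F' : SymplecticFrame lam w)

/-- The vector `e_i` of the frame as an element of the model space. -/
def ev (i : Fin n) (z : X) : Model n := F.e i z

/-- The vector `f_i` of the frame as an element of the model space. -/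
def fv (i : Fin n) (z : X) : Model n := F.f i z

theorem isField_ev (i : Fin n) : IsField w (F.ev i) univ := (F.continuous_e i).continuousOn

theorem isField_fv (i : Fin n) : IsField w (F.fv i) univ := (F.continuous_f i).continuousOn

theorem lamAt_ev (i : Fin n) (z : X) : lam.lamAt (w z) (F.ev i z) = 0 := F.form_e i z

theorem lamAt_fv (i : Fin n) (z : X) : lam.lamAt (w z) (F.fv i z) = 0 := F.form_f i z

theorem omegaAt_ev_ev (i j : Fin n) (z : X) : lam.omegaAt (w z) (F.ev i z) (F.ev j z) = 0 :=
  F.d_e_e i j z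

theorem omegaAt_fv_fv (i j : Fin n) (z : X) : lam.omegaAt (w z) (F.fv i z) (F.fv j z) = 0 :=
  F.d_f_f i j z

theorem omegaAt_ev_fv (i j : Fin n) (z : X) :
    lam.omegaAt (w z) (F.ev i z) (F.fv j z) = if i = j then 1 else 0 := F.d_e_f i j z

theorem isSymplecticAt (z : X) : IsSymplecticAt lam (w z) n
    (fun i => if h : i < n then F.ev ⟨i, h⟩ z else 0)
    (fun i => if h : i < n then F.fv ⟨i, h⟩ z else 0) := by
  constructor
  · intro i hi; simp only [hi, dif_pos, F.lamAt_ev]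
  · intro i hi; simp only [hi, dif_pos, F.lamAt_fv]
  · intro i hi j hj; simp only [hi, hj, dif_pos, F.omegaAt_ev_ev]
  · intro i hi j hj; simp only [hi, hj, dif_pos, F.omegaAt_fv_fv]
  · intro i hi j hj; simp only [hi, hj, dif_pos, F.omegaAt_ev_fv, Fin.mk.injEq]

variable {z : X}

theorem eq_sum {v : Model n} (hv : lam.lamAt (w z) v = 0) :
    v = ∑ i, (lam.omegaAt (w z) v (F.fv i z) • F.ev i z +
      lam.omegaAt (w z) (F.ev i z) v • F.fv i z) := by
  have h := (F.isSymplecticAt z).eq_sum hv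
  rw [Finset.sum_range] at h
  simpa using h

theorem omegaAt_eq_sum {u v : Model n} (hu : lam.lamAt (w z) u = 0) :
    lam.omegaAt (w z) u v = ∑ i, (lam.omegaAt (w z) u (F.fv i z) * lam.omegaAt (w z) (F.ev i z) v -
      lam.omegaAt (w z) (F.ev i z) u * lam.omegaAt (w z) v (F.fv i z)) := by
  have h := (F.isSymplecticAt z).omegaAt_eq_sum (w := v) hu
  rw [Finset.sum_range] at h
  simpa using h

/-- The `i`-th complex coordinate `x_i + √-1 y_i` of a vector `∑ x_i e_i + y_i f_i` of `ξ` in a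
symplectic frame. -/
def zc (z : X) (i : Fin n) (v : Model n) : ℂ :=
  (lam.omegaAt (w z) v (F.fv i z) : ℂ) + (lam.omegaAt (w z) (F.ev i z) v : ℂ) * Complex.I

theorem zc_add (z : X) (i : Fin n) (u v : Model n) :
    F.zc z i (u + v) = F.zc z i u + F.zc z i v := by
  simp only [zc, map_add, _root_.add_apply]; push_cast; ring

theorem zc_smul (z : X) (i : Fin n) (a : ℝ) (v : Model n) : F.zc z i (a • v) = a * F.zc z i v := by
  simp only [zc, map_smul, _root_.smul_apply, smul_eq_mul]; push_cast; ring

/-- A complex coordinate as a real linear map. -/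
def zcLin (z : X) (i : Fin n) : Model n →ₗ[ℝ] ℂ where
  toFun := F.zc z i
  map_add' := F.zc_add z i
  map_smul' a v := by simp [F.zc_smul]

theorem zc_sum (z : X) (i : Fin n) {ι : Type*} (s : Finset ι) (v : ι → Model n) :
    F.zc z i (∑ j ∈ s, v j) = ∑ j ∈ s, F.zc z i (v j) :=
  map_sum (F.zcLin z i) v s

/-- The matrix whose columns are the complex coordinates of the vectors `v_j`. -/
def zmat (z : X) (v : Fin n → Model n) : CMat n := Matrix.of fun i j => F.zc z i (v j)

theorem zmat_apply (z : X) (v : Fin n → Model n) (i j : Fin n) : F.zmat z v i j = F.zc z i (v j) :=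
  rfl

variable {v : Fin n → Model n}

theorem zmat_mulVec (x : Fin n → ℂ) (i : Fin n) :
    (F.zmat z v *ᵥ x) i = F.zc z i (∑ j, (x j).re • v j) +
      F.zc z i (∑ j, (x j).im • v j) * Complex.I := by
  rw [F.zc_sum, F.zc_sum, Finset.sum_mul, ← Finset.sum_add_distrib]
  simp only [mulVec, dotProduct, zmat_apply, F.zc_smul]
  refine Finset.sum_congr rfl fun j _ => ?_
  conv_lhs => rw [← Complex.re_add_im (x j)]
  ring

/-- A real basis of a Lagrangian subspace is a complex basis of `ℂⁿ`: a complex relation gives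
vectors `p`, `q` of the subspace with `p = -√-1 q`, so that `0 = dλ(p, q) = |q|²`. -/
theorem det_zmat_ne_zero (hL : lam.IsLagrangian (w z) (Submodule.span ℝ (range v))) :
    (F.zmat z v).det ≠ 0 := by
  obtain ⟨hl, ho, hr⟩ := isLagrangian_iff.1 hL
  have hli : LinearIndependent ℝ v := by
    rw [linearIndependent_iff_card_eq_finrank_span, Fintype.card_fin]
    exact hr.symm
  intro hdet
  obtain ⟨x, hx0, hx⟩ := exists_mulVec_eq_zero_iff.2 hdet
  have hmem : ∀ c : Fin n → ℝ, ∑ j, c j • v j ∈ Submodule.span ℝ (range v) := fun c =>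
    Submodule.sum_mem _ fun j _ => Submodule.smul_mem _ _ (Submodule.subset_span ⟨j, rfl⟩)
  set p := ∑ j, (x j).re • v j with hp
  set q := ∑ j, (x j).im • v j with hq
  have hpl := hl p (hmem _)
  have hql := hl q (hmem _)
  have h1 : ∀ i, F.zc z i p + F.zc z i q * Complex.I = 0 := fun i => by
    rw [← F.zmat_mulVec x i, hx]; rfl
  have hre : ∀ i, lam.omegaAt (w z) p (F.fv i z) = lam.omegaAt (w z) (F.ev i z) q := fun i => by
    have := congrArg Complex.re (h1 i)
    simp [zc] at this
    linarith
  have him : ∀ i, lam.omegaAt (w z) (F.ev i z) p = - lam.omegaAt (w z) q (F.fv i z) := fun i => by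
    have := congrArg Complex.im (h1 i)
    simp [zc] at this
    linarith
  have h2 := ho p (hmem _) q (hmem _)
  rw [F.omegaAt_eq_sum hpl] at h2
  have h3 : ∑ i, (lam.omegaAt (w z) (F.ev i z) q ^ 2 + lam.omegaAt (w z) q (F.fv i z) ^ 2) = 0 := by
    rw [← h2]
    refine Finset.sum_congr rfl fun i _ => ?_
    rw [hre, him]; ring
  rw [Finset.sum_eq_zero_iff_of_nonneg fun i _ => by positivity] at h3
  have he : ∀ i, lam.omegaAt (w z) (F.ev i z) q = 0 := fun i => by
    have := h3 i (Finset.mem_univ i)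
    nlinarith [sq_nonneg (lam.omegaAt (w z) (F.ev i z) q),
      sq_nonneg (lam.omegaAt (w z) q (F.fv i z))]
  have hf : ∀ i, lam.omegaAt (w z) q (F.fv i z) = 0 := fun i => by
    have := h3 i (Finset.mem_univ i)
    nlinarith [sq_nonneg (lam.omegaAt (w z) (F.ev i z) q),
      sq_nonneg (lam.omegaAt (w z) q (F.fv i z))]
  have hq0 : q = 0 := by rw [F.eq_sum hql]; simp [he, hf]
  have hp0 : p = 0 := by rw [F.eq_sum hpl]; simp [hre, him, he, hf]
  rw [Fintype.linearIndependent_iff] at hli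
  apply hx0
  funext j
  exact Complex.ext (hli _ hp0 j) (hli _ hq0 j)

/-- For a Lagrangian subspace the Hermitian products of basis vectors are real. -/
theorem zmat_symm (hL : lam.IsLagrangian (w z) (Submodule.span ℝ (range v))) :
    (F.zmat z v)ᵀ * mconj (F.zmat z v) = (F.zmat z v)ᴴ * F.zmat z v := by
  obtain ⟨hl, ho, -⟩ := isLagrangian_iff.1 hL
  have hm : ∀ j, v j ∈ Submodule.span ℝ (range v) := fun j => Submodule.subset_span ⟨j, rfl⟩
  ext j k
  rw [← sub_eq_zero]
  have h1 := ho _ (hm j) _ (hm k)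
  rw [F.omegaAt_eq_sum (hl _ (hm j))] at h1
  have h2 := congrArg (fun r : ℝ => -2 * Complex.I * (r : ℂ)) h1
  simp only [Complex.ofReal_sum, Finset.mul_sum, Complex.ofReal_zero, mul_zero] at h2
  rw [← h2]
  simp only [mul_apply, transpose_apply, conjTranspose_apply, mconj, map_apply, zmat_apply,
    ← Finset.sum_sub_distrib]
  refine Finset.sum_congr rfl fun i _ => ?_
  simp only [zc, map_add, map_mul, Complex.conj_ofReal, Complex.conj_I, RCLike.star_def]
  push_cast
  ring

/-- The Souriau matrix `Z Z̄⁻¹` of a Lagrangian subspace, where `Z` is the matrix of complex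
coordinates of a basis. It does not depend on the basis, and its determinant is the unit complex
number whose phase is used in `HasPhase`. The value is `0` for subspaces without a basis of length
`n`. -/
def souriau (z : X) (V : Submodule ℝ (Model n)) : CMat n :=
  open Classical in
  if h : ∃ v : Fin n → Model n, Submodule.span ℝ (range v) = V then
    F.zmat z h.choose * (mconj (F.zmat z h.choose))⁻¹
  else 0

theorem zmat_basis_change {v' : Fin n → Model n} (B : Matrix (Fin n) (Fin n) ℝ)
    (hB : ∀ j, v' j = ∑ k, B k j • v k) :
    F.zmat z v' = F.zmat z v * B.map ((↑) : ℝ → ℂ) := by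
  ext i j
  rw [zmat_apply, hB, F.zc_sum, mul_apply]
  refine Finset.sum_congr rfl fun k _ => ?_
  rw [F.zc_smul, zmat_apply, map_apply, mul_comm]

theorem souriau_eq {V : Submodule ℝ (Model n)} (hV : lam.IsLagrangian (w z) V)
    (hv : Submodule.span ℝ (range v) = V) :
    F.souriau z V = F.zmat z v * (mconj (F.zmat z v))⁻¹ := by
  have h : ∃ v : Fin n → Model n, Submodule.span ℝ (range v) = V := ⟨v, hv⟩
  rw [souriau, dif_pos h]
  set v' := h.choose
  have hv' : Submodule.span ℝ (range v') = V := h.choose_spec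
  have hex : ∀ j, ∃ c : Fin n → ℝ, ∑ k, c k • v k = v' j := fun j => by
    have hm : v' j ∈ Submodule.span ℝ (range v) := by
      rw [hv, ← hv']; exact Submodule.subset_span ⟨j, rfl⟩
    exact (Submodule.mem_span_range_iff_exists_fun ℝ).1 hm
  choose c hc using hex
  set B : Matrix (Fin n) (Fin n) ℝ := Matrix.of fun k j => c j k
  have hz : F.zmat z v' = F.zmat z v * B.map ((↑) : ℝ → ℂ) :=
    F.zmat_basis_change B fun j => (hc j).symm
  have hBc : mconj (B.map ((↑) : ℝ → ℂ)) = B.map ((↑) : ℝ → ℂ) := by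
    ext; simp [mconj]
  have hd' := F.det_zmat_ne_zero (hv'.symm ▸ hV)
  have hBd : (B.map ((↑) : ℝ → ℂ)).det ≠ 0 := by
    rw [hz, det_mul] at hd'
    exact right_ne_zero_of_mul hd'
  rw [hz, mconj_mul, hBc, Matrix.mul_inv_rev, Matrix.mul_assoc, ← Matrix.mul_assoc _ _ (mconj _)⁻¹,
    mul_nonsing_inv _ (Ne.isUnit hBd), Matrix.one_mul]

section

variable {V : Submodule ℝ (Model n)} (hV : lam.IsLagrangian (w z) V)
include hV

theorem exists_basis : ∃ v : Fin n → Model n, Submodule.span ℝ (range v) = V :=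
  exists_span_of_finrank (isLagrangian_iff.1 hV).2.2

theorem det_souriau_eq (hv : Submodule.span ℝ (range v) = V) :
    (F.souriau z V).det = (F.zmat z v).det / starRingEnd ℂ (F.zmat z v).det := by
  rw [F.souriau_eq hV hv, det_mul, det_nonsing_inv, det_mconj, Ring.inverse_eq_inv', div_eq_mul_inv]

theorem norm_det_souriau : ‖(F.souriau z V).det‖ = 1 := by
  obtain ⟨v, rfl⟩ := exists_basis hV
  rw [F.det_souriau_eq hV rfl, norm_div_conj (F.det_zmat_ne_zero hV)]

theorem souriau_unitary : F.souriau z V * (F.souriau z V)ᴴ = 1 := by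
  obtain ⟨v, rfl⟩ := exists_basis hV
  rw [F.souriau_eq hV rfl]
  have hd := F.det_zmat_ne_zero hV
  have hs := F.zmat_symm hV
  set Z := F.zmat z v
  have hdc : (mconj Z).det ≠ 0 := by rw [det_mconj]; exact conj_ne_zero hd
  have hdt : IsUnit (Zᵀ).det := by rw [det_transpose]; exact Ne.isUnit hd
  have hdh : IsUnit (Zᴴ).det := by rw [det_conjTranspose]; exact Ne.isUnit (star_ne_zero.2 hd)
  rw [conjTranspose_mul, conjTranspose_nonsing_inv, mconj_conjTranspose, Matrix.mul_assoc,
    ← Matrix.mul_assoc _ _ Zᴴ, ← Matrix.mul_inv_rev, hs, Matrix.mul_inv_rev, Matrix.mul_assoc,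
    nonsing_inv_mul _ hdh, Matrix.mul_one, mul_nonsing_inv _ (Ne.isUnit hd)]

theorem hasPhase_plane_iff {θ : ℝ} : F.HasPhase z (plane (w z) V) θ ↔
    (F.souriau z V).det = Complex.exp (2 * Real.pi * θ * Complex.I) := by
  constructor
  · rintro ⟨v, hv, D, hD, hθ⟩
    obtain ⟨-, rfl⟩ := plane_inj.1 hv
    have hD' : D = (F.zmat z v).det := hD
    rw [F.det_souriau_eq hV rfl, ← hθ, hD', div_norm_sq (F.det_zmat_ne_zero hV)]
  · intro h
    obtain ⟨v, rfl⟩ := exists_basis hV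
    refine ⟨v, rfl, (F.zmat z v).det, rfl, ?_⟩
    rw [div_norm_sq (F.det_zmat_ne_zero hV), ← F.det_souriau_eq hV rfl, h]

end

/-- The Souriau matrix varies continuously along Lagrangian sections. -/
theorem continuous_souriau {Y : Type*} [TopologicalSpace Y] {σ : Y → X} (hσ : Continuous σ)
    {P : Y → Plane n M} (hP : IsLagSec lam (fun y => w (σ y)) P) :
    Continuous fun y => F.souriau (σ y) (P y).2 := by
  rw [continuous_iff_continuousAt]
  intro y₀
  obtain ⟨U, hU, v, hv, hPv⟩ := hP.2 y₀
  have hL : ∀ y ∈ U, lam.IsLagrangian (w (σ y)) (Submodule.span ℝ (range fun i => v i y)) := by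
    intro y hy
    have h1 := (hP.1 y).2
    rw [hPv y hy] at h1
    exact h1
  have hs : ∀ y ∈ U, F.souriau (σ y) (P y).2 =
      F.zmat (σ y) (fun i => v i y) * (mconj (F.zmat (σ y) fun i => v i y))⁻¹ := by
    intro y hy
    rw [hPv y hy]
    exact F.souriau_eq (hL y hy) rfl
  have hz : ContinuousOn (fun y => F.zmat (σ y) fun i => v i y) U := by
    refine continuousOn_pi.2 fun i => continuousOn_pi.2 fun j => ?_
    have h1 := (hv j).omegaAt lam (((F.isField_fv i).comp hσ.continuousOn (mapsTo_univ _ _)).mono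
      (subset_univ U))
    have h2 := (((F.isField_ev i).comp hσ.continuousOn (mapsTo_univ _ _)).mono
      (subset_univ U)).omegaAt lam (hv j)
    exact (Complex.continuous_ofReal.comp_continuousOn h1).add
      ((Complex.continuous_ofReal.comp_continuousOn h2).mul continuousOn_const)
  have hz0 := (hz y₀ (mem_of_mem_nhds hU)).continuousAt hU
  have hinv : ContinuousAt (fun y => (mconj (F.zmat (σ y) fun i => v i y))⁻¹) y₀ := by
    have hd : (mconj (F.zmat (σ y₀) fun i => v i y₀)).det ≠ 0 := by
      rw [det_mconj]
      exact conj_ne_zero (F.det_zmat_ne_zero (hL y₀ (mem_of_mem_nhds hU)))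
    have hm := continuous_mconj.continuousAt.comp hz0
    exact ContinuousAt.comp (f := fun y => mconj (F.zmat (σ y) fun i => v i y))
      (continuousAt_matInv hd) hm
  refine (hz0.mul hinv).congr ?_
  filter_upwards [hU] with y hy
  exact (hs y hy).symm

end SymplecticFrame

end Phases

/-! ### Rotation along paths -/

section Rotation

open Matrix

instance : LocallyPathConnectedSpace 𝕀 :=
  Convex.locallyPathConnectedSpace ℝ (convex_Icc (0 : ℝ) 1)

instance : ContractibleSpace 𝕀 :=
  (convex_Icc (0 : ℝ) 1).contractibleSpace ⟨0, by simp⟩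

/-- A continuous function with integral values on a connected space is constant. -/
theorem eq_of_continuous_of_int {Y : Type*} [TopologicalSpace Y] [PreconnectedSpace Y] {f : Y → ℝ}
    (hf : Continuous f) (h : ∀ y, ∃ m : ℤ, f y = m) (x y : Y) : f x = f y := by
  choose m hm using h
  have hc : Continuous m := by
    rw [Int.isClosedEmbedding_coe_real.isEmbedding.continuous_iff]
    exact hf.congr hm
  rw [hm, hm, PreconnectedSpace.constant ‹_› hc]

variable {n : ℕ} {M : Type*} [TopologicalSpace M] [ChartedSpace (Model n) M]
  [IsManifold (𝓡 (2 * n + 1)) ∞ M] {lam : ContactForm n M} {X : Type*} [TopologicalSpace X]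
  {w : X → M}

theorem IsLagSec.isLagrangian {Y : Type*} [TopologicalSpace Y] {c : Y → M} {P : Y → Plane n M}
    (h : IsLagSec lam c P) (t : Y) : lam.IsLagrangian (c t) (P t).2 := by
  obtain ⟨h1, h2⟩ := h.1 t
  generalize P t = Q at h1 h2 ⊢
  obtain ⟨x, V⟩ := Q
  subst h1
  exact h2

namespace SymplecticFrame

variable (F F' : SymplecticFrame lam w) {z : X}

/-- The complex linear part `a` of the change of coordinates `z ↦ a z + b z̄` from one frame to
another. -/
def linPart (z : X) : CMat n := Matrix.of fun i k =>
  (F'.zc z i (F.ev k z) - Complex.I * F'.zc z i (F.fv k z)) / 2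

/-- The complex antilinear part `b` of the change of coordinates `z ↦ a z + b z̄` from one frame to
another. -/
def antiPart (z : X) : CMat n := Matrix.of fun i k =>
  (F'.zc z i (F.ev k z) + Complex.I * F'.zc z i (F.fv k z)) / 2

theorem zmat_change {v : Fin n → Model n} (hv : ∀ j, lam.lamAt (w z) (v j) = 0) :
    F'.zmat z v = F.linPart F' z * F.zmat z v + F.antiPart F' z * mconj (F.zmat z v) := by
  ext i j
  simp only [Matrix.add_apply, mul_apply, ← Finset.sum_add_distrib, zmat_apply, mconj, map_apply]
  conv_lhs => rw [F.eq_sum (hv j), F'.zc_sum]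
  refine Finset.sum_congr rfl fun k _ => ?_
  simp only [F'.zc_add, F'.zc_smul, linPart, antiPart, of_apply, zc.eq_1 F, map_add, map_mul,
    Complex.conj_ofReal, Complex.conj_I]
  linear_combination ((lam.omegaAt (w z) (F.ev k z) (v j) : ℂ) * F'.zc z i (F.fv k z)) *
    Complex.I_mul_I

/-- The change of coordinates is symplectic. -/
theorem linPart_antiPart :
    F.linPart F' z * (F.linPart F' z)ᴴ - F.antiPart F' z * (F.antiPart F' z)ᴴ = 1 := by
  ext i j
  have h1 := F.omegaAt_eq_sum (v := F'.fv j z) (F'.lamAt_fv i z)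
  have h2 := F.omegaAt_eq_sum (v := F'.ev j z) (F'.lamAt_ev i z)
  have h3 := F.omegaAt_eq_sum (v := F'.fv j z) (F'.lamAt_ev i z)
  have h4 := F.omegaAt_eq_sum (v := F'.fv i z) (F'.lamAt_ev j z)
  rw [F'.omegaAt_fv_fv] at h1
  rw [F'.omegaAt_ev_ev] at h2
  rw [F'.omegaAt_ev_fv] at h3 h4
  have h5 : (1 : CMat n) i j = (((((if i = j then (1 : ℝ) else 0) +
      (if j = i then (1 : ℝ) else 0)) / 2 : ℝ) : ℂ)) +
      ((((0 : ℝ) + 0) / 2 : ℝ) : ℂ) * Complex.I := by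
    rw [one_apply]
    by_cases h : i = j
    · simp [h]
    · simp [h, Ne.symm h]
  rw [h5, h3, h4]
  nth_rewrite 1 [h1]
  rw [h2]
  simp only [Matrix.sub_apply, mul_apply, ← Finset.sum_add_distrib, ← Finset.sum_sub_distrib,
    Finset.sum_div, Complex.ofReal_sum, Finset.sum_mul]
  refine Finset.sum_congr rfl fun k _ => ?_
  have s1 : ∀ (u v : Model n), (lam.omegaAt (w z) u v : ℝ) = - lam.omegaAt (w z) v u :=
    fun u v => lam.omegaAt_swap (w z) u v
  rw [s1 (F'.fv j z) (F.fv k z), s1 (F'.fv i z) (F.fv k z), s1 (F.ev k z) (F'.ev i z),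
    s1 (F.ev k z) (F'.ev j z)]
  simp only [linPart, antiPart, of_apply, zc, conjTranspose_apply, RCLike.star_def, map_add,
    map_mul, map_sub, map_div₀, map_ofNat, Complex.conj_ofReal, Complex.conj_I]
  push_cast
  ring_nf
  simp only [Complex.I_sq, show Complex.I ^ 3 = - Complex.I by rw [pow_succ, Complex.I_sq]; ring]
  ring

theorem det_linPart_ne_zero : (F.linPart F' z).det ≠ 0 := by
  have h := det_add_smul_ne_zero (F.linPart_antiPart F' (z := z)) (V := 1) (by simp) (s := 0)
    (by simp)
  simpa using h

/-- The correction `a⁻¹ b Ū` of the linear part `a` of the change of coordinates, on the plane with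
Souriau matrix `U`. -/
theorem mem_logDomain_change {V : Submodule ℝ (Model n)} (hV : lam.IsLagrangian (w z) V) :
    (F.linPart F' z)⁻¹ * (F.antiPart F' z * mconj (F.souriau z V)) ∈ logDomain n := by
  intro s hs h0
  have hU : mconj (F.souriau z V) * (mconj (F.souriau z V))ᴴ = 1 := by
    have h1 := congrArg mconj (F.souriau_unitary hV)
    rw [mconj_mul, mconj_one] at h1
    exact h1
  apply det_add_smul_ne_zero (F.linPart_antiPart F' (z := z)) hU hs
  have h2 : F.linPart F' z + (s : ℂ) • (F.antiPart F' z * mconj (F.souriau z V)) =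
      F.linPart F' z * (1 + (s : ℂ) • ((F.linPart F' z)⁻¹ *
        (F.antiPart F' z * mconj (F.souriau z V)))) := by
    rw [mul_add, mul_one, mul_smul_comm,
      mul_nonsing_inv_cancel_left _ _ (Ne.isUnit (F.det_linPart_ne_zero F'))]
  rw [h2, det_mul, h0, mul_zero]

/-- On a plane with coordinate matrix `Z` the change of coordinates is `Z ↦ a (1 + a⁻¹ b Z̄ Z⁻¹) Z`.
Each of the first two factors has a continuous phase. -/
theorem det_souriau_change {V : Submodule ℝ (Model n)} (hV : lam.IsLagrangian (w z) V) :
    (F'.souriau z V).det =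
      (F.linPart F' z).det / starRingEnd ℂ (F.linPart F' z).det * Complex.exp (2 * Real.pi *
        argDet ((F.linPart F' z)⁻¹ * (F.antiPart F' z * mconj (F.souriau z V))) * Complex.I) *
      (F.souriau z V).det := by
  rw [← argDet_spec (F.mem_logDomain_change F' hV)]
  obtain ⟨v, rfl⟩ := exists_basis hV
  have hd := F.det_zmat_ne_zero hV
  have hl := (isLagrangian_iff.1 hV).1
  have hZ := F.zmat_change F' (z := z) (v := v) fun j => hl _ (Submodule.subset_span ⟨j, rfl⟩)
  rw [F.det_souriau_eq hV rfl, F'.det_souriau_eq hV rfl, F.souriau_eq hV rfl]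
  set Z := F.zmat z v
  set a := F.linPart F' z
  set b := F.antiPart F' z
  have ha : a.det ≠ 0 := F.det_linPart_ne_zero F'
  have hmc : mconj (Z * (mconj Z)⁻¹) = mconj Z * Z⁻¹ := by
    rw [mconj_mul, mconj_inv (by rw [det_mconj]; exact conj_ne_zero hd), mconj_mconj]
  have h2 : F'.zmat z v = a * (1 + a⁻¹ * (b * (mconj Z * Z⁻¹))) * Z := by
    rw [hZ, mul_add, mul_one, mul_nonsing_inv_cancel_left _ _ (Ne.isUnit ha), add_mul,
      Matrix.mul_assoc b, Matrix.mul_assoc (mconj Z), nonsing_inv_mul _ (Ne.isUnit hd), mul_one]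
  rw [hmc, h2, det_mul, det_mul, map_mul, map_mul, mul_div_mul_comm, mul_div_mul_comm]

theorem continuous_zc (i : Fin n) {v : X → Model n} (hv : IsField w v univ) :
    Continuous fun z => F.zc z i (v z) := by
  have h1 := continuousOn_univ.1 (hv.omegaAt lam (F.isField_fv i))
  have h2 := continuousOn_univ.1 ((F.isField_ev i).omegaAt lam hv)
  exact (Complex.continuous_ofReal.comp h1).add
    ((Complex.continuous_ofReal.comp h2).mul continuous_const)

theorem continuous_linPart : Continuous (F.linPart F') :=
  continuous_pi fun i => continuous_pi fun k => ((F'.continuous_zc i (F.isField_ev k)).sub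
    (continuous_const.mul (F'.continuous_zc i (F.isField_fv k)))).div_const _

theorem continuous_antiPart : Continuous (F.antiPart F') :=
  continuous_pi fun i => continuous_pi fun k => ((F'.continuous_zc i (F.isField_ev k)).add
    (continuous_const.mul (F'.continuous_zc i (F.isField_fv k)))).div_const _

variable {F F'}

theorem hasPhase_iff {P : Plane n M} (h1 : P.1 = w z) (h2 : lam.IsLagrangian P.1 P.2) {θ : ℝ} :
    F.HasPhase z P θ ↔
      (F.souriau z P.2).det = Complex.exp (2 * Real.pi * θ * Complex.I) := by
  obtain ⟨x, V⟩ := P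
  subst h1
  exact F.hasPhase_plane_iff h2

theorem HasPhase.int_sub {P : Plane n M} (h1 : P.1 = w z) (h2 : lam.IsLagrangian P.1 P.2)
    {θ θ' : ℝ} (h : F.HasPhase z P θ) (h' : F.HasPhase z P θ') : ∃ m : ℤ, θ - θ' = m := by
  rw [hasPhase_iff h1 h2] at h h'
  obtain ⟨m, hm⟩ := exp_two_pi_eq_iff.1 (h.symm.trans h')
  exact ⟨m, by linarith⟩

theorem exists_phase_along (F : SymplecticFrame lam w) {Y : Type*} [TopologicalSpace Y]
    [SimplyConnectedSpace Y] [LocallyPathConnectedSpace Y] {σ : Y → X} (hσ : Continuous σ)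
    {P : Y → Plane n M} (hP : IsLagSec lam (fun y => w (σ y)) P) :
    ∃ θ : C(Y, ℝ), ∀ y, F.HasPhase (σ y) (P y) (θ y) := by
  obtain ⟨θ, hθ⟩ := exists_phase (q := fun y => (F.souriau (σ y) (P y).2).det)
    (F.continuous_souriau hσ hP).matrix_det fun y => F.norm_det_souriau
      (hP.isLagrangian y)
  exact ⟨θ, fun y => (hasPhase_iff (hP.1 y).1 (hP.1 y).2).2 (hθ y)⟩

theorem exists_hasRotation (F : SymplecticFrame lam w) {σ : 𝕀 → X} (hσ : Continuous σ)
    {P : 𝕀 → Plane n M} (hP : IsLagSec lam (fun y => w (σ y)) P) : ∃ r, F.HasRotation σ P r := by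
  obtain ⟨θ, hθ⟩ := F.exists_phase_along hσ hP
  exact ⟨_, θ, hθ, rfl⟩

theorem HasRotation.eq_sub {σ : 𝕀 → X} {P : 𝕀 → Plane n M}
    (hP : IsLagSec lam (fun y => w (σ y)) P) {r : ℝ} (h : F.HasRotation σ P r) {θ : 𝕀 → ℝ}
    (hc : Continuous θ) (hθ : ∀ t, F.HasPhase (σ t) (P t) (θ t)) : r = θ 1 - θ 0 := by
  obtain ⟨η, hη, rfl⟩ := h
  have := eq_of_continuous_of_int (f := fun t => η t - θ t) (by fun_prop)
    (fun t => HasPhase.int_sub (hP.1 t).1 (hP.1 t).2 (hη t) (hθ t)) 0 1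
  linarith

theorem HasRotation.unique {σ : 𝕀 → X} {P : 𝕀 → Plane n M}
    (hP : IsLagSec lam (fun y => w (σ y)) P) {r r' : ℝ} (h : F.HasRotation σ P r)
    (h' : F.HasRotation σ P r') : r = r' := by
  obtain ⟨η, hη, rfl⟩ := h'
  exact h.eq_sub hP η.continuous hη

/-- A change of the trivialization changes the phase by a function on the bundle of Lagrangian
planes, so it changes rotations by the difference of the values at the end points. -/
theorem exists_shift [SimplyConnectedSpace X] [LocallyPathConnectedSpace X]
    (F F' : SymplecticFrame lam w) : ∃ h : X → Plane n M → ℝ, ∀ (σ : 𝕀 → X) (P : 𝕀 → Plane n M)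
      (r : ℝ), Continuous σ → IsLagSec lam (fun t => w (σ t)) P → F.HasRotation σ P r →
        F'.HasRotation σ P (r + (h (σ 1) (P 1) - h (σ 0) (P 0))) := by
  have hA := F.continuous_linPart F'
  have hB := F.continuous_antiPart F'
  have hd : ∀ z, (F.linPart F' z).det ≠ 0 := fun z => F.det_linPart_ne_zero F'
  obtain ⟨ρ, hρ⟩ := exists_phase
    (q := fun z => (F.linPart F' z).det / starRingEnd ℂ (F.linPart F' z).det)
    (hA.matrix_det.div (Complex.continuous_conj.comp hA.matrix_det) fun z => conj_ne_zero (hd z))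
    fun z => norm_div_conj (hd z)
  let h : X → Plane n M → ℝ := fun z P =>
    ρ z + argDet ((F.linPart F' z)⁻¹ * (F.antiPart F' z * mconj (F.souriau z P.2)))
  refine ⟨h, fun σ P r hσ hP => ?_⟩
  rintro ⟨θ, hθ, rfl⟩
  have hL : ∀ t, lam.IsLagrangian (w (σ t)) (P t).2 := hP.isLagrangian
  have hinv : Continuous fun t => (F.linPart F' (σ t))⁻¹ := by
    rw [continuous_iff_continuousAt]
    intro t
    exact ContinuousAt.comp (f := fun t => F.linPart F' (σ t)) (continuousAt_matInv (hd _))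
      (hA.comp hσ).continuousAt
  have hc : Continuous fun t => h (σ t) (P t) := by
    refine (ρ.continuous.comp hσ).add ?_
    refine continuousOn_argDet.comp_continuous (hinv.mul ((hB.comp hσ).mul
      (continuous_mconj.comp (F.continuous_souriau hσ hP)))) fun t => ?_
    exact F.mem_logDomain_change F' (hL t)
  refine ⟨⟨fun t => θ t + h (σ t) (P t), θ.continuous.add hc⟩, fun t => ?_, ?_⟩
  · have h1 := (hasPhase_iff (hP.1 t).1 (hP.1 t).2).1 (hθ t)
    refine (hasPhase_iff (hP.1 t).1 (hP.1 t).2).2 ?_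
    rw [F.det_souriau_change F' (hL t), hρ, h1, ← Complex.exp_add, ← Complex.exp_add]
    congr 1
    simp only [h, ContinuousMap.coe_mk]
    push_cast
    ring
  · simp only [ContinuousMap.coe_mk]
    ring

end SymplecticFrame

/-- The paths of planes `P j` over the paths `σ j`, taken with multiplicities `ε j`, form a cycle:
the boundary of this chain vanishes, i.e. every function of planes has total increment `0`. -/
def IsCycle {ι : Type*} [Fintype ι] (σ : ι → 𝕀 → X) (P : ι → 𝕀 → Plane n M) (ε : ι → ℤ) : Prop :=
  ∀ h : X → Plane n M → ℝ, ∑ j, ε j * (h (σ j 1) (P j 1) - h (σ j 0) (P j 0)) = 0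

namespace IsCycle

open SymplecticFrame

variable {ι : Type*} [Fintype ι] {σ : ι → 𝕀 → X} {P : ι → 𝕀 → Plane n M} {ε : ι → ℤ}
  {F F' : SymplecticFrame lam w} {r r' : ι → ℝ}

/-- The total rotation of a cycle is an integer. -/
theorem exists_int (h : IsCycle σ P ε) (hP : ∀ j, IsLagSec lam (fun t => w (σ j t)) (P j))
    (hr : ∀ j, F.HasRotation (σ j) (P j) (r j)) : ∃ m : ℤ, ∑ j, ε j * r j = m := by
  choose θ hθ hr using hr
  -- A choice of a phase for every plane; phases of the same plane differ by integers.
  let φ : X → Plane n M → ℝ := fun z Q => Classical.epsilon fun a => F.HasPhase z Q a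
  have hφ : ∀ j t, ∃ m : ℤ, θ j t - φ (σ j t) (P j t) = m := fun j t =>
    HasPhase.int_sub ((hP j).1 t).1 ((hP j).1 t).2 (hθ j t)
      (Classical.epsilon_spec (p := fun a => F.HasPhase (σ j t) (P j t) a) ⟨_, hθ j t⟩)
  choose m hm using hφ
  refine ⟨∑ j, ε j * (m j 1 - m j 0), ?_⟩
  rw [← sub_zero (∑ j, ε j * r j), ← h φ, ← Finset.sum_sub_distrib]
  push_cast
  refine Finset.sum_congr rfl fun j _ => ?_
  rw [hr, ← hm, ← hm]
  ring

/-- The total rotation of a cycle does not depend on the trivialization. -/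
theorem rotation_eq [SimplyConnectedSpace X] [LocallyPathConnectedSpace X] (h : IsCycle σ P ε)
    (hσ : ∀ j, Continuous (σ j)) (hP : ∀ j, IsLagSec lam (fun t => w (σ j t)) (P j))
    (hr : ∀ j, F.HasRotation (σ j) (P j) (r j)) (hr' : ∀ j, F'.HasRotation (σ j) (P j) (r' j)) :
    ∑ j, ε j * r j = ∑ j, ε j * r' j := by
  obtain ⟨φ, hφ⟩ := F.exists_shift F'
  rw [← add_zero (∑ j, ε j * r j), ← h φ, ← Finset.sum_add_distrib]
  refine Finset.sum_congr rfl fun j _ => ?_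
  rw [(hr' j).unique (hP j) (hφ _ _ _ (hσ j) (hP j) (hr j))]
  ring

end IsCycle

/-- The total rotation of a cycle is invariant under homotopies: in a frame over the domain of the
homotopy it is an integer that depends continuously on the parameter. -/
theorem rotation_homotopy {ι : Type*} [Fintype ι] {ε : ι → ℤ} {H : C(𝕀 × 𝕀 × 𝕀, M)}
    {σ : ι → 𝕀 → 𝕀 × 𝕀} {P : ι → 𝕀 × 𝕀 → Plane n M} (hσ : ∀ j, Continuous (σ j))
    (hP : ∀ j, IsLagSec lam (fun z => H (z.1, σ j z.2)) (P j))
    (hc : ∀ a, IsCycle σ (fun j t => P j (a, t)) ε)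
    {F : SymplecticFrame lam fun z => H (0, z)} {F' : SymplecticFrame lam fun z => H (1, z)}
    {r r' : ι → ℝ} (hr : ∀ j, F.HasRotation (σ j) (fun t => P j (0, t)) (r j))
    (hr' : ∀ j, F'.HasRotation (σ j) (fun t => P j (1, t)) (r' j)) :
    ∑ j, ε j * r j = ∑ j, ε j * r' j := by
  obtain ⟨G⟩ := exists_symplecticFrame_cube lam H
  have hex : ∀ j, ∃ θ : C(𝕀 × 𝕀, ℝ), ∀ y, G.HasPhase (y.1, σ j y.2) (P j y) (θ y) := fun j =>
    G.exists_phase_along (σ := fun y : 𝕀 × 𝕀 => (y.1, σ j y.2)) (by have := hσ j; fun_prop) (hP j)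
  choose θ hθ using hex
  let Gr : ∀ a : 𝕀, SymplecticFrame lam fun z => H (a, z) := fun a =>
    G.pull ⟨fun z => (a, z), by fun_prop⟩
  have hPa : ∀ (a : 𝕀) j, IsLagSec lam (fun t => H (a, σ j t)) (fun t => P j (a, t)) := fun a j =>
    (hP j).comp (σ := fun t => (a, t)) (by fun_prop)
  have hG : ∀ a j, (Gr a).HasRotation (σ j) (fun t => P j (a, t)) (θ j (a, 1) - θ j (a, 0)) :=
    fun a j => ⟨⟨fun t => θ j (a, t), by fun_prop⟩, fun t => hθ j (a, t), rfl⟩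
  rw [(hc 0).rotation_eq hσ (hPa 0) hr (hG 0), (hc 1).rotation_eq hσ (hPa 1) hr' (hG 1)]
  exact eq_of_continuous_of_int (f := fun a => ∑ j, ε j * (θ j (a, 1) - θ j (a, 0)))
    (by fun_prop) (fun a => (hc a).exists_int (hPa a) (hG a)) 0 1

end Rotation

/-! ### The Cayley transform near the closing corner -/

section Cayley

open Matrix

variable {n : ℕ}

theorem mem_logDomain_of_skew {A : CMat n} (hA : Aᴴ = -A) : A ∈ logDomain n := by
  intro s _ hdet
  obtain ⟨x, hx0, hx⟩ := exists_vecMul_eq_zero_iff.2 hdet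
  have h1 : (1 + (s : ℂ) • A) * (1 + (s : ℂ) • A)ᴴ = 1 + ((s ^ 2 : ℝ) : ℂ) • (A * Aᴴ) := by
    rw [conjTranspose_add, conjTranspose_one, conjTranspose_smul, hA, RCLike.star_def,
      Complex.conj_ofReal]
    simp only [mul_add, add_mul, one_mul, mul_one, smul_neg, mul_neg, smul_mul_smul_comm]
    push_cast
    rw [sq]
    abel
  have h2 : x ⬝ᵥ star x + ((s ^ 2 : ℝ) : ℂ) * ((x ᵥ* A) ⬝ᵥ star (x ᵥ* A)) = 0 := by
    have h3 : x ᵥ* ((1 + (s : ℂ) • A) * (1 + (s : ℂ) • A)ᴴ) = 0 := by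
      rw [← vecMul_vecMul, hx, zero_vecMul]
    rw [h1, vecMul_add, vecMul_one, vecMul_smul] at h3
    rw [dotProduct_star_vecMul, ← smul_eq_mul, ← smul_dotProduct, ← add_dotProduct, h3,
      zero_dotProduct]
  rw [dotProduct_star_eq, dotProduct_star_eq] at h2
  have h4 : (∑ i, ‖x i‖ ^ 2) + s ^ 2 * ∑ i, ‖(x ᵥ* A) i‖ ^ 2 = 0 := by exact_mod_cast h2
  have h5 : 0 ≤ s ^ 2 * ∑ i, ‖(x ᵥ* A) i‖ ^ 2 := by positivity
  apply hx0
  funext i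
  have h6 := Finset.single_le_sum (f := fun i => ‖x i‖ ^ 2) (fun i _ => by positivity)
    (Finset.mem_univ i)
  have h7 : ‖x i‖ ^ 2 ≤ 0 := by linarith
  simpa using h7

theorem continuousAt_argDet {A : CMat n} (hA : Aᴴ = -A) : ContinuousAt (argDet (n := n)) A :=
  continuousOn_argDet.continuousAt (isOpen_logDomain.mem_nhds (mem_logDomain_of_skew hA))

theorem exp_half (n : ℕ) :
    Complex.exp (2 * Real.pi * ((n / 2 : ℝ) : ℂ) * Complex.I) = (-1) ^ n := by
  rw [← Complex.exp_pi_mul_I, ← Complex.exp_nat_mul]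
  congr 1
  push_cast
  ring

theorem neg_one_pow_mul_self (n : ℕ) : ((-1 : ℂ) ^ n) * (-1) ^ n = 1 := by
  rw [← mul_pow]; simp

/-- The Cayley transform `(U + 1) (U - 1)⁻¹ = 1 + 2 (U - 1)⁻¹`. It is skew-Hermitian if `U` is
unitary without eigenvalue `1`. -/
def cayley (U : CMat n) : CMat n := 1 + (2 : ℂ) • (U - 1)⁻¹

section

variable {U : CMat n} (hU : U * Uᴴ = 1) (h1 : (U - 1).det ≠ 0)
include h1

theorem cayley_mul : cayley U * (U - 1) = U + 1 := by
  rw [cayley, add_mul, one_mul, smul_mul, nonsing_inv_mul _ (Ne.isUnit h1), two_smul]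
  abel

theorem cayley_mul_cayley_neg (h2 : (-U - 1).det ≠ 0) : cayley U * cayley (-U) = 1 := by
  have e2 := cayley_mul h2
  have h3 : (-U - 1) = -(cayley U * (U - 1)) := by rw [cayley_mul h1]; abel
  have h4 : (cayley (-U) * (cayley U * (U - 1))) = (U - 1) := by
    rw [h3, mul_neg] at e2
    rw [← neg_inj, e2]
    abel
  refine mul_eq_one_comm.1 ?_
  calc cayley (-U) * cayley U = cayley (-U) * cayley U * ((U - 1) * (U - 1)⁻¹) := by
        rw [mul_nonsing_inv _ (Ne.isUnit h1), Matrix.mul_one]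
    _ = (cayley (-U) * (cayley U * (U - 1))) * (U - 1)⁻¹ := by simp only [Matrix.mul_assoc]
    _ = 1 := by rw [h4, mul_nonsing_inv _ (Ne.isUnit h1)]

include hU

theorem cayley_skew : (cayley U)ᴴ = -cayley U := by
  have hU' : Uᴴ * U = 1 := mul_eq_one_comm.1 hU
  have h2 : (Uᴴ - 1)⁻¹ = -((U - 1)⁻¹ * U) := by
    apply inv_eq_right_inv
    have h3 : Uᴴ - 1 = -(Uᴴ * (U - 1)) := by rw [mul_sub, hU', mul_one]; abel
    rw [h3, neg_mul_neg, Matrix.mul_assoc, mul_nonsing_inv_cancel_left _ _ (Ne.isUnit h1), hU']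
  have h4 : (cayley U)ᴴ = 1 - (2 : ℂ) • ((U - 1)⁻¹ * U) := by
    rw [cayley, conjTranspose_add, conjTranspose_one, conjTranspose_smul, conjTranspose_nonsing_inv,
      conjTranspose_sub, conjTranspose_one, h2]
    simp [sub_eq_add_neg]
  have h5 : (U - 1)⁻¹ * U = 1 + (U - 1)⁻¹ := by
    have := nonsing_inv_mul _ (Ne.isUnit h1)
    rw [mul_sub, mul_one] at this
    exact sub_eq_iff_eq_add.1 this
  rw [h4, h5, cayley, smul_add, two_smul ℂ (1 : CMat n)]
  abel

/-- The phase of a unitary matrix without eigenvalue `1` in terms of its Cayley transform `C`: since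
`(1 + C) (U - 1) = 2 U` and `(1 + C)ᴴ (U - 1) = -2`, the determinant of `U` is `(-1) ^ n` times the
quotient of `det (1 + C)` and its conjugate. -/
theorem det_eq_exp_cayley :
    U.det = Complex.exp (2 * Real.pi * ((n / 2 + argDet (cayley U) : ℝ) : ℂ) * Complex.I) := by
  have hs := cayley_skew hU h1
  have h2 : (1 + cayley U).det ≠ 0 := by simpa using mem_logDomain_of_skew hs 1 (by simp)
  have h3 : (1 + cayley U) * (U - 1) = (2 : ℂ) • U := by
    rw [add_mul, cayley_mul h1, one_mul, two_smul]; abel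
  have h4 : (1 + cayley U)ᴴ * (U - 1) = -((2 : ℂ) • 1) := by
    rw [conjTranspose_add, conjTranspose_one, hs, add_mul, neg_mul, cayley_mul h1, one_mul,
      two_smul]
    abel
  have h5 := congrArg det h3
  have h6 := congrArg det h4
  rw [det_mul, det_smul, Fintype.card_fin] at h5
  rw [det_mul, det_conjTranspose, det_neg, det_smul, Fintype.card_fin, det_one, mul_one] at h6
  have h7 : starRingEnd ℂ (1 + cayley U).det ≠ 0 := conj_ne_zero h2
  rw [Complex.ofReal_add, mul_add, add_mul, Complex.exp_add, exp_half,
    ← argDet_spec (mem_logDomain_of_skew hs), mul_div_assoc', eq_div_iff h7]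
  have h8 : (U - 1).det * (2 : ℂ) ^ n ≠ 0 := mul_ne_zero h1 (by simp)
  apply mul_right_cancel₀ h8
  have h9 : starRingEnd ℂ (1 + cayley U).det * (U - 1).det = (-1) ^ n * 2 ^ n := h6
  calc _ = U.det * (starRingEnd ℂ (1 + cayley U).det * (U - 1).det) * 2 ^ n := by ring
    _ = (-1) ^ n * (2 ^ n * U.det) * 2 ^ n := by rw [h9]; ring
    _ = _ := by rw [← h5]; ring

end

theorem det_eq_exp_cayley_neg {U : CMat n} (hU : U * Uᴴ = 1) (h1 : (-U - 1).det ≠ 0) :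
    U.det = Complex.exp (2 * Real.pi * (argDet (cayley (-U)) : ℂ) * Complex.I) := by
  have h := det_eq_exp_cayley (U := -U) (by rw [conjTranspose_neg, neg_mul_neg, hU]) h1
  rw [Complex.ofReal_add, mul_add, add_mul, Complex.exp_add, exp_half, det_neg,
    Fintype.card_fin] at h
  exact mul_left_cancel₀ (pow_ne_zero n (by simp)) h

/-- The difference of the two phases of a unitary matrix that are obtained from its Cayley transform
`B⁻¹` and from the Cayley transform `B` of its negative. It is a locally constant function on the
regular skew-Hermitian matrices. -/
def jump (B : CMat n) : ℝ := n / 2 + argDet B⁻¹ - argDet B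

theorem skew_inv {B : CMat n} (hB : Bᴴ = -B) (hd : B.det ≠ 0) : (B⁻¹)ᴴ = -B⁻¹ := by
  rw [conjTranspose_nonsing_inv, hB]
  apply inv_eq_right_inv
  rw [neg_mul_neg, mul_nonsing_inv _ (Ne.isUnit hd)]

theorem jump_int {B : CMat n} (hB : Bᴴ = -B) (hd : B.det ≠ 0) : ∃ m : ℤ, jump B = m := by
  have h1 := argDet_spec (mem_logDomain_of_skew hB)
  have h2 := argDet_spec (mem_logDomain_of_skew (skew_inv hB hd))
  have h0 : (1 + B).det ≠ 0 := by simpa using mem_logDomain_of_skew hB 1 (by simp)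
  have h3 : (1 + B⁻¹).det = (1 + B).det / B.det := by
    rw [eq_div_iff hd, ← det_mul, add_mul, one_mul, nonsing_inv_mul _ (Ne.isUnit hd), add_comm]
  have h4 : starRingEnd ℂ B.det = (-1) ^ n * B.det := by
    have := congrArg det hB
    rwa [det_conjTranspose, det_neg, Fintype.card_fin] at this
  have h5 : Complex.exp (2 * Real.pi * ((n / 2 + argDet B⁻¹ : ℝ) : ℂ) * Complex.I) =
      Complex.exp (2 * Real.pi * (argDet B : ℂ) * Complex.I) := by
    rw [Complex.ofReal_add, mul_add, add_mul, Complex.exp_add, exp_half, ← h1, ← h2, h3, map_div₀,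
      h4]
    have h6 := conj_ne_zero h0
    have h7 : ((-1 : ℂ)) ^ n ≠ 0 := pow_ne_zero n (by simp)
    field_simp
    rw [sq, neg_one_pow_mul_self]
  obtain ⟨m, hm⟩ := exp_two_pi_eq_iff.1 h5
  exact ⟨m, by rw [jump, hm]; ring⟩

theorem continuousAt_jump {B : CMat n} (hB : Bᴴ = -B) (hd : B.det ≠ 0) :
    ContinuousAt (jump (n := n)) B := by
  refine ContinuousAt.sub (continuousAt_const.add ?_) (continuousAt_argDet hB)
  exact ContinuousAt.comp (f := fun B : CMat n => B⁻¹) (continuousAt_argDet (skew_inv hB hd))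
    (continuousAt_matInv hd)

theorem jump_eq_of_path {B : 𝕀 → CMat n} (hc : Continuous B) (hB : ∀ s, (B s)ᴴ = -B s)
    (hd : ∀ s, (B s).det ≠ 0) : jump (B 0) = jump (B 1) :=
  eq_of_continuous_of_int (f := fun s => jump (B s))
    (continuous_iff_continuousAt.2 fun s =>
      ContinuousAt.comp (f := B) (continuousAt_jump (hB s) (hd s)) hc.continuousAt)
    (fun s => jump_int (hB s) (hd s)) 0 1

theorem jump_smul {B : CMat n} (hB : Bᴴ = -B) (hd : B.det ≠ 0) {a : ℝ} (ha : 0 < a) :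
    jump ((a : ℂ) • B) = jump B := by
  have h := jump_eq_of_path (B := fun s : 𝕀 => (((1 - s + s * a : ℝ)) : ℂ) • B) (by fun_prop)
    (fun s => by
      rw [conjTranspose_smul, hB, RCLike.star_def, Complex.conj_ofReal, smul_neg])
    (fun s => by
      rw [det_smul]
      refine mul_ne_zero (pow_ne_zero _ ?_) hd
      have : (0 : ℝ) < 1 - s + s * a := by
        rcases eq_or_lt_of_le s.2.1 with h0 | h0
        · rw [← h0]; norm_num
        · have := s.2.2
          have := mul_pos h0 ha
          linarith
      exact_mod_cast this.ne')
  simpa using h.symm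

/-- The jump is the same for all negative definite real symmetric matrices, because they form a
convex set that contains `-1`. -/
theorem jump_negDef {Y : Matrix (Fin n) (Fin n) ℝ} (hY : Yᵀ = Y)
    (hneg : ∀ a : Fin n → ℝ, a ≠ 0 → a ⬝ᵥ Y *ᵥ a < 0) :
    jump (Complex.I • Y.map ((↑) : ℝ → ℂ)) = jump (-(Complex.I • (1 : CMat n))) := by
  have hmap : ∀ Q : Matrix (Fin n) (Fin n) ℝ, Qᵀ = Q →
      (Complex.I • Q.map ((↑) : ℝ → ℂ))ᴴ = -(Complex.I • Q.map ((↑) : ℝ → ℂ)) := by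
    intro Q hQ
    ext i j
    have := congrFun (congrFun hQ i) j
    rw [transpose_apply] at this
    simp [this]
  have h := jump_eq_of_path
    (B := fun s : 𝕀 => Complex.I • ((1 - (s : ℝ)) • Y - (s : ℝ) • 1).map ((↑) : ℝ → ℂ))
    (by
      have h1 : Continuous fun s : 𝕀 => (1 - (s : ℝ)) • Y - (s : ℝ) • 1 := by fun_prop
      exact (h1.matrix_map Complex.continuous_ofReal).const_smul Complex.I)
    (fun s => hmap _ (by simp [hY]))
    (fun s => by
      rw [det_smul]
      refine mul_ne_zero (pow_ne_zero _ Complex.I_ne_zero) ?_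
      intro h0
      have h1 : ((1 - (s : ℝ)) • Y - (s : ℝ) • 1).det = 0 :=
        Complex.ofReal_eq_zero.1
          ((Complex.ofRealHom.map_det ((1 - (s : ℝ)) • Y - (s : ℝ) • 1)).trans h0)
      obtain ⟨a, ha0, ha⟩ := exists_mulVec_eq_zero_iff.2 h1
      have h4 := congrArg (fun b => a ⬝ᵥ b) ha
      simp only [sub_mulVec, smul_mulVec, one_mulVec, dotProduct_sub, dotProduct_smul,
        dotProduct_zero, smul_eq_mul] at h4
      have h5 := hneg a ha0
      have h6 : 0 < a ⬝ᵥ a := by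
        refine lt_of_le_of_ne (Finset.sum_nonneg fun i _ => mul_self_nonneg _) fun h => ha0 ?_
        exact dotProduct_self_eq_zero.1 h.symm
      nlinarith [s.2.1, s.2.2, mul_nonneg s.2.1 h6.le,
        mul_nonneg (sub_nonneg.2 s.2.2) (neg_nonneg.2 h5.le)])
  have e0 : ((1 - ((0 : 𝕀) : ℝ)) • Y - ((0 : 𝕀) : ℝ) • 1) = Y := by simp
  have e1 : (((1 - ((1 : 𝕀) : ℝ)) • Y - ((1 : 𝕀) : ℝ) • 1).map ((↑) : ℝ → ℂ)) = -(1 : CMat n) := by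
    ext i j
    by_cases hij : i = j <;> simp [hij]
  simp only [e0, e1, smul_neg] at h
  exact h

end Cayley

/-! ### Existence of closing paths -/

section Closing

open Matrix

variable {n : ℕ} {M : Type*} [TopologicalSpace M] [ChartedSpace (Model n) M]
  [IsManifold (𝓡 (2 * n + 1)) ∞ M] {lam : ContactForm n M} {x : M}

theorem exists_frame_at (lam : ContactForm n M) (x : M) :
    Nonempty (SymplecticFrame lam fun _ : Unit => x) := by
  obtain ⟨F⟩ := exists_symplecticFrame_square lam (ContinuousMap.const _ x)
  exact ⟨F.pull (ContinuousMap.const Unit (0, 0))⟩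

/-- A Lagrangian subspace contains its symplectic complement in the contact hyperplane: in complex
coordinates a vector of the complement is `p + √-1 q` with `p`, `q` in the subspace, and its pairing
with `q` is `-|q|²`. -/
theorem mem_of_omegaAt_eq_zero {V : Submodule ℝ (Model n)} (hV : lam.IsLagrangian x V)
    {v : Model n} (hv : lam.lamAt x v = 0) (h : ∀ u ∈ V, lam.omegaAt x v u = 0) : v ∈ V := by
  obtain ⟨F⟩ := exists_frame_at lam x
  obtain ⟨u, rfl⟩ := SymplecticFrame.exists_basis (w := fun _ : Unit => x) (z := ()) hV
  have hd := F.det_zmat_ne_zero (z := ()) hV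
  set y : Fin n → ℂ := (F.zmat () u)⁻¹ *ᵥ fun i => F.zc () i v
  have hy : ∀ i, (F.zmat () u *ᵥ y) i = F.zc () i v := fun i => by
    rw [mulVec_mulVec, mul_nonsing_inv _ (Ne.isUnit hd), one_mulVec]
  obtain ⟨hl, ho, -⟩ := isLagrangian_iff.1 hV
  have hmem : ∀ c : Fin n → ℝ, ∑ j, c j • u j ∈ Submodule.span ℝ (range u) := fun c =>
    Submodule.sum_mem _ fun j _ => Submodule.smul_mem _ _ (Submodule.subset_span ⟨j, rfl⟩)
  set p := ∑ j, (y j).re • u j with hp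
  set q := ∑ j, (y j).im • u j with hq
  have hz : ∀ i, F.zc () i v = F.zc () i p + F.zc () i q * Complex.I := fun i => by
    rw [← hy, F.zmat_mulVec]
  have hre : ∀ i, lam.omegaAt x v (F.fv i ()) =
      lam.omegaAt x p (F.fv i ()) - lam.omegaAt x (F.ev i ()) q := fun i => by
    have := congrArg Complex.re (hz i)
    simp [SymplecticFrame.zc] at this
    linarith
  have him : ∀ i, lam.omegaAt x (F.ev i ()) v =
      lam.omegaAt x (F.ev i ()) p + lam.omegaAt x q (F.fv i ()) := fun i => by
    have := congrArg Complex.im (hz i)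
    simp [SymplecticFrame.zc] at this
    linarith
  have hql := hl q (hmem _)
  have h1 := h q (hmem _)
  have h2 := ho p (hmem _) q (hmem _)
  rw [F.omegaAt_eq_sum (z := ()) hv] at h1
  rw [F.omegaAt_eq_sum (z := ()) (hl p (hmem _))] at h2
  have h3 : ∑ i, (lam.omegaAt x (F.ev i ()) q ^ 2 + lam.omegaAt x q (F.fv i ()) ^ 2) = 0 := by
    have h4 := congrArg₂ (· - ·) h2 h1
    simp only [sub_zero, ← Finset.sum_sub_distrib] at h4
    rw [← h4]
    refine Finset.sum_congr rfl fun i _ => ?_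
    rw [hre, him]; ring
  rw [Finset.sum_eq_zero_iff_of_nonneg fun i _ => by positivity] at h3
  have he : ∀ i, lam.omegaAt x (F.ev i ()) q = 0 := fun i => by
    have := h3 i (Finset.mem_univ i)
    nlinarith [sq_nonneg (lam.omegaAt x (F.ev i ()) q), sq_nonneg (lam.omegaAt x q (F.fv i ()))]
  have hf : ∀ i, lam.omegaAt x q (F.fv i ()) = 0 := fun i => by
    have := h3 i (Finset.mem_univ i)
    nlinarith [sq_nonneg (lam.omegaAt x (F.ev i ()) q), sq_nonneg (lam.omegaAt x q (F.fv i ()))]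
  have hvp : v = p := by
    refine (F.eq_sum (z := ()) hv).trans (Eq.trans ?_ (F.eq_sum (z := ()) (hl p (hmem _))).symm)
    refine Finset.sum_congr rfl fun i _ => ?_
    rw [hre, him, he, hf, sub_zero, add_zero]
  rw [hvp]
  exact hmem _

/-- Transversal Lagrangian subspaces have dual bases. -/
theorem exists_adapted {V W : Submodule ℝ (Model n)} (hV : lam.IsLagrangian x V)
    (hW : lam.IsLagrangian x W) (hVW : V ⊓ W = ⊥) : ∃ e f : Fin n → Model n,
      Submodule.span ℝ (range e) = V ∧ Submodule.span ℝ (range f) = W ∧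
      ∀ i j, lam.omegaAt x (e i) (f j) = if i = j then 1 else 0 := by
  obtain ⟨e, rfl⟩ := SymplecticFrame.exists_basis (w := fun _ : Unit => x) (z := ()) hV
  obtain ⟨hl, ho, hr⟩ := isLagrangian_iff.1 hW
  let T : W →ₗ[ℝ] Fin n → ℝ := LinearMap.pi fun i => (lam.omegaAt x (e i)).toLinearMap.domRestrict W
  have hT : Function.Injective T := by
    rw [injective_iff_map_eq_zero]
    intro v hv
    have hvi : ∀ i, lam.omegaAt x (e i) v = 0 := fun i => congrFun hv i
    have h1 : (v : Model n) ∈ Submodule.span ℝ (range e) := by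
      refine mem_of_omegaAt_eq_zero hV (hl v v.2) fun u hu => ?_
      induction hu using Submodule.span_induction with
      | mem u hu =>
        obtain ⟨i, rfl⟩ := hu
        rw [lam.omegaAt_swap, hvi, neg_zero]
      | zero => exact map_zero _
      | add a b _ _ ha hb => rw [map_add, ha, hb, add_zero]
      | smul a b _ hb => rw [map_smul, hb, smul_zero]
    have h2 : (v : Model n) ∈ Submodule.span ℝ (range e) ⊓ W := ⟨h1, v.2⟩
    rw [hVW] at h2
    exact Subtype.ext h2
  have hTs : Function.Surjective T :=
    (LinearMap.injective_iff_surjective_of_finrank_eq_finrank (by rw [hr]; simp)).1 hT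
  choose f hf using fun j : Fin n => hTs (Pi.single j 1)
  have hef : ∀ i j, lam.omegaAt x (e i) (f j) = if i = j then 1 else 0 := fun i j => by
    have h1 : lam.omegaAt x (e i) (f j) = (Pi.single j 1 : Fin n → ℝ) i := congrFun (hf j) i
    rw [h1, Pi.single_apply]
  refine ⟨e, fun j => f j, rfl, ?_, hef⟩
  have hli : LinearIndependent ℝ fun j => (f j : Model n) := by
    rw [Fintype.linearIndependent_iff]
    intro g hg i
    have h1 := congrArg (lam.omegaAt x (e i)) hg
    simpa [map_sum, hef] using h1
  exact span_eq_of_finrank hli (fun j => (f j).2) hr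

/-- A path of Lagrangian subspaces which is transversal to its starting point for positive times and
leaves it in the negative direction. The conditions are those of `ReebChord.IsClosingPath`, without
the ones on the end points. -/
structure IsClosing (lam : ContactForm n M) (x : M) (K : 𝕀 → Submodule ℝ (Model n)) : Prop where
  sec : IsLagSec lam (fun _ : 𝕀 => x) fun t => plane x (K t)
  transversal : ∀ t, 0 < t → K t ⊓ K 0 = ⊥
  negative : ∀ v ∈ K 0, v ≠ 0 → ∃ (c : ℝ → Model n) (c' : Model n), c 0 = v ∧ (∀ t : 𝕀, c t ∈ K t) ∧
    HasDerivWithinAt c c' (Icc 0 1) 0 ∧ lam.omegaAt x v c' < 0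

/-- Transversal Lagrangian subspaces are joined by a closing path, which is linear in dual bases. -/
theorem exists_isClosing {V W : Submodule ℝ (Model n)} (hV : lam.IsLagrangian x V)
    (hW : lam.IsLagrangian x W) (hVW : V ⊓ W = ⊥) :
    ∃ K, IsClosing lam x K ∧ K 0 = V ∧ K 1 = W := by
  obtain ⟨e, f, rfl, rfl, hef⟩ := exists_adapted hV hW hVW
  obtain ⟨hVl, hVo, -⟩ := isLagrangian_iff.1 hV
  obtain ⟨hWl, hWo, -⟩ := isLagrangian_iff.1 hW
  have he : ∀ i, e i ∈ Submodule.span ℝ (range e) := fun i => Submodule.subset_span ⟨i, rfl⟩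
  have hf : ∀ i, f i ∈ Submodule.span ℝ (range f) := fun i => Submodule.subset_span ⟨i, rfl⟩
  have hfe : ∀ i j, lam.omegaAt x (f i) (e j) = if i = j then -1 else 0 := fun i j => by
    rw [lam.omegaAt_swap, hef]
    by_cases h : i = j
    · simp [h]
    · simp [h, Ne.symm h]
  -- The minus sign makes the velocity negative: `dλ(e_i, -e_i - f_i) = -1`.
  let b : ℝ → Fin n → Model n := fun t i => (1 - t) • e i - t • f i
  let K : 𝕀 → Submodule ℝ (Model n) := fun t => Submodule.span ℝ (range (b t))
  have hK0 : K 0 = Submodule.span ℝ (range e) := by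
    have : b ((0 : 𝕀) : ℝ) = e := by funext i; simp [b]
    simp only [K, this]
  have hK1 : K 1 = Submodule.span ℝ (range f) := by
    have : b ((1 : 𝕀) : ℝ) = fun i => -f i := by funext i; simp [b]
    simp only [K, this]
    refine le_antisymm ?_ ?_
    · rw [Submodule.span_le]
      rintro _ ⟨j, rfl⟩
      exact Submodule.neg_mem _ (hf j)
    · rw [Submodule.span_le]
      rintro _ ⟨j, rfl⟩
      rw [← neg_neg (f j)]
      exact Submodule.neg_mem _ (Submodule.subset_span ⟨j, rfl⟩)
  have hbl : ∀ t i, lam.lamAt x (b t i) = 0 := fun t i => by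
    simp [b, hVl _ (he i), hWl _ (hf i)]
  have hbo : ∀ t i j, lam.omegaAt x (b t i) (b t j) = 0 := fun t i j => by
    simp only [b, map_sub, map_smul, _root_.sub_apply, _root_.smul_apply, hVo _ (he i) _ (he j),
      hWo _ (hf i) _ (hf j), hef, hfe]
    by_cases h : i = j
    · simp [h]; ring
    · simp [h]
  have hbe : ∀ t i j, lam.omegaAt x (e i) (b t j) = if i = j then -t else 0 := fun t i j => by
    simp only [b, map_sub, map_smul, hVo _ (he i) _ (he j), hef]
    by_cases h : i = j <;> simp [h]
  have hbf : ∀ t i j, lam.omegaAt x (b t j) (f i) = if i = j then 1 - t else 0 := fun t i j => by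
    simp only [b, map_sub, map_smul, _root_.sub_apply, _root_.smul_apply, hWo _ (hf j) _ (hf i),
      hef]
    by_cases h : i = j
    · simp [h]
    · simp [h, Ne.symm h]
  have hli : ∀ t, LinearIndependent ℝ (b t) := fun t => by
    rw [Fintype.linearIndependent_iff]
    intro g hg i
    have h1 := congrArg (lam.omegaAt x (e i)) hg
    have h2 := congrArg (fun v => lam.omegaAt x v (f i)) hg
    simp only [map_sum, map_smul, hbe, smul_eq_mul, map_zero, mul_ite, mul_zero,
      Finset.sum_ite_eq, Finset.mem_univ, if_true] at h1
    simp only [map_sum, map_smul, _root_.sum_apply, _root_.smul_apply, hbf, smul_eq_mul, map_zero,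
      mul_ite, mul_zero, Finset.sum_ite_eq, Finset.mem_univ, if_true, _root_.zero_apply] at h2
    linarith
  refine ⟨K, ⟨⟨fun t => ⟨rfl, isLagrangian_iff.2 ⟨fun v hv => ?_, fun v hv w hw => ?_, ?_⟩⟩,
    fun t₀ => ⟨univ, univ_mem, fun i t => b t i, fun i => ?_, fun t _ => rfl⟩⟩, ?_, ?_⟩, hK0, hK1⟩
  · have hle : K t ≤ (lam.lamAt x).toLinearMap.ker := by
      rw [Submodule.span_le]
      rintro _ ⟨j, rfl⟩
      exact hbl t j
    exact hle hv
  · have h1 : ∀ i, K t ≤ (lam.omegaAt x (b t i)).toLinearMap.ker := fun i => by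
      rw [Submodule.span_le]
      rintro _ ⟨j, rfl⟩
      exact hbo t i j
    have h2 : K t ≤ (lam.omegaAt x w).toLinearMap.ker := by
      rw [Submodule.span_le]
      rintro _ ⟨j, rfl⟩
      change lam.omegaAt x w (b t j) = 0
      rw [lam.omegaAt_swap]
      exact neg_eq_zero.2 (h1 j hw)
    change lam.omegaAt x v w = 0
    rw [lam.omegaAt_swap]
    exact neg_eq_zero.2 (h2 hv)
  · exact (finrank_span_eq_card (hli t)).trans (Fintype.card_fin n)
  · have hc : ∀ u : Model n, IsField (fun _ : 𝕀 => x) (fun _ => u) univ := fun u =>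
      continuousOn_const
    exact ((hc (e i)).smul (a := fun t : 𝕀 => 1 - (t : ℝ)) (by fun_prop)).sub
      ((hc (f i)).smul (a := fun t : 𝕀 => (t : ℝ)) (by fun_prop))
  · intro t ht
    rw [eq_bot_iff]
    rintro v ⟨hv, hv0⟩
    rw [hK0] at hv0
    obtain ⟨g, rfl⟩ := (Submodule.mem_span_range_iff_exists_fun ℝ).1 hv
    have h1 : ∀ i, g i = 0 := fun i => by
      have h2 := hVo (e i) (he i) _ hv0
      simp only [map_sum, map_smul, hbe, smul_eq_mul, mul_ite, mul_zero,
        Finset.sum_ite_eq, Finset.mem_univ, if_true] at h2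
      have h3 : (t : ℝ) ≠ 0 := (show (0 : ℝ) < t from ht).ne'
      simpa [h3] using h2
    simp [h1]
  · intro v hv hv0
    rw [hK0] at hv
    obtain ⟨g, rfl⟩ := (Submodule.mem_span_range_iff_exists_fun ℝ).1 hv
    refine ⟨fun t => ∑ i, g i • b t i, ∑ i, g i • (-e i - f i), by simp [b], fun t =>
      Submodule.sum_mem _ fun j _ => Submodule.smul_mem _ _ (Submodule.subset_span ⟨j, rfl⟩),
      ?_, ?_⟩
    · refine HasDerivAt.hasDerivWithinAt
        (HasDerivAt.fun_sum fun i _ => HasDerivAt.fun_const_smul _ ?_)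
      have h1 : HasDerivAt (fun t : ℝ => 1 - t) (-1) 0 := by
        simpa using (hasDerivAt_id (0 : ℝ)).const_sub 1
      refine HasDerivAt.congr_deriv (f := fun t => b t i)
        ((h1.smul_const (e i)).sub ((hasDerivAt_id (0 : ℝ)).smul_const (f i))) ?_
      simp
    · have h1 : lam.omegaAt x (∑ i, g i • e i) (∑ i, g i • (-e i - f i)) = -∑ i, g i ^ 2 := by
        simp only [map_sum, map_smul, _root_.sum_apply, _root_.smul_apply, map_sub, map_neg,
          hVo _ (he _) _ (he _), hef, smul_eq_mul, mul_ite, mul_one,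
          mul_zero, Finset.sum_ite_eq', Finset.mem_univ, if_true]
        simp [sq]
      rw [h1, neg_lt_zero]
      refine lt_of_le_of_ne (Finset.sum_nonneg fun i _ => sq_nonneg _) fun h => hv0 ?_
      rw [eq_comm, Finset.sum_eq_zero_iff_of_nonneg fun i _ => sq_nonneg _] at h
      refine Finset.sum_eq_zero fun i hi => ?_
      rw [pow_eq_zero_iff two_ne_zero |>.1 (h i hi), zero_smul]

end Closing

/-! ### All closing paths have the same rotation -/

section ClosingRotation

open Matrix

variable {n : ℕ} {M : Type*} [TopologicalSpace M] [ChartedSpace (Model n) M]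
  [IsManifold (𝓡 (2 * n + 1)) ∞ M] {lam : ContactForm n M} {X : Type*} [TopologicalSpace X]
  {w : X → M}

namespace SymplecticFrame

variable (F : SymplecticFrame lam w) {z : X} {v : Fin n → Model n}

/-- The real parts of the complex coordinates. -/
def reMat (z : X) (v : Fin n → Model n) : Matrix (Fin n) (Fin n) ℝ :=
  Matrix.of fun i j => lam.omegaAt (w z) (v j) (F.fv i z)

/-- The imaginary parts of the complex coordinates. -/
def imMat (z : X) (v : Fin n → Model n) : Matrix (Fin n) (Fin n) ℝ :=
  Matrix.of fun i j => lam.omegaAt (w z) (F.ev i z) (v j)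

theorem zmat_add_mconj :
    F.zmat z v + mconj (F.zmat z v) = (2 : ℂ) • (F.reMat z v).map ((↑) : ℝ → ℂ) := by
  ext i j
  simp [zmat_apply, mconj, zc, reMat]
  ring

theorem zmat_sub_mconj :
    F.zmat z v - mconj (F.zmat z v) = (2 * Complex.I) • (F.imMat z v).map ((↑) : ℝ → ℂ) := by
  ext i j
  simp [zmat_apply, mconj, zc, imMat]
  ring

theorem reMat_mulVec (a : Fin n → ℝ) (i : Fin n) :
    (F.reMat z v *ᵥ a) i = lam.omegaAt (w z) (∑ j, a j • v j) (F.fv i z) := by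
  simp [mulVec, dotProduct, reMat, mul_comm]

theorem imMat_mulVec (a : Fin n → ℝ) (i : Fin n) :
    (F.imMat z v *ᵥ a) i = lam.omegaAt (w z) (F.ev i z) (∑ j, a j • v j) := by
  simp [mulVec, dotProduct, imMat, mul_comm]

theorem det_map_ofReal (A : Matrix (Fin n) (Fin n) ℝ) :
    (A.map ((↑) : ℝ → ℂ)).det = (A.det : ℂ) :=
  (Complex.ofRealHom.map_det A).symm

theorem souriau_mul_mconj (hL : lam.IsLagrangian (w z) (Submodule.span ℝ (range v))) :
    F.souriau z (Submodule.span ℝ (range v)) * mconj (F.zmat z v) = F.zmat z v := by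
  have hd : (mconj (F.zmat z v)).det ≠ 0 := by
    rw [det_mconj]; exact conj_ne_zero (F.det_zmat_ne_zero hL)
  refine (congrArg (· * mconj (F.zmat z v)) (F.souriau_eq hL rfl)).trans ?_
  change F.zmat z v * _ * _ = _
  rw [Matrix.mul_assoc, nonsing_inv_mul _ (Ne.isUnit hd), Matrix.mul_one]

/-- The Souriau matrix of a plane has the eigenvalue `1` only if the plane meets the span of the
`e_i`. -/
theorem det_souriau_sub_one_ne_zero {V : Submodule ℝ (Model n)} (hV : lam.IsLagrangian (w z) V)
    (h : V ⊓ Submodule.span ℝ (range fun i => F.ev i z) = ⊥) : (F.souriau z V - 1).det ≠ 0 := by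
  obtain ⟨v, rfl⟩ := exists_basis hV
  intro h0
  have h1 : ((2 * Complex.I) • (F.imMat z v).map ((↑) : ℝ → ℂ)).det = 0 := by
    rw [← F.zmat_sub_mconj]
    have h2 : F.zmat z v - mconj (F.zmat z v) =
        (F.souriau z (Submodule.span ℝ (range v)) - 1) * mconj (F.zmat z v) := by
      rw [sub_mul, F.souriau_mul_mconj hV, one_mul]
    rw [h2, det_mul, h0, zero_mul]
  rw [det_smul, det_map_ofReal] at h1
  have h3 : (F.imMat z v).det = 0 := by
    have h4 : ((2 : ℂ) * Complex.I) ^ Fintype.card (Fin n) ≠ 0 := pow_ne_zero _ (by simp)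
    exact_mod_cast (mul_eq_zero.1 h1).resolve_left h4
  obtain ⟨a, ha0, ha⟩ := exists_mulVec_eq_zero_iff.2 h3
  obtain ⟨hl, -, hr⟩ := isLagrangian_iff.1 hV
  have hmem : ∑ j, a j • v j ∈ Submodule.span ℝ (range v) :=
    Submodule.sum_mem _ fun j _ => Submodule.smul_mem _ _ (Submodule.subset_span ⟨j, rfl⟩)
  have he : ∀ i, lam.omegaAt (w z) (F.ev i z) (∑ j, a j • v j) = 0 := fun i => by
    rw [← F.imMat_mulVec, ha]; rfl
  have hmem' : ∑ j, a j • v j ∈ Submodule.span ℝ (range fun i => F.ev i z) := by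
    rw [F.eq_sum (hl _ hmem)]
    refine Submodule.sum_mem _ fun j _ => ?_
    rw [he, zero_smul, add_zero]
    exact Submodule.smul_mem _ _ (Submodule.subset_span ⟨j, rfl⟩)
  have h5 : ∑ j, a j • v j ∈ Submodule.span ℝ (range v) ⊓
    Submodule.span ℝ (range fun i => F.ev i z) := ⟨hmem, hmem'⟩
  rw [h] at h5
  have hli : LinearIndependent ℝ v := by
    rw [linearIndependent_iff_card_eq_finrank_span, Fintype.card_fin]
    exact hr.symm
  exact ha0 (funext fun j => Fintype.linearIndependent_iff.1 hli a h5 j)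

theorem souriau_span_ev
    (hL : lam.IsLagrangian (w z) (Submodule.span ℝ (range fun i => F.ev i z))) :
    F.souriau z (Submodule.span ℝ (range fun i => F.ev i z)) = 1 := by
  have h : F.zmat z (fun i => F.ev i z) = 1 := by
    ext i j
    rw [zmat_apply, zc, F.omegaAt_ev_ev, F.omegaAt_ev_fv, one_apply]
    by_cases hij : i = j
    · simp [hij]
    · simp [hij, Ne.symm hij]
  have h1 := F.souriau_mul_mconj hL
  rwa [h, mconj_one, mul_one] at h1

theorem souriau_span_fv
    (hL : lam.IsLagrangian (w z) (Submodule.span ℝ (range fun i => F.fv i z))) :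
    F.souriau z (Submodule.span ℝ (range fun i => F.fv i z)) = -1 := by
  have h : F.zmat z (fun i => F.fv i z) = Complex.I • (1 : CMat n) := by
    ext i j
    rw [zmat_apply, zc, F.omegaAt_fv_fv, F.omegaAt_ev_fv, Matrix.smul_apply, one_apply]
    by_cases hij : i = j <;> simp [hij]
  have h1 := F.souriau_mul_mconj hL
  have h2 : mconj (Complex.I • (1 : CMat n)) = -(Complex.I • (1 : CMat n)) := by
    ext i j
    by_cases hij : i = j <;> simp [mconj, hij]
  rw [h, h2, mul_neg, mul_smul_comm, mul_one, ← smul_neg] at h1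
  rw [← neg_eq_iff_eq_neg]
  exact smul_right_injective _ Complex.I_ne_zero h1

end SymplecticFrame

namespace IsClosing

variable {x : M} {K K' : 𝕀 → Submodule ℝ (Model n)}

/-- The infinitesimal form of the Lagrangian condition. It shows that the velocity of a path of
Lagrangian subspaces is a well-defined symmetric form. -/
theorem omegaAt_deriv (hK : IsClosing lam x K) {c d : ℝ → Model n} {c' d' : Model n}
    (hc : ∀ t : 𝕀, c t ∈ K t) (hd : ∀ t : 𝕀, d t ∈ K t)
    (hc' : HasDerivWithinAt c c' (Icc 0 1) 0) (hd' : HasDerivWithinAt d d' (Icc 0 1) 0) :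
    lam.omegaAt x c' (d 0) + lam.omegaAt x (c 0) d' = 0 := by
  have h1 : HasDerivWithinAt (fun t => lam.omegaAt x (c t)) (lam.omegaAt x c') (Icc 0 1) 0 :=
    (lam.omegaAt x).hasFDerivAt.comp_hasDerivWithinAt 0 hc'
  have h2 := h1.clm_apply hd'
  have h3 : HasDerivWithinAt (fun t => lam.omegaAt x (c t) (d t)) 0 (Icc (0 : ℝ) 1) 0 := by
    refine (hasDerivWithinAt_const (0 : ℝ) (Icc (0 : ℝ) 1) (0 : ℝ)).congr (fun t ht => ?_) ?_
    · exact (isLagrangian_iff.1 (hK.sec.isLagrangian ⟨t, ht⟩)).2.1 _ (hc ⟨t, ht⟩) _ (hd ⟨t, ht⟩)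
    · exact (isLagrangian_iff.1 (hK.sec.isLagrangian 0)).2.1 _ (hc 0) _ (hd 0)
  exact (uniqueDiffOn_Icc zero_lt_one 0 (by simp)).eq_deriv _ h2 h3

/-- A symplectic frame adapted to the end points of a closing path. -/
theorem exists_frame (hK : IsClosing lam x K) : ∃ G : SymplecticFrame lam fun _ : Unit => x,
    Submodule.span ℝ (range fun i => G.ev i ()) = K 0 ∧
    Submodule.span ℝ (range fun i => G.fv i ()) = K 1 := by
  have h0 := hK.sec.isLagrangian 0
  have h1 := hK.sec.isLagrangian 1
  obtain ⟨e, f, he, hf, hef⟩ := exists_adapted h0 h1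
    (by rw [inf_comm]; exact hK.transversal 1 zero_lt_one)
  have hme : ∀ i, e i ∈ K 0 := fun i => he.le (Submodule.subset_span ⟨i, rfl⟩)
  have hmf : ∀ i, f i ∈ K 1 := fun i => hf.le (Submodule.subset_span ⟨i, rfl⟩)
  obtain ⟨l0, o0, -⟩ := isLagrangian_iff.1 h0
  obtain ⟨l1, o1, -⟩ := isLagrangian_iff.1 h1
  exact ⟨{
    e := fun i _ => e i
    f := fun i _ => f i
    continuous_e := fun i => continuous_of_discreteTopology
    continuous_f := fun i => continuous_of_discreteTopology
    form_e := fun i _ => l0 _ (hme i)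
    form_f := fun i _ => l1 _ (hmf i)
    d_e_e := fun i j _ => o0 _ (hme i) _ (hme j)
    d_f_f := fun i j _ => o1 _ (hmf i) _ (hmf j)
    d_e_f := fun i j _ => hef i j }, he, hf⟩

section

variable (hK : IsClosing lam x K) (G : SymplecticFrame lam fun _ : Unit => x)
  (he : Submodule.span ℝ (range fun i => G.ev i ()) = K 0)
  (hf : Submodule.span ℝ (range fun i => G.fv i ()) = K 1)
include hK he

/-- The velocity at time `0`, a negative definite quadratic form, is the limit of the rescaled
Cayley transforms: if the plane has a basis with coordinate matrix `X + √-1 Y`, the Cayley transform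
of the negative of its Souriau matrix is `√-1 Y X⁻¹`. -/
theorem exists_tendsto_cayley : ∃ (Y : Matrix (Fin n) (Fin n) ℝ) (t : ℕ → 𝕀), Yᵀ = Y ∧
    (∀ a : Fin n → ℝ, a ≠ 0 → a ⬝ᵥ Y *ᵥ a < 0) ∧ (∀ m, 0 < t m) ∧ Tendsto t atTop (𝓝 0) ∧
    Tendsto (fun m => (((t m : ℝ)⁻¹ : ℝ) : ℂ) • cayley (-G.souriau () (K (t m)))) atTop
      (𝓝 (Complex.I • Y.map ((↑) : ℝ → ℂ))) := by
  have hme : ∀ i, G.ev i () ∈ K 0 := fun i => he ▸ Submodule.subset_span ⟨i, rfl⟩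
  have hef : ∀ i j, lam.omegaAt x (G.ev i ()) (G.fv j ()) = if i = j then 1 else 0 :=
    fun i j => G.omegaAt_ev_fv i j ()
  have hee : ∀ i j, lam.omegaAt x (G.ev i ()) (G.ev j ()) = 0 :=
    fun i j => G.omegaAt_ev_ev i j ()
  have hne : ∀ i, G.ev i () ≠ 0 := fun i h => by
    have h1 := hef i i
    rw [h] at h1
    simp at h1
  -- The bases consist of curves in `K` through the vectors of the frame.
  choose c c' hc0 hcK hc' _ using fun i => hK.negative _ (hme i) (hne i)
  let Y : Matrix (Fin n) (Fin n) ℝ := Matrix.of fun i j => lam.omegaAt x (G.ev i ()) (c' j)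
  have hsum : ∀ a : Fin n → ℝ, HasDerivWithinAt (fun t => ∑ i, a i • c i t) (∑ i, a i • c' i)
      (Icc 0 1) 0 := fun a => HasDerivWithinAt.fun_sum fun i _ => (hc' i).fun_const_smul (a i)
  have hsumK : ∀ (a : Fin n → ℝ) (t : 𝕀), ∑ i, a i • c i t ∈ K t := fun a t =>
    Submodule.sum_mem _ fun j _ => Submodule.smul_mem _ _ (hcK j t)
  let t : ℕ → 𝕀 := fun m => ⟨1 / ((m : ℝ) + 1), by positivity, by
    rw [div_le_one (by positivity)]; linarith [(Nat.cast_nonneg m : (0 : ℝ) ≤ m)]⟩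
  have htpos : ∀ m, 0 < t m := fun m => by
    change (0 : ℝ) < 1 / ((m : ℝ) + 1)
    positivity
  have ht0 : Tendsto (fun m => (t m : ℝ)) atTop (𝓝 0) := tendsto_one_div_add_atTop_nhds_zero_nat
  have htt : Tendsto t atTop (𝓝 0) := tendsto_subtype_rng.2 ht0
  have htw : Tendsto (fun m => (t m : ℝ)) atTop (𝓝[Icc 0 1 \ {0}] 0) := by
    rw [tendsto_nhdsWithin_iff]
    exact ⟨ht0, Eventually.of_forall fun m => ⟨(t m).2, fun h => (htpos m).ne' (Subtype.ext h)⟩⟩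
  have htw' : Tendsto (fun m => (t m : ℝ)) atTop (𝓝[Icc 0 1] 0) :=
    htw.mono_right (nhdsWithin_mono _ sdiff_subset)
  have hslope : ∀ j, Tendsto (fun m => (t m : ℝ)⁻¹ • (c j (t m) - G.ev j ())) atTop (𝓝 (c' j)) := by
    intro j
    have h1 := (hasDerivWithinAt_iff_tendsto_slope.1 (hc' j)).comp htw
    refine h1.congr fun m => ?_
    simp [slope, hc0]
  have hlim : ∀ j, Tendsto (fun m => c j (t m)) atTop (𝓝 (G.ev j ())) := fun j => by
    have h1 := (hc' j).continuousWithinAt.tendsto.comp htw'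
    rwa [hc0] at h1
  let Xm : ℕ → Matrix (Fin n) (Fin n) ℝ := fun m => G.reMat () fun j => c j (t m)
  let Ym : ℕ → Matrix (Fin n) (Fin n) ℝ := fun m => G.imMat () fun j => c j (t m)
  have hX : Tendsto (fun m => (Xm m).map ((↑) : ℝ → ℂ)) atTop (𝓝 1) := by
    refine tendsto_pi_nhds.2 fun i => tendsto_pi_nhds.2 fun j => ?_
    have h1 : Tendsto (fun m => lam.omegaAt x (c j (t m)) (G.fv i ())) atTop
        (𝓝 (lam.omegaAt x (G.ev j ()) (G.fv i ()))) :=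
      (((lam.omegaAt x).flip (G.fv i ())).continuous.tendsto _).comp (hlim j)
    have h2 := (Complex.continuous_ofReal.tendsto _).comp h1
    rw [hef] at h2
    have h3 : (1 : CMat n) i j = (((if j = i then 1 else 0 : ℝ)) : ℂ) := by
      rw [one_apply]
      by_cases h : i = j
      · simp [h]
      · simp [h, Ne.symm h]
    rw [h3]
    exact h2
  have hY : Tendsto (fun m => (((t m : ℝ)⁻¹ : ℝ) : ℂ) • (Ym m).map ((↑) : ℝ → ℂ)) atTop
      (𝓝 (Y.map ((↑) : ℝ → ℂ))) := by
    refine tendsto_pi_nhds.2 fun i => tendsto_pi_nhds.2 fun j => ?_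
    have h1 := (Complex.continuous_ofReal.tendsto _).comp
      (((lam.omegaAt x (G.ev i ())).continuous.tendsto _).comp (hslope j))
    refine h1.congr fun m => ?_
    simp [Ym, SymplecticFrame.imMat, hee]
  have hXd : ∀ᶠ m in atTop, ((Xm m).map ((↑) : ℝ → ℂ)).det ≠ 0 := by
    have h1 : Tendsto (fun m => ((Xm m).map ((↑) : ℝ → ℂ)).det) atTop (𝓝 (1 : CMat n).det) :=
      ((continuous_id.matrix_det).tendsto (1 : CMat n)).comp hX
    rw [det_one] at h1
    exact h1.eventually (isOpen_ne.mem_nhds one_ne_zero)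
  have hcay : ∀ᶠ m in atTop, Complex.I • ((((t m : ℝ)⁻¹ : ℝ) : ℂ) • (Ym m).map ((↑) : ℝ → ℂ)) *
      ((Xm m).map ((↑) : ℝ → ℂ))⁻¹ =
      (((t m : ℝ)⁻¹ : ℝ) : ℂ) • cayley (-G.souriau () (K (t m))) := by
    filter_upwards [hXd] with m hm
    have hli : LinearIndependent ℝ fun j => c j (t m) := by
      rw [Fintype.linearIndependent_iff]
      intro a ha
      have h1 : Xm m *ᵥ a = 0 := by
        funext i
        exact (G.reMat_mulVec a i).trans (by rw [ha]; simp)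
      rw [SymplecticFrame.det_map_ofReal] at hm
      have h2 : (Xm m).det ≠ 0 := by exact_mod_cast hm
      exact congrFun (eq_zero_of_mulVec_eq_zero h2 h1)
    have hspan : Submodule.span ℝ (range fun j => c j (t m)) = K (t m) :=
      span_eq_of_finrank hli (fun j => hcK j (t m))
        (isLagrangian_iff.1 (hK.sec.isLagrangian (t m))).2.2
    have hL : lam.IsLagrangian x (Submodule.span ℝ (range fun j => c j (t m))) :=
      hspan ▸ hK.sec.isLagrangian (t m)
    have hU := G.souriau_mul_mconj (z := ()) hL
    rw [hspan] at hU
    set U := G.souriau () (K (t m))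
    have hp := G.zmat_add_mconj (z := ()) (v := fun j => c j (t m))
    have hs := G.zmat_sub_mconj (z := ()) (v := fun j => c j (t m))
    set Z := G.zmat () fun j => c j (t m)
    have h1 : (U + 1) * mconj Z = (2 : ℂ) • (Xm m).map ((↑) : ℝ → ℂ) := by
      rw [add_mul, hU, one_mul, hp]
    have h2 : (U - 1) * mconj Z = (2 * Complex.I) • (Ym m).map ((↑) : ℝ → ℂ) := by
      rw [sub_mul, hU, one_mul, hs]
    have h3 : (-U - 1).det ≠ 0 := by
      have h4 := congrArg det h1
      rw [det_mul, det_smul] at h4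
      have h5 : (U + 1).det ≠ 0 := by
        intro h0
        rw [h0, zero_mul] at h4
        exact mul_ne_zero (pow_ne_zero _ two_ne_zero) hm h4.symm
      have h6 : -U - 1 = -(U + 1) := by abel
      rw [h6, det_neg]
      exact mul_ne_zero (pow_ne_zero _ (by simp)) h5
    have h7 : cayley (-U) * (U + 1) = U - 1 := by
      have h8 := cayley_mul h3
      have h6 : -U - 1 = -(U + 1) := by abel
      rw [h6, mul_neg] at h8
      rw [← neg_inj, h8]
      abel
    have h9 : cayley (-U) * (Xm m).map ((↑) : ℝ → ℂ) = Complex.I • (Ym m).map ((↑) : ℝ → ℂ) := by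
      apply smul_right_injective _ (two_ne_zero (α := ℂ))
      change (2 : ℂ) • (cayley (-U) * _) = (2 : ℂ) • (Complex.I • _)
      rw [← mul_smul_comm, ← h1, ← Matrix.mul_assoc, h7, h2, smul_smul]
    rw [smul_comm Complex.I, ← h9, smul_mul, Matrix.mul_assoc, mul_nonsing_inv _ (Ne.isUnit hm),
      Matrix.mul_one]
  refine ⟨Y, t, ?_, ?_, htpos, htt, ?_⟩
  · ext i j
    have h1 := hK.omegaAt_deriv (hcK i) (hcK j) (hc' i) (hc' j)
    rw [hc0, hc0, lam.omegaAt_swap] at h1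
    change lam.omegaAt x (G.ev j ()) (c' i) = lam.omegaAt x (G.ev i ()) (c' j)
    linarith
  · intro a ha
    set v := ∑ j, a j • G.ev j () with hv
    have hv0 : v ≠ 0 := by
      intro h0
      apply ha
      funext i
      have h1 := congrArg (fun u => lam.omegaAt x u (G.fv i ())) h0
      simpa [hv, hef] using h1
    have hvK : v ∈ K 0 := Submodule.sum_mem _ fun j _ => Submodule.smul_mem _ _ (hme j)
    -- The curve through `v` provided by the hypothesis may differ from the combination of the
    -- curves `c i`, but the difference starts at `0`, so that both give the same value of the form.
    obtain ⟨d, d', hd0, hdK, hd', hneg⟩ := hK.negative v hvK hv0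
    have h1 := hK.omegaAt_deriv hdK (fun s => Submodule.sub_mem _ (hsumK a s) (hdK s)) hd'
      ((hsum a).fun_sub hd')
    have h2 : ∑ i, a i • c i 0 = v := by simp only [hc0, hv]
    rw [h2, hd0, sub_self, map_zero, zero_add, map_sub, sub_eq_zero] at h1
    rw [← h1] at hneg
    convert hneg using 1
    simp only [hv, dotProduct, mulVec, Y, of_apply, map_sum, map_smul, _root_.sum_apply,
      _root_.smul_apply, smul_eq_mul]
    simp only [Finset.mul_sum]
    rw [Finset.sum_comm]
    refine Finset.sum_congr rfl fun i _ => Finset.sum_congr rfl fun j _ => ?_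
    ring
  · have hinv : Tendsto (fun m => ((Xm m).map ((↑) : ℝ → ℂ))⁻¹) atTop (𝓝 (1 : CMat n)⁻¹) :=
      (continuousAt_matInv (by simp)).tendsto.comp hX
    have h1 := (hY.const_smul Complex.I).mul hinv
    rw [inv_one, mul_one] at h1
    exact h1.congr' hcay

include hf

/-- In a frame adapted to its end points, the rotation of a closing path is a universal constant. -/
theorem rotation_adapted {θ : 𝕀 → ℝ} (hθ : Continuous θ)
    (hph : ∀ t, G.HasPhase () (plane x (K t)) (θ t)) :
    θ 1 - θ 0 = n / 2 - jump (-(Complex.I • (1 : CMat n))) := by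
  let U : 𝕀 → CMat n := fun t => G.souriau () (K t)
  have hUc : Continuous U := G.continuous_souriau (σ := fun _ : 𝕀 => ()) continuous_const hK.sec
  have hUu : ∀ t, U t * (U t)ᴴ = 1 := fun t => G.souriau_unitary (z := ()) (hK.sec.isLagrangian t)
  have hU0 : U 0 = 1 := by
    have h1 := G.souriau_span_ev (z := ())
      (Eq.subst (motive := fun V : Submodule ℝ (Model n) => lam.IsLagrangian x V) he.symm
        (hK.sec.isLagrangian 0))
    rwa [he] at h1
  have hU1 : U 1 = -1 := by
    have h1 := G.souriau_span_fv (z := ())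
      (Eq.subst (motive := fun V : Submodule ℝ (Model n) => lam.IsLagrangian x V) hf.symm
        (hK.sec.isLagrangian 1))
    rwa [hf] at h1
  have hdet : ∀ t, (U t).det = Complex.exp (2 * Real.pi * θ t * Complex.I) := fun t =>
    (G.hasPhase_plane_iff (z := ()) (hK.sec.isLagrangian t)).1 (hph t)
  have hsub : ∀ t, 0 < t → (U t - 1).det ≠ 0 := fun t ht =>
    G.det_souriau_sub_one_ne_zero (z := ()) (hK.sec.isLagrangian t) (by
      rw [he]; exact hK.transversal t ht)
  have hcay : ∀ {A : CMat n}, (A - 1).det ≠ 0 → ContinuousAt (cayley (n := n)) A := by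
    intro A hA
    refine continuousAt_const.add (ContinuousAt.fun_const_smul ?_ _)
    exact ContinuousAt.comp (f := fun A : CMat n => A - 1) (continuousAt_matInv hA) (by fun_prop)
  obtain ⟨Y, t, hYs, hYn, htpos, ht0, hlim⟩ := hK.exists_tendsto_cayley G he
  obtain ⟨δ, hδ, hδU⟩ : ∃ δ > 0, ∀ s : 𝕀, dist s 0 < δ → (-U s - 1).det ≠ 0 := by
    have hc : Continuous fun s => (-U s - 1).det := by fun_prop
    have h0 : (-U 0 - 1).det ≠ 0 := by
      have h2 : -U 0 - 1 = (-2 : ℂ) • (1 : CMat n) := by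
        rw [hU0, neg_smul, two_smul]; abel
      rw [h2, det_smul, det_one, mul_one]
      exact pow_ne_zero _ (by norm_num)
    exact Metric.eventually_nhds_iff.1 (hc.continuousAt.eventually (isOpen_ne.mem_nhds h0))
  -- For small `t` the phase is compared on `[0, t]` with the Cayley transform of `-U`, and on
  -- `[t, 1]` with the one of `U`. The Cayley transforms of `-U 0 = -1` and `U 1 = -1` vanish, so
  -- only the jump between the two phases at time `t` remains.
  have key : ∀ s : 𝕀, 0 < s → dist s 0 < δ → θ 1 - θ 0 = n / 2 - jump (cayley (-U s)) := by
    intro s hs hsδ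
    have hd : ∀ a : 𝕀, (-U (min s a) - 1).det ≠ 0 := fun a => hδU _ (by
      refine lt_of_le_of_lt ?_ hsδ
      rw [Subtype.dist_eq, Subtype.dist_eq, Real.dist_eq, Real.dist_eq]
      have h1 : ((min s a : 𝕀) : ℝ) ≤ s := Subtype.coe_le_coe.2 (min_le_left s a)
      have h2 := (min s a).2.1
      have h3 := s.2.1
      simp only [Icc.coe_zero, sub_zero]
      rwa [abs_of_nonneg h2, abs_of_nonneg h3])
    have hd' : ∀ a : 𝕀, (U (max s a) - 1).det ≠ 0 := fun a => hsub _ (lt_max_of_lt_left hs)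
    have hneg : ∀ a, -U a * (-U a)ᴴ = 1 := fun a => by rw [conjTranspose_neg, neg_mul_neg, hUu]
    have e1 := eq_of_continuous_of_int
      (f := fun a : 𝕀 => θ (min s a) - argDet (cayley (-U (min s a))))
      (by
        refine (hθ.comp (continuous_const.min continuous_id)).sub
          (continuous_iff_continuousAt.2 fun a => ?_)
        refine ContinuousAt.comp (f := fun a => cayley (-U (min s a)))
          (continuousAt_argDet (cayley_skew (hneg _) (hd a))) ?_
        refine ContinuousAt.comp (f := fun a => -U (min s a)) (hcay (hd a)) ?_
        exact (hUc.comp (continuous_const.min continuous_id)).neg.continuousAt)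
      (fun a => by
        obtain ⟨m, hm⟩ := exp_two_pi_eq_iff.1
          ((hdet (min s a)).symm.trans (det_eq_exp_cayley_neg (hUu _) (hd a)))
        exact ⟨m, by rw [hm]; ring⟩) 0 1
    have e2 := eq_of_continuous_of_int
      (f := fun a : 𝕀 => θ (max s a) - (n / 2 + argDet (cayley (U (max s a)))))
      (by
        refine (hθ.comp (continuous_const.max continuous_id)).sub
          (continuous_const.add (continuous_iff_continuousAt.2 fun a => ?_))
        refine ContinuousAt.comp (f := fun a => cayley (U (max s a)))
          (continuousAt_argDet (cayley_skew (hUu _) (hd' a))) ?_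
        refine ContinuousAt.comp (f := fun a => U (max s a)) (hcay (hd' a)) ?_
        exact (hUc.comp (continuous_const.max continuous_id)).continuousAt)
      (fun a => by
        obtain ⟨m, hm⟩ := exp_two_pi_eq_iff.1
          ((hdet (max s a)).symm.trans (det_eq_exp_cayley (hUu _) (hd' a)))
        exact ⟨m, by rw [hm]; ring⟩) 0 1
    have m0 : min s 0 = 0 := min_eq_right s.2.1
    have m1 : min s 1 = s := min_eq_left s.2.2
    have M0 : max s 0 = s := max_eq_left s.2.1
    have M1 : max s 1 = 1 := max_eq_right s.2.2
    simp only [m0, m1, M0, M1, hU0, hU1] at e1 e2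
    have hinv : (cayley (-U s))⁻¹ = cayley (U s) := by
      apply inv_eq_left_inv
      have h1 := hd 1
      rw [m1] at h1
      exact cayley_mul_cayley_neg (hsub s hs) h1
    rw [jump, hinv]
    linarith
  have hYskew : (Complex.I • Y.map ((↑) : ℝ → ℂ))ᴴ = -(Complex.I • Y.map ((↑) : ℝ → ℂ)) := by
    ext i j
    have := congrFun (congrFun hYs i) j
    rw [transpose_apply] at this
    simp [this]
  have hYd : (Complex.I • Y.map ((↑) : ℝ → ℂ)).det ≠ 0 := by
    rw [det_smul, SymplecticFrame.det_map_ofReal]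
    refine mul_ne_zero (pow_ne_zero _ Complex.I_ne_zero) ?_
    intro h0
    obtain ⟨a, ha0, ha⟩ := exists_mulVec_eq_zero_iff.2 (Complex.ofReal_eq_zero.1 h0)
    have := hYn a ha0
    rw [ha] at this
    simp at this
  -- As `t → 0`, the jump tends to its value at the velocity.
  have hj := (continuousAt_jump hYskew hYd).tendsto.comp hlim
  have hev : ∀ᶠ m in atTop, jump ((((t m : ℝ)⁻¹ : ℝ) : ℂ) • cayley (-G.souriau () (K (t m)))) =
      n / 2 - (θ 1 - θ 0) := by
    have h1 : ∀ᶠ m in atTop, dist (t m) 0 < δ := ht0.eventually (Metric.ball_mem_nhds 0 hδ)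
    filter_upwards [h1] with m hm
    have hn : -U (t m) * (-U (t m))ᴴ = 1 := by rw [conjTranspose_neg, neg_mul_neg, hUu]
    have hdm := hδU _ hm
    have hdc : (cayley (-U (t m))).det ≠ 0 := by
      have h2 := congrArg det (cayley_mul_cayley_neg (hsub _ (htpos m)) hdm)
      rw [det_mul, det_one] at h2
      exact right_ne_zero_of_mul (h2.trans_ne one_ne_zero)
    have h3 := jump_smul (cayley_skew hn hdm) hdc
      (inv_pos.2 (show (0 : ℝ) < t m from htpos m))
    refine h3.trans ?_
    rw [key _ (htpos m) hm]
    ring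
  have h4 := tendsto_nhds_unique hj (tendsto_const_nhds.congr' (hev.mono fun m hm => hm.symm))
  rw [jump_negDef hYs hYn] at h4
  linarith

end

/-- Closing paths with the same end points have the same rotation. -/
theorem rotation_unique (hK : IsClosing lam x K) (hK' : IsClosing lam x K') (h0 : K 0 = K' 0)
    (h1 : K 1 = K' 1) (F : SymplecticFrame lam w) {z : X} (hz : w z = x) {r r' : ℝ}
    (hr : F.HasRotation (fun _ => z) (fun t => plane x (K t)) r)
    (hr' : F.HasRotation (fun _ => z) (fun t => plane x (K' t)) r') : r = r' := by
  subst hz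
  obtain ⟨G, he, hf⟩ := hK.exists_frame
  have hG : ∀ {Q : 𝕀 → Submodule ℝ (Model n)} {a : ℝ},
      F.HasRotation (fun _ => z) (fun t => plane (w z) (Q t)) a →
      (F.pull (ContinuousMap.const Unit z)).HasRotation (fun _ => ())
        (fun t => plane (w z) (Q t)) a := fun h => h
  -- The change to an adapted frame contributes the same difference of end point values to both.
  obtain ⟨φ, hφ⟩ := (F.pull (ContinuousMap.const Unit z)).exists_shift G
  obtain ⟨θ, hθ, e1⟩ := hφ _ _ _ continuous_const hK.sec (hG hr)
  obtain ⟨θ', hθ', e2⟩ := hφ _ _ _ continuous_const hK'.sec (hG hr')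
  rw [hK.rotation_adapted G he hf θ.continuous hθ] at e1
  rw [hK'.rotation_adapted G (he.trans h0) (hf.trans h1) θ'.continuous hθ'] at e2
  simp only [h0, h1] at e1 e2
  linarith

end IsClosing

end ClosingRotation

/-! ### The index of a bounding square -/

section Index

variable {n : ℕ} {M : Type*} [TopologicalSpace M] [ChartedSpace (Model n) M]
  [IsManifold (𝓡 (2 * n + 1)) ∞ M] {lam : ContactForm n M} {R R' : Legendrian lam}

theorem dMap_eq_id {g : M → M} {x : M} (h : g =ᶠ[𝓝 x] id) :
    dMap (n := n) g x = ContinuousLinearMap.id ℝ (Model n) := by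
  have h1 : dMap (n := n) g x = dMap (n := n) id x := h.mfderiv_eq
  rw [h1]
  exact mfderiv_id

theorem transport_zero {γ : ReebChord R R'} {Φ : ℝ → M → M} (h : γ.IsLocalFlow Φ) :
    γ.transport Φ 0 = R.gauss (γ.path 0) := by
  obtain ⟨ε, hε, U, hU, hxU, -, h0, -, hp⟩ := h
  rw [transport_eq]
  change _ = plane (γ.path 0) (tanAt R.carrier (γ.path 0))
  rw [plane_inj]
  refine ⟨hp 0, ?_⟩
  have h1 : Φ ((0 : 𝕀) : ℝ) =ᶠ[𝓝 (γ.path 0)] id := by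
    filter_upwards [hU.mem_nhds hxU] with x hx
    exact h0 x hx
  rw [dMap_eq_id h1]
  exact Submodule.map_id _

theorem _root_.LegendrianIndex.ReebChord.IsClosingPath.isClosing {γ : ReebChord R R'}
    {Φ : ℝ → M → M} {K : 𝕀 → Submodule ℝ (Model n)} (h : γ.IsClosingPath Φ K) :
    IsClosing lam (γ.path 1) K := by
  obtain ⟨h1, h2, -, h4, h5⟩ := h
  refine ⟨h1, fun t ht => ?_, fun v hv hv0 => ?_⟩
  · rw [h2]
    exact h4 t ht
  · obtain ⟨c, c', e1, e2, e3, e4⟩ := h5 v (h2 ▸ hv) hv0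
    exact ⟨c, c', e1, e2, e3, e4⟩

/-- A nondegenerate chord has a local flow and a closing path. -/
theorem _root_.LegendrianIndex.ReebChord.Nondegenerate.exists_closing {γ : ReebChord R R'}
    (h : γ.Nondegenerate) : ∃ (Φ : ℝ → M → M) (K : 𝕀 → Submodule ℝ (Model n)),
      γ.IsLocalFlow Φ ∧ γ.IsClosingPath Φ K := by
  obtain ⟨Φ, hΦ, V, hV, hVR⟩ := h
  have h1 : lam.IsLagrangian (γ.path 1) V := by
    have h2 := (isLagSec_transport hΦ).isLagrangian 1
    rwa [hV] at h2
  have h0 := R'.isLagrangian_tanAt γ.target_mem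
  obtain ⟨K, hK, hK0, hK1⟩ :=
    exists_isClosing h0 h1 ((inf_comm (α := Submodule ℝ (Model n)) _ _).trans hVR)
  refine ⟨Φ, K, hΦ, hK.sec, hK0, ?_, fun t ht => ?_, fun v hv hv0 => ?_⟩
  · rw [hV, hK1]
  · have h2 := hK.transversal t ht
    rw [hK0] at h2
    exact h2
  · obtain ⟨c, c', e1, e2, e3, e4⟩ := hK.negative v (hK0 ▸ hv) hv0
    exact ⟨c, c', e1, e2, e3, e4⟩

/-- The rotation of the closing path does not depend on the choice of this path. -/
theorem closing_hasRotation [T2Space M] {γ : ReebChord R R'} {Φ Φ' : ℝ → M → M}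
    {K K' : 𝕀 → Submodule ℝ (Model n)} (hΦ : γ.IsLocalFlow Φ) (hK : γ.IsClosingPath Φ K)
    (hΦ' : γ.IsLocalFlow Φ') (hK' : γ.IsClosingPath Φ' K') {X : Type*} [TopologicalSpace X]
    {w : X → M} {F : SymplecticFrame lam w} {z : X} (hz : w z = γ.path 1) {r : ℝ}
    (h : F.HasRotation (fun _ => z) (fun t => plane (γ.path 1) (K' t)) r) :
    F.HasRotation (fun _ => z) (fun t => plane (γ.path 1) (K t)) r := by
  have hs : IsLagSec lam (fun _ : 𝕀 => w z) fun t => plane (γ.path 1) (K t) := by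
    rw [hz]
    exact hK.isClosing.sec
  obtain ⟨r', hr'⟩ := F.exists_hasRotation (σ := fun _ => z) continuous_const hs
  have h0 : K' 0 = K 0 := hK'.2.1.trans hK.2.1.symm
  have h1 : K' 1 = K 1 := by
    have e1 := hK'.2.2.1
    rw [transport_congr hΦ' hΦ, hK.2.2.1] at e1
    exact (plane_inj.1 e1).2.symm
  rwa [hK'.isClosing.rotation_unique hK.isClosing h0 h1 F hz h hr']

/-- The boundary of the square without its left side, together with the corner at which the closing
path is inserted. -/
def outerPath : Fin 4 → 𝕀 → 𝕀 × 𝕀 :=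
  ![fun s => (s, 0), fun t => (1, t), fun _ => (1, 1), fun s => (s, 1)]

/-- The Lagrangian planes over `outerPath`. -/
def outerPlane (γ : ReebChord R R') (Φ : ℝ → M → M) (K : 𝕀 → Submodule ℝ (Model n))
    (w : 𝕀 × 𝕀 → M) : Fin 4 → 𝕀 → Plane n M :=
  ![fun s => R.gauss (w (s, 0)), γ.transport Φ, fun t => plane (γ.path 1) (K t),
    fun s => R'.gauss (w (s, 1))]

/-- The multiplicities of the pieces of `outerPath`. -/
def outerSign : Fin 4 → ℤ := ![1, 1, -1, -1]

theorem continuous_outerPath (j : Fin 4) : Continuous (outerPath j) := by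
  fin_cases j
  · exact (by fun_prop : Continuous fun s : 𝕀 => (s, (0 : 𝕀)))
  · exact (by fun_prop : Continuous fun t : 𝕀 => ((1 : 𝕀), t))
  · exact (by fun_prop : Continuous fun _ : 𝕀 => ((1 : 𝕀), (1 : 𝕀)))
  · exact (by fun_prop : Continuous fun s : 𝕀 => (s, (1 : 𝕀)))

section

variable {γ : ReebChord R R'} {Φ : ℝ → M → M} {K : 𝕀 → Submodule ℝ (Model n)}
  (hΦ : γ.IsLocalFlow Φ) (hK : γ.IsClosingPath Φ K)
include hΦ hK

theorem isLagSec_outerPlane {H : C(𝕀 × 𝕀 × 𝕀, M)} (h0 : ∀ a s, H (a, s, 0) ∈ R.carrier)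
    (h1 : ∀ a s, H (a, s, 1) ∈ R'.carrier) (hr : ∀ a t, H (a, 1, t) = γ.path t) (j : Fin 4) :
    IsLagSec lam (fun z : 𝕀 × 𝕀 => H (z.1, outerPath j z.2))
      (fun z => outerPlane γ Φ K (fun y => H (z.1, y)) j z.2) := by
  fin_cases j
  · exact R.isLagSec_gauss (c := fun z : 𝕀 × 𝕀 => H (z.1, z.2, 0)) (by fun_prop) fun z => h0 _ _
  · have h := (isLagSec_transport hΦ).comp (σ := fun z : 𝕀 × 𝕀 => z.2) continuous_snd
    have e : (fun z : 𝕀 × 𝕀 => γ.path z.2) = fun z : 𝕀 × 𝕀 => H (z.1, 1, z.2) :=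
      funext fun z => (hr _ _).symm
    rw [e] at h
    exact h
  · have h := hK.isClosing.sec.comp (σ := fun z : 𝕀 × 𝕀 => z.2) continuous_snd
    have e : (fun _ : 𝕀 × 𝕀 => γ.path 1) = fun z : 𝕀 × 𝕀 => H (z.1, 1, 1) :=
      funext fun z => (hr _ _).symm
    rw [e] at h
    exact h
  · exact R'.isLagSec_gauss (c := fun z : 𝕀 × 𝕀 => H (z.1, z.2, 1)) (by fun_prop) fun z => h1 _ _

/-- The chain over the outer part of the boundary of the square leads from `T R` over the corner
`(0,0)` to `T R'` over the corner `(0,1)`. -/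
theorem outer_boundary {w : 𝕀 × 𝕀 → M} (hr : ∀ t, w (1, t) = γ.path t)
    (h : 𝕀 × 𝕀 → Plane n M → ℝ) :
    ∑ j, outerSign j * (h (outerPath j 1) (outerPlane γ Φ K w j 1) -
      h (outerPath j 0) (outerPlane γ Φ K w j 0)) =
    h (0, 1) (R'.gauss (w (0, 1))) - h (0, 0) (R.gauss (w (0, 0))) := by
  have e0 := transport_zero hΦ
  have e1 : γ.transport Φ 1 = plane (γ.path 1) (K 1) := hK.2.2.1
  have e2 : plane (γ.path 1) (K 0) = R'.gauss (γ.path 1) := by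
    change _ = plane (γ.path 1) (tanAt R'.carrier (γ.path 1))
    rw [plane_inj]
    exact ⟨rfl, hK.2.1⟩
  rw [Fin.sum_univ_four]
  simp only [outerSign, outerPath, outerPlane, Matrix.cons_val, e0, e1, e2, hr]
  push_cast
  ring

variable {κ : Type*} [Fintype κ] {τ : κ → 𝕀 → 𝕀 × 𝕀} {ε : κ → ℤ}

/-- Together with any chain with the same end points, run backward along the left side, the outer
part forms a cycle. -/
theorem isCycle_boundary {w : 𝕀 × 𝕀 → M} (hr : ∀ t, w (1, t) = γ.path t)
    {Q : κ → 𝕀 → Plane n M} (hQ : ∀ h : 𝕀 × 𝕀 → Plane n M → ℝ,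
      ∑ j, ε j * (h (τ j 1) (Q j 1) - h (τ j 0) (Q j 0)) =
        h (0, 1) (R'.gauss (w (0, 1))) - h (0, 0) (R.gauss (w (0, 0)))) :
    IsCycle (Sum.elim outerPath τ) (Sum.elim (outerPlane γ Φ K w) Q)
      (Sum.elim outerSign fun j => -ε j) := by
  intro h
  rw [Fintype.sum_sum_type]
  simp only [Sum.elim_inl, Sum.elim_inr]
  rw [outer_boundary hΦ hK hr h, ← hQ h, ← Finset.sum_add_distrib]
  refine Finset.sum_eq_zero fun j _ => ?_
  push_cast
  ring

/-- The total rotation over the boundary of a square is an integer, and invariant under homotopies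
which preserve the boundary conditions. The left side carries an arbitrary chain of planes `Q j`, so
that this applies to bounding squares and to polygons. -/
theorem boundary_rotation {H : C(𝕀 × 𝕀 × 𝕀, M)} (h0 : ∀ a s, H (a, s, 0) ∈ R.carrier)
    (h1 : ∀ a s, H (a, s, 1) ∈ R'.carrier) (hr : ∀ a t, H (a, 1, t) = γ.path t)
    (hτ : ∀ j, Continuous (τ j)) {Q : κ → 𝕀 × 𝕀 → Plane n M}
    (hQs : ∀ j, IsLagSec lam (fun z => H (z.1, τ j z.2)) (Q j))
    (hQ : ∀ (a : 𝕀) (h : 𝕀 × 𝕀 → Plane n M → ℝ),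
      ∑ j, ε j * (h (τ j 1) (Q j (a, 1)) - h (τ j 0) (Q j (a, 0))) =
        h (0, 1) (R'.gauss (H (a, 0, 1))) - h (0, 0) (R.gauss (H (a, 0, 0))))
    {w w' : 𝕀 × 𝕀 → M} (hw : ∀ z, H (0, z) = w z) (hw' : ∀ z, H (1, z) = w' z)
    {F : SymplecticFrame lam w} {F' : SymplecticFrame lam w'} {r r' : Fin 4 → ℝ} {l l' : κ → ℝ}
    (hF : ∀ j, F.HasRotation (outerPath j) (outerPlane γ Φ K w j) (r j))
    (hF' : ∀ j, F'.HasRotation (outerPath j) (outerPlane γ Φ K w' j) (r' j))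
    (hl : ∀ j, F.HasRotation (τ j) (fun t => Q j (0, t)) (l j))
    (hl' : ∀ j, F'.HasRotation (τ j) (fun t => Q j (1, t)) (l' j)) :
    (∃ m : ℤ, r 0 + r 1 - r 2 - r 3 - ∑ j, ε j * l j = m) ∧
      r 0 + r 1 - r 2 - r 3 - ∑ j, ε j * l j = r' 0 + r' 1 - r' 2 - r' 3 - ∑ j, ε j * l' j := by
  obtain rfl : (fun z => H (0, z)) = w := funext hw
  obtain rfl : (fun z => H (1, z)) = w' := funext hw'
  have hsum : ∀ (r : Fin 4 → ℝ) (l : κ → ℝ),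
      ∑ j, ((Sum.elim outerSign (fun j => -ε j) j : ℤ) : ℝ) * Sum.elim r l j =
        r 0 + r 1 - r 2 - r 3 - ∑ j, ε j * l j := by
    intro r l
    rw [Fintype.sum_sum_type, Fin.sum_univ_four]
    simp only [Sum.elim_inl, Sum.elim_inr, outerSign, Matrix.cons_val]
    push_cast
    simp only [neg_mul, Finset.sum_neg_distrib]
    ring
  let P : Fin 4 ⊕ κ → 𝕀 × 𝕀 → Plane n M :=
    Sum.elim (fun j z => outerPlane γ Φ K (fun y => H (z.1, y)) j z.2) Q
  have hσ : ∀ j, Continuous (Sum.elim outerPath τ j) := by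
    rintro (j | j)
    exacts [continuous_outerPath j, hτ j]
  have hP : ∀ j, IsLagSec lam (fun z => H (z.1, Sum.elim outerPath τ j z.2)) (P j) := by
    rintro (j | j)
    exacts [isLagSec_outerPlane hΦ hK h0 h1 hr j, hQs j]
  have hc : ∀ a, IsCycle (Sum.elim outerPath τ) (fun j t => P j (a, t))
      (Sum.elim outerSign fun j => -ε j) := by
    intro a
    have h := isCycle_boundary hΦ hK (τ := τ) (ε := ε) (w := fun y => H (a, y)) (hr a)
      (Q := fun j t => Q j (a, t)) (hQ a)
    have e : (fun j t => P j (a, t)) = Sum.elim (outerPlane γ Φ K fun y => H (a, y))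
        fun j t => Q j (a, t) := by
      funext j
      rcases j with j | j <;> rfl
    rw [e]
    exact h
  have hR : ∀ j, F.HasRotation (Sum.elim outerPath τ j) (fun t => P j (0, t)) (Sum.elim r l j) := by
    rintro (j | j)
    exacts [hF j, hl j]
  have hR' : ∀ j, F'.HasRotation (Sum.elim outerPath τ j) (fun t => P j (1, t))
      (Sum.elim r' l' j) := by
    rintro (j | j)
    exacts [hF' j, hl' j]
  constructor
  · rw [← hsum]
    exact (hc 0).exists_int (fun j => (hP j).comp (σ := fun t => (0, t)) (by fun_prop)) hR
  · rw [← hsum, ← hsum]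
    exact rotation_homotopy hσ hP hc hR hR'

theorem exists_outer_rotation {w : C(𝕀 × 𝕀, M)} (h0 : ∀ s, w (s, 0) ∈ R.carrier)
    (h1 : ∀ s, w (s, 1) ∈ R'.carrier) (hr : ∀ t, w (1, t) = γ.path t)
    (F : SymplecticFrame lam w) :
    ∃ r : Fin 4 → ℝ, ∀ j, F.HasRotation (outerPath j) (outerPlane γ Φ K w j) (r j) := by
  have h := fun j => F.exists_hasRotation (continuous_outerPath j)
    ((isLagSec_outerPlane hΦ hK (H := w.comp ContinuousMap.snd) (fun _ => h0) (fun _ => h1)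
      (fun _ => hr) j).comp (σ := fun t => (0, t)) (by fun_prop))
  choose r hr using h
  exact ⟨r, hr⟩

end

/-- A path of maps on the square as a homotopy. -/
theorem exists_homotopy {p : C(𝕀 × 𝕀, M) → Prop} {w w' : {w : C(𝕀 × 𝕀, M) // p w}}
    (h : (Quotient.mk _ w : ZerothHomotopy {w : C(𝕀 × 𝕀, M) // p w}) = Quotient.mk _ w') :
    ∃ H : C(𝕀 × 𝕀 × 𝕀, M), (∀ a, p ⟨fun z => H (a, z), by fun_prop⟩) ∧
      (∀ z, H (0, z) = w.1 z) ∧ ∀ z, H (1, z) = w'.1 z := by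
  obtain ⟨f⟩ : Joined w w' := Quotient.exact h
  let g : C(𝕀, C(𝕀 × 𝕀, M)) := ⟨fun a => (f a).1, by fun_prop⟩
  refine ⟨g.uncurry, fun a => ?_, fun z => ?_, fun z => ?_⟩
  · exact (f a).2
  · change (f 0).1 z = w.1 z
    rw [f.source]
  · change (f 1).1 z = w'.1 z
    rw [f.target]

/-- A relation between maps and integers which is total, and single valued on homotopy classes,
defines a function on homotopy classes. -/
theorem exists_classFun {α : Type*} [TopologicalSpace α] {S : α → ℤ → Prop}
    (hex : ∀ w, ∃ m, S w m) (hun : ∀ (w w' : α) (m m' : ℤ),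
      (Quotient.mk _ w : ZerothHomotopy α) = Quotient.mk _ w' → S w m → S w' m' → m = m') :
    ∃ μ : ZerothHomotopy α → ℤ, ∀ w m, S w m ↔ μ (Quotient.mk _ w) = m := by
  choose i hi using hex
  have hout : ∀ c : ZerothHomotopy α, ∃ w, Quotient.mk _ w = c := Quotient.exists_rep
  choose o ho using hout
  refine ⟨fun c => i (o c), fun w m => ⟨fun h => hun _ _ _ _ (ho _) (hi _) h, ?_⟩⟩
  rintro rfl
  change S w (i (o _))
  rw [hun _ _ _ _ (ho _) (hi _) (hi w)]
  exact hi w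

section Square

variable {ℓ : GradedBridge R R'} {γ : ReebChord R R'}

/-- The index of a square may be computed with any local flow and closing path. -/
theorem isSquareIndex_iff [T2Space M] {Φ : ℝ → M → M} {K : 𝕀 → Submodule ℝ (Model n)}
    (hΦ : γ.IsLocalFlow Φ) (hK : γ.IsClosingPath Φ K) {w : Square ℓ γ} {m : ℤ} :
    IsSquareIndex w m ↔ ∃ (F : SymplecticFrame lam w.1) (r : Fin 4 → ℝ) (l : ℝ),
      (∀ j, F.HasRotation (outerPath j) (outerPlane γ Φ K w.1 j) (r j)) ∧
      F.HasRotation (fun t => (0, t)) ℓ.grading l ∧ (m : ℝ) = r 0 + r 1 - r 2 - r 3 - l := by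
  constructor
  · rintro ⟨F, Φ', K', left, bottom, right, corner, top, hΦ', hK', hl, hb, hr, hc, ht, hm⟩
    refine ⟨F, ![bottom, right, corner, top], left, ?_, hl, ?_⟩
    · intro j
      fin_cases j
      · exact hb
      · rw [transport_congr hΦ' hΦ] at hr
        exact hr
      · exact closing_hasRotation hΦ hK hΦ' hK' (w.2.2.2.2 1) hc
      · exact ht
    · rw [hm]
      simp only [Matrix.cons_val]
      ring
  · rintro ⟨F, r, l, hr, hl, hm⟩
    refine ⟨F, Φ, K, l, r 0, r 1, r 2, r 3, hΦ, hK, hl, hr 0, hr 1, hr 2, hr 3, ?_⟩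
    rw [hm]
    ring

theorem square_rotation {Φ : ℝ → M → M} {K : 𝕀 → Submodule ℝ (Model n)}
    (hΦ : γ.IsLocalFlow Φ) (hK : γ.IsClosingPath Φ K) {w w' : Square ℓ γ}
    (h : (Quotient.mk _ w : SquareClass ℓ γ) = Quotient.mk _ w')
    {F : SymplecticFrame lam w.1} {F' : SymplecticFrame lam w'.1} {r r' : Fin 4 → ℝ} {l l' : ℝ}
    (hF : ∀ j, F.HasRotation (outerPath j) (outerPlane γ Φ K w.1 j) (r j))
    (hF' : ∀ j, F'.HasRotation (outerPath j) (outerPlane γ Φ K w'.1 j) (r' j))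
    (hl : F.HasRotation (fun t => (0, t)) ℓ.grading l)
    (hl' : F'.HasRotation (fun t => (0, t)) ℓ.grading l') :
    (∃ m : ℤ, r 0 + r 1 - r 2 - r 3 - l = m) ∧
      r 0 + r 1 - r 2 - r 3 - l = r' 0 + r' 1 - r' 2 - r' 3 - l' := by
  obtain ⟨H, hp, h0, h1⟩ := exists_homotopy h
  have key := boundary_rotation hΦ hK (H := H) (κ := Unit) (τ := fun _ t => (0, t))
    (ε := fun _ => 1) (Q := fun _ z => ℓ.grading z.2) (w := w.1) (w' := w'.1) (F := F) (F' := F')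
    (r := r) (r' := r') (l := fun _ => l) (l' := fun _ => l')
    (fun a => (hp a).1) (fun a => (hp a).2.1) (fun a => (hp a).2.2.2) (fun _ => by fun_prop)
    (fun _ => by
      have hs : IsLagSec lam ℓ.path ℓ.grading := ℓ.isSection
      have h2 := hs.comp (σ := fun z : 𝕀 × 𝕀 => z.2) continuous_snd
      have e : (fun z : 𝕀 × 𝕀 => ℓ.path z.2) = fun z : 𝕀 × 𝕀 => H (z.1, 0, z.2) :=
        funext fun z => ((hp z.1).2.2.1 z.2).symm
      rw [e] at h2
      exact h2)
    (fun a φ => by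
      have e0 : H (a, 0, 0) = ℓ.path 0 := (hp a).2.2.1 0
      have e1 : H (a, 0, 1) = ℓ.path 1 := (hp a).2.2.1 1
      simp [ℓ.grading_zero, ℓ.grading_one, e0, e1])
    h0 h1 hF hF' (fun _ => hl) (fun _ => hl')
  simpa using key

/-- The Maslov index of bounding squares is well defined. -/
theorem exists_squareIndex [T2Space M] (ℓ : GradedBridge R R') {γ : ReebChord R R'}
    (hγ : γ.Nondegenerate) : ∃ μ : SquareClass ℓ γ → ℤ, ∀ (w : Square ℓ γ) (m : ℤ),
      IsSquareIndex w m ↔ μ (Quotient.mk _ w) = m := by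
  obtain ⟨Φ, K, hΦ, hK⟩ := hγ.exists_closing
  have hex : ∀ w : Square ℓ γ, ∃ m : ℤ, IsSquareIndex w m := by
    intro w
    obtain ⟨F⟩ := exists_symplecticFrame_square lam w.1
    obtain ⟨r, hr⟩ := exists_outer_rotation hΦ hK w.2.1 w.2.2.1 w.2.2.2.2 F
    have hs : IsLagSec lam (fun t => w.1 (0, t)) ℓ.grading := by
      have e : (fun t => w.1 (0, t)) = ℓ.path := funext w.2.2.2.1
      rw [e]
      exact ℓ.isSection
    obtain ⟨l, hl⟩ := F.exists_hasRotation (σ := fun t => (0, t)) (by fun_prop) hs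
    obtain ⟨⟨m, hm⟩, -⟩ := square_rotation hΦ hK rfl hr hr hl hl
    exact ⟨m, (isSquareIndex_iff hΦ hK).2 ⟨F, r, l, hr, hl, hm.symm⟩⟩
  have hun : ∀ (w w' : Square ℓ γ) (m m' : ℤ), (Quotient.mk _ w : SquareClass ℓ γ) =
      Quotient.mk _ w' → IsSquareIndex w m → IsSquareIndex w' m' → m = m' := by
    intro w w' m m' hww hm hm'
    obtain ⟨F, r, l, hr, hl, hm⟩ := (isSquareIndex_iff hΦ hK).1 hm
    obtain ⟨F', r', l', hr', hl', hm'⟩ := (isSquareIndex_iff hΦ hK).1 hm'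
    have := (square_rotation hΦ hK hww hr hr' hl hl').2
    rw [← hm, ← hm'] at this
    exact_mod_cast this
  exact exists_classFun hex hun

end Square

end Index

/-! ### The index of a polygon -/

section Polygons

theorem continuous_sub (N j : ℕ) : Continuous (sub N j) := by
  unfold sub
  exact continuous_projIcc.comp (by fun_prop)

theorem sub_succ_zero {N : ℕ} (j : ℕ) : sub N (j + 1) 0 = sub N j 1 := by
  simp [sub]

theorem sub_zero_zero (N : ℕ) : sub N 0 0 = 0 := by
  simp [sub]

theorem sub_last_one (N : ℕ) : sub (N + 1) N 1 = 1 := by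
  have : ((N : ℝ) + 1) / ((N + 1 : ℕ) : ℝ) = 1 := by
    push_cast
    exact div_self (by positivity)
  simp only [sub, Icc.coe_one, this]
  exact projIcc_right (zero_le_one (α := ℝ))

/-- The end points of `k + 1` intervals and of the `k` gaps between them. -/
theorem sum_telescope {k : ℕ} (A B : Fin (k + 1) → ℝ) :
    ∑ i, (B i - A i) + ∑ i : Fin k, (A i.succ - B i.castSucc) = B (Fin.last k) - A 0 := by
  rw [Finset.sum_sub_distrib, Finset.sum_sub_distrib, Fin.sum_univ_castSucc B, Fin.sum_univ_succ A]
  ring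

variable {n : ℕ} {M : Type*} [TopologicalSpace M] [ChartedSpace (Model n) M]
  [IsManifold (𝓡 (2 * n + 1)) ∞ M] {lam : ContactForm n M} {k : ℕ}
  {R : Fin (k + 2) → Legendrian lam}
  {γ : ∀ i : Fin (k + 1), ReebChord (R i.castSucc) (R i.succ)}
  {γ₀ : ReebChord (R 0) (R (Fin.last (k + 1)))}

/-- The left side of a polygon: the chords, the closing paths at their end points, and the arcs. The
`i`-th chord lies over the subinterval with number `2 i`, the `i`-th arc over the next one. -/
def leftPath (k : ℕ) : Fin (k + 1) ⊕ Fin (k + 1) ⊕ Fin k → 𝕀 → 𝕀 × 𝕀 :=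
  Sum.elim (fun i t => (0, sub (2 * k + 1) (2 * (i : ℕ)) t))
    (Sum.elim (fun i _ => (0, sub (2 * k + 1) (2 * (i : ℕ)) 1))
      fun i t => (0, sub (2 * k + 1) (2 * (i : ℕ) + 1) t))

/-- The Lagrangian planes over `leftPath`. -/
def leftPlane (γ : ∀ i : Fin (k + 1), ReebChord (R i.castSucc) (R i.succ))
    (Φ : Fin (k + 1) → ℝ → M → M) (K : Fin (k + 1) → 𝕀 → Submodule ℝ (Model n)) (w : 𝕀 × 𝕀 → M) :
    Fin (k + 1) ⊕ Fin (k + 1) ⊕ Fin k → 𝕀 → Plane n M :=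
  Sum.elim (fun i t => (γ i).transport (Φ i) t)
    (Sum.elim (fun i t => plane ((γ i).path 1) (K i t))
      fun i t => (R i.succ.castSucc).gauss (w (0, sub (2 * k + 1) (2 * (i : ℕ) + 1) t)))

/-- The multiplicities of the pieces of `leftPath`. -/
def leftSign (k : ℕ) : Fin (k + 1) ⊕ Fin (k + 1) ⊕ Fin k → ℤ :=
  Sum.elim (fun _ => 1) (Sum.elim (fun _ => -1) fun _ => 1)

theorem leftSign_sum (l : Fin (k + 1) ⊕ Fin (k + 1) ⊕ Fin k → ℝ) :
    ∑ j, leftSign k j * l j = ∑ i, (l (Sum.inl i) - l (Sum.inr (Sum.inl i))) +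
      ∑ i, l (Sum.inr (Sum.inr i)) := by
  rw [Fintype.sum_sum_type, Fintype.sum_sum_type, Finset.sum_sub_distrib]
  simp only [leftSign, Sum.elim_inl, Sum.elim_inr]
  push_cast
  simp only [one_mul, neg_mul, Finset.sum_neg_distrib]
  ring

theorem continuous_leftPath (j : Fin (k + 1) ⊕ Fin (k + 1) ⊕ Fin k) :
    Continuous (leftPath k j) := by
  rcases j with i | i | i
  · exact continuous_const.prodMk (continuous_sub _ _)
  · exact continuous_const
  · exact continuous_const.prodMk (continuous_sub _ _)

variable {Φ : Fin (k + 1) → ℝ → M → M} {K : Fin (k + 1) → 𝕀 → Submodule ℝ (Model n)}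

/-- The chain over the left side leads from `T R_0` over the corner `(0,0)` to `T R_{k+1}` over the
corner `(0,1)`. -/
theorem left_boundary (hΦ : ∀ i, (γ i).IsLocalFlow (Φ i))
    (hK : ∀ i, (γ i).IsClosingPath (Φ i) (K i))
    {w : 𝕀 × 𝕀 → M}
    (hw : ∀ i t, w (0, sub (2 * k + 1) (2 * ((i : Fin (k + 1)) : ℕ)) t) = (γ i).path t)
    (h : 𝕀 × 𝕀 → Plane n M → ℝ) :
    ∑ j, leftSign k j * (h (leftPath k j 1) (leftPlane γ Φ K w j 1) -
      h (leftPath k j 0) (leftPlane γ Φ K w j 0)) =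
    h (0, 1) ((R (Fin.last (k + 1))).gauss (w (0, 1))) - h (0, 0) ((R 0).gauss (w (0, 0))) := by
  let A : Fin (k + 1) → ℝ := fun i => h (0, sub (2 * k + 1) (2 * (i : ℕ)) 0)
    ((R i.castSucc).gauss (w (0, sub (2 * k + 1) (2 * (i : ℕ)) 0)))
  let B : Fin (k + 1) → ℝ := fun i => h (0, sub (2 * k + 1) (2 * (i : ℕ)) 1)
    ((R i.succ).gauss (w (0, sub (2 * k + 1) (2 * (i : ℕ)) 1)))
  have e2 : ∀ i, plane ((γ i).path 1) (K i 0) = (R i.succ).gauss ((γ i).path 1) := fun i => by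
    change _ = plane ((γ i).path 1) (tanAt (R i.succ).carrier ((γ i).path 1))
    rw [plane_inj]
    exact ⟨rfl, (hK i).2.1⟩
  have e1 : ∀ i, (γ i).transport (Φ i) 1 = plane ((γ i).path 1) (K i 1) := fun i => (hK i).2.2.1
  rw [leftSign_sum]
  have h1 : ∀ i : Fin (k + 1),
      (h (leftPath k (Sum.inl i) 1) (leftPlane γ Φ K w (Sum.inl i) 1) -
        h (leftPath k (Sum.inl i) 0) (leftPlane γ Φ K w (Sum.inl i) 0) -
      (h (leftPath k (Sum.inr (Sum.inl i)) 1) (leftPlane γ Φ K w (Sum.inr (Sum.inl i)) 1) -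
        h (leftPath k (Sum.inr (Sum.inl i)) 0) (leftPlane γ Φ K w (Sum.inr (Sum.inl i)) 0))) =
      B i - A i := by
    intro i
    simp only [leftPath, leftPlane, Sum.elim_inl, Sum.elim_inr, transport_zero (hΦ i), e1, e2, A, B,
      hw]
    ring
  have h2 : ∀ i : Fin k,
      h (leftPath k (Sum.inr (Sum.inr i)) 1) (leftPlane γ Φ K w (Sum.inr (Sum.inr i)) 1) -
        h (leftPath k (Sum.inr (Sum.inr i)) 0) (leftPlane γ Φ K w (Sum.inr (Sum.inr i)) 0) =
      A i.succ - B i.castSucc := by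
    intro i
    have s1 : sub (2 * k + 1) (2 * (i.succ : ℕ)) 0 = sub (2 * k + 1) (2 * (i : ℕ) + 1) 1 :=
      sub_succ_zero _
    have s2 : sub (2 * k + 1) (2 * (i : ℕ) + 1) 0 = sub (2 * k + 1) (2 * (i.castSucc : ℕ)) 1 :=
      sub_succ_zero _
    simp only [leftPath, leftPlane, Sum.elim_inr, A, B, s1, s2]
    rfl
  rw [Finset.sum_congr rfl fun i _ => h1 i, Finset.sum_congr rfl fun i _ => h2 i,
    sum_telescope]
  have a0 : A 0 = h (0, 0) ((R 0).gauss (w (0, 0))) := by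
    simp only [A, Fin.val_zero, mul_zero, sub_zero_zero]
    rfl
  have b0 : B (Fin.last k) = h (0, 1) ((R (Fin.last (k + 1))).gauss (w (0, 1))) := by
    simp only [B, Fin.val_last, sub_last_one]
    rfl
  rw [a0, b0]

theorem isLagSec_leftPlane (hΦ : ∀ i, (γ i).IsLocalFlow (Φ i))
    (hK : ∀ i, (γ i).IsClosingPath (Φ i) (K i)) {H : C(𝕀 × 𝕀 × 𝕀, M)}
    (hc : ∀ a i t, H (a, 0, sub (2 * k + 1) (2 * ((i : Fin (k + 1)) : ℕ)) t) = (γ i).path t)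
    (ha : ∀ a i t, H (a, 0, sub (2 * k + 1) (2 * ((i : Fin k) : ℕ) + 1) t) ∈
      (R i.succ.castSucc).carrier) (j : Fin (k + 1) ⊕ Fin (k + 1) ⊕ Fin k) :
    IsLagSec lam (fun z : 𝕀 × 𝕀 => H (z.1, leftPath k j z.2))
      (fun z => leftPlane γ Φ K (fun y => H (z.1, y)) j z.2) := by
  rcases j with i | i | i
  · have h := (isLagSec_transport (hΦ i)).comp (σ := fun z : 𝕀 × 𝕀 => z.2) continuous_snd
    have e : (fun z : 𝕀 × 𝕀 => (γ i).path z.2) =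
        fun z : 𝕀 × 𝕀 => H (z.1, 0, sub (2 * k + 1) (2 * (i : ℕ)) z.2) :=
      funext fun z => (hc _ _ _).symm
    rw [e] at h
    exact h
  · have h := (hK i).isClosing.sec.comp (σ := fun z : 𝕀 × 𝕀 => z.2) continuous_snd
    have e : (fun _ : 𝕀 × 𝕀 => (γ i).path 1) =
        fun z : 𝕀 × 𝕀 => H (z.1, 0, sub (2 * k + 1) (2 * (i : ℕ)) 1) :=
      funext fun z => (hc _ _ _).symm
    rw [e] at h
    exact h
  · have hs := continuous_sub (2 * k + 1) (2 * (i : ℕ) + 1)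
    exact (R i.succ.castSucc).isLagSec_gauss
      (c := fun z : 𝕀 × 𝕀 => H (z.1, 0, sub (2 * k + 1) (2 * (i : ℕ) + 1) z.2)) (by fun_prop)
      fun z => ha _ _ _

section

variable {Φ₀ : ℝ → M → M} {K₀ : 𝕀 → Submodule ℝ (Model n)} (hΦ₀ : γ₀.IsLocalFlow Φ₀)
  (hK₀ : γ₀.IsClosingPath Φ₀ K₀) (hΦ : ∀ i, (γ i).IsLocalFlow (Φ i))
  (hK : ∀ i, (γ i).IsClosingPath (Φ i) (K i))
include hΦ₀ hK₀ hΦ hK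

/-- The index of a polygon may be computed with any local flows and closing paths. -/
theorem isPolygonIndex_iff [T2Space M] {u : Polygon R γ γ₀} {m : ℤ} :
    IsPolygonIndex u m ↔ ∃ (F : SymplecticFrame lam u.1) (r : Fin 4 → ℝ)
      (l : Fin (k + 1) ⊕ Fin (k + 1) ⊕ Fin k → ℝ),
      (∀ j, F.HasRotation (outerPath j) (outerPlane γ₀ Φ₀ K₀ u.1 j) (r j)) ∧
      (∀ j, F.HasRotation (leftPath k j) (leftPlane γ Φ K u.1 j) (l j)) ∧
      (m : ℝ) = r 0 + r 1 - r 2 - r 3 - ∑ j, leftSign k j * l j := by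
  constructor
  · rintro ⟨F, Φ₀', K₀', Φ', K', bottom, right, corner, top, chord, closing, arc, hΦ₀', hK₀', h',
      hb, hr, hc, ht, h1, h2, h3, hm⟩
    refine ⟨F, ![bottom, right, corner, top], Sum.elim chord (Sum.elim closing arc), ?_, ?_, ?_⟩
    · intro j
      fin_cases j
      · exact hb
      · rw [transport_congr hΦ₀' hΦ₀] at hr
        exact hr
      · exact closing_hasRotation hΦ₀ hK₀ hΦ₀' hK₀' (u.2.2.2.1 1) hc
      · exact ht
    · rintro (i | i | i)
      · have h := h1 i
        rw [transport_congr (h' i).1 (hΦ i)] at h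
        exact h
      · exact closing_hasRotation (hΦ i) (hK i) (h' i).1 (h' i).2 (u.2.2.2.2.1 i 1) (h2 i)
      · exact h3 i
    · rw [hm, leftSign_sum]
      simp only [Matrix.cons_val, Sum.elim_inl, Sum.elim_inr]
      ring
  · rintro ⟨F, r, l, hr, hl, hm⟩
    refine ⟨F, Φ₀, K₀, Φ, K, r 0, r 1, r 2, r 3, fun i => l (Sum.inl i),
      fun i => l (Sum.inr (Sum.inl i)), fun i => l (Sum.inr (Sum.inr i)), hΦ₀, hK₀,
      fun i => ⟨hΦ i, hK i⟩, hr 0, hr 1, hr 2, hr 3, fun i => hl (Sum.inl i),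
      fun i => hl (Sum.inr (Sum.inl i)), fun i => hl (Sum.inr (Sum.inr i)), ?_⟩
    rw [hm, leftSign_sum]
    ring

theorem polygon_rotation {u u' : Polygon R γ γ₀}
    (h : (Quotient.mk _ u : PolygonClass R γ γ₀) = Quotient.mk _ u')
    {F : SymplecticFrame lam u.1} {F' : SymplecticFrame lam u'.1} {r r' : Fin 4 → ℝ}
    {l l' : Fin (k + 1) ⊕ Fin (k + 1) ⊕ Fin k → ℝ}
    (hF : ∀ j, F.HasRotation (outerPath j) (outerPlane γ₀ Φ₀ K₀ u.1 j) (r j))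
    (hF' : ∀ j, F'.HasRotation (outerPath j) (outerPlane γ₀ Φ₀ K₀ u'.1 j) (r' j))
    (hl : ∀ j, F.HasRotation (leftPath k j) (leftPlane γ Φ K u.1 j) (l j))
    (hl' : ∀ j, F'.HasRotation (leftPath k j) (leftPlane γ Φ K u'.1 j) (l' j)) :
    (∃ m : ℤ, r 0 + r 1 - r 2 - r 3 - ∑ j, leftSign k j * l j = m) ∧
      r 0 + r 1 - r 2 - r 3 - ∑ j, leftSign k j * l j =
        r' 0 + r' 1 - r' 2 - r' 3 - ∑ j, leftSign k j * l' j := by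
  obtain ⟨H, hp, h0, h1⟩ := exists_homotopy h
  have e0 : (fun z => H (0, z)) = u.1 := funext h0
  have e1 : (fun z => H (1, z)) = u'.1 := funext h1
  exact boundary_rotation hΦ₀ hK₀ (H := H) (τ := leftPath k) (ε := leftSign k)
    (Q := fun j z => leftPlane γ Φ K (fun y => H (z.1, y)) j z.2)
    (fun a => (hp a).1) (fun a => (hp a).2.1) (fun a => (hp a).2.2.1) continuous_leftPath
    (isLagSec_leftPlane hΦ hK (fun a => (hp a).2.2.2.1) fun a => (hp a).2.2.2.2)
    (fun a φ => left_boundary hΦ hK (w := fun y => H (a, y)) (hp a).2.2.2.1 φ)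
    h0 h1 hF hF' (by simpa only [e0] using hl) (by simpa only [e1] using hl')

theorem exists_left_rotation (u : Polygon R γ γ₀) (F : SymplecticFrame lam u.1) :
    ∃ l : Fin (k + 1) ⊕ Fin (k + 1) ⊕ Fin k → ℝ,
      ∀ j, F.HasRotation (leftPath k j) (leftPlane γ Φ K u.1 j) (l j) := by
  have h := fun j => F.exists_hasRotation (continuous_leftPath j)
    ((isLagSec_leftPlane hΦ hK (H := u.1.comp ContinuousMap.snd) (fun _ => u.2.2.2.2.1)
      (fun _ => u.2.2.2.2.2) j).comp (σ := fun t => (0, t)) (by fun_prop))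
  choose l hl using h
  exact ⟨l, hl⟩

end

/-- The Maslov index of polygons is well defined. -/
theorem exists_polygonIndex [T2Space M] (hγ : ∀ i, (γ i).Nondegenerate) (hγ₀ : γ₀.Nondegenerate) :
    ∃ μ : PolygonClass R γ γ₀ → ℤ, ∀ (u : Polygon R γ γ₀) (m : ℤ),
      IsPolygonIndex u m ↔ μ (Quotient.mk _ u) = m := by
  obtain ⟨Φ₀, K₀, hΦ₀, hK₀⟩ := hγ₀.exists_closing
  choose Φ K hΦ hK using fun i => (hγ i).exists_closing
  refine exists_classFun (fun u => ?_) fun u u' m m' huu hm hm' => ?_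
  · obtain ⟨F⟩ := exists_symplecticFrame_square lam u.1
    obtain ⟨r, hr⟩ := exists_outer_rotation hΦ₀ hK₀ u.2.1 u.2.2.1 u.2.2.2.1 F
    obtain ⟨l, hl⟩ := exists_left_rotation hΦ₀ hK₀ hΦ hK u F
    obtain ⟨⟨m, hm⟩, -⟩ := polygon_rotation hΦ₀ hK₀ hΦ hK rfl hr hr hl hl
    exact ⟨m, (isPolygonIndex_iff hΦ₀ hK₀ hΦ hK).2 ⟨F, r, l, hr, hl, hm.symm⟩⟩
  · obtain ⟨F, r, l, hr, hl, hm⟩ := (isPolygonIndex_iff hΦ₀ hK₀ hΦ hK).1 hm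
    obtain ⟨F', r', l', hr', hl', hm'⟩ := (isPolygonIndex_iff hΦ₀ hK₀ hΦ hK).1 hm'
    have := (polygon_rotation hΦ₀ hK₀ hΦ hK huu hr hr' hl hl').2
    rw [← hm, ← hm'] at this
    exact_mod_cast this

end Polygons

/-! ### Gluing continuous maps over subintervals -/

section Strips

theorem coe_sub {N j : ℕ} (hj : j < N) (t : 𝕀) : (sub N j t : ℝ) = (j + t) / N := by
  have hN : (0 : ℝ) < N := by exact_mod_cast (Nat.zero_le j).trans_lt hj
  have h1 : (j : ℝ) + 1 ≤ N := by exact_mod_cast hj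
  have h2 := t.2.1
  have h3 := t.2.2
  have h4 : ((j : ℝ) + t) / N ∈ Icc (0 : ℝ) 1 :=
    ⟨by positivity, by rw [div_le_one hN]; linarith⟩
  rw [sub, projIcc_of_mem _ h4]

theorem exists_sub_eq {N : ℕ} (hN : 0 < N) (t : 𝕀) : ∃ j < N, ∃ s, sub N j s = t := by
  have hN' : (0 : ℝ) < N := by exact_mod_cast hN
  rcases eq_or_lt_of_le t.2.2 with h1 | h1
  · refine ⟨N - 1, by omega, 1, Subtype.ext ?_⟩
    rw [coe_sub (by omega), h1, Icc.coe_one]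
    have : ((N - 1 : ℕ) : ℝ) + 1 = N := by exact_mod_cast Nat.sub_add_cancel hN
    rw [this, div_self hN'.ne']
  · have h0 : 0 ≤ N * (t : ℝ) := mul_nonneg hN'.le t.2.1
    have hj : ⌊N * (t : ℝ)⌋₊ < N := by
      rw [Nat.floor_lt h0]
      nlinarith
    refine ⟨⌊N * (t : ℝ)⌋₊, hj, ⟨N * t - ⌊N * (t : ℝ)⌋₊, ?_, ?_⟩, Subtype.ext ?_⟩
    · have := Nat.floor_le h0
      linarith
    · have := Nat.lt_floor_add_one (N * (t : ℝ))
      linarith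
    · rw [coe_sub hj]
      field_simp
      ring

/-- Distinct subintervals meet only in common end points. -/
theorem sub_eq_sub {N j j' : ℕ} (hj : j < N) (hj' : j' < N) {t t' : 𝕀}
    (h : sub N j t = sub N j' t') (hle : j ≤ j') :
    (j = j' ∧ t = t') ∨ (j' = j + 1 ∧ t = 1 ∧ t' = 0) := by
  have hN : (N : ℝ) ≠ 0 := by
    have : N ≠ 0 := by omega
    exact_mod_cast this
  have h1 := congrArg (fun s : 𝕀 => (s : ℝ)) h
  simp only [coe_sub hj, coe_sub hj'] at h1
  have h2 : (j : ℝ) + t = j' + t' := by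
    rw [div_eq_div_iff hN hN] at h1
    exact mul_right_cancel₀ hN h1
  rcases eq_or_lt_of_le hle with h3 | h3
  · subst h3
    exact Or.inl ⟨rfl, Subtype.ext (by linarith)⟩
  · have h4 : (j : ℝ) + 1 ≤ j' := by exact_mod_cast h3
    have h5 := t.2.2
    have h6 := t'.2.1
    refine Or.inr ⟨?_, Subtype.ext (by rw [Icc.coe_one]; linarith),
      Subtype.ext (by rw [Icc.coe_zero]; linarith)⟩
    have h7 : (j' : ℝ) = j + 1 := by linarith
    exact_mod_cast h7

/-- Functions on the subintervals which agree at the common end points fit together. -/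
theorem exists_glue {A : Type*} {N : ℕ} (hN : 0 < N) (g : ℕ → 𝕀 → A)
    (h : ∀ j, j + 1 < N → g j 1 = g (j + 1) 0) :
    ∃ G : 𝕀 → A, ∀ j < N, ∀ t, G (sub N j t) = g j t := by
  choose J hJ S hS using exists_sub_eq hN
  have key : ∀ {j j' : ℕ} {t t' : 𝕀}, j < N → j' < N → j ≤ j' → sub N j t = sub N j' t' →
      g j t = g j' t' := by
    intro j j' t t' hj hj' hle he
    rcases sub_eq_sub hj hj' he hle with ⟨rfl, rfl⟩ | ⟨rfl, rfl, rfl⟩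
    · rfl
    · exact h j hj'
  refine ⟨fun t => g (J t) (S t), fun j hj t => ?_⟩
  rcases le_total (J (sub N j t)) j with hle | hle
  · exact key (hJ _) hj hle (hS _)
  · exact (key hj (hJ _) hle (hS _).symm).symm

/-- A function of `(y, t)` is continuous if it is so on each strip. -/
theorem continuous_of_sub {Y Z : Type*} [TopologicalSpace Y] [CompactSpace Y] [T2Space Y]
    [TopologicalSpace Z] {N : ℕ} (hN : 0 < N) {f : Y × 𝕀 → Z}
    (h : ∀ j < N, Continuous fun z : Y × 𝕀 => f (z.1, sub N j z.2)) : Continuous f := by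
  let q : Fin N × Y × 𝕀 → Y × 𝕀 := fun z => (z.2.1, sub N z.1 z.2.2)
  have hq : Continuous q := by
    rw [continuous_prod_of_discrete_left]
    intro j
    have := continuous_sub N j
    change Continuous fun z : Y × 𝕀 => (z.1, sub N j z.2)
    fun_prop
  have hqs : Function.Surjective q := by
    rintro ⟨y, t⟩
    obtain ⟨j, hj, s, rfl⟩ := exists_sub_eq hN t
    exact ⟨(⟨j, hj⟩, y, s), rfl⟩
  rw [(hq.isClosedMap.isQuotientMap hq hqs).continuous_iff, continuous_prod_of_discrete_left]
  exact fun j => h j j.2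

/-- The variant of `exists_glue` with separate functions on the even and the odd subintervals. -/
theorem exists_glue_alternating {A : Type*} {k : ℕ} (a : Fin (k + 1) → 𝕀 → A) (b : Fin k → 𝕀 → A)
    (h0 : ∀ i : Fin k, a i.castSucc 1 = b i 0) (h1 : ∀ i : Fin k, b i 1 = a i.succ 0) :
    ∃ G : 𝕀 → A, (∀ (i : Fin (k + 1)) t, G (sub (2 * k + 1) (2 * (i : ℕ)) t) = a i t) ∧
      ∀ (i : Fin k) t, G (sub (2 * k + 1) (2 * (i : ℕ) + 1) t) = b i t := by
  let g : ℕ → 𝕀 → A := fun j =>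
    if h : j % 2 = 0 ∧ j / 2 < k + 1 then a ⟨j / 2, h.2⟩
    else if h : j / 2 < k then b ⟨j / 2, h⟩ else a 0
  have ge : ∀ i : Fin (k + 1), g (2 * i) = a i := fun i => by
    have e : 2 * (i : ℕ) / 2 = i := by omega
    have h : (2 * (i : ℕ)) % 2 = 0 ∧ 2 * (i : ℕ) / 2 < k + 1 := ⟨by omega, by omega⟩
    simp only [g, dif_pos h, e]
  have go : ∀ i : Fin k, g (2 * i + 1) = b i := fun i => by
    have e : (2 * (i : ℕ) + 1) / 2 = i := by omega
    have h : ¬ ((2 * (i : ℕ) + 1) % 2 = 0 ∧ (2 * (i : ℕ) + 1) / 2 < k + 1) := by omega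
    simp only [g, dif_neg h, e]
    exact dif_pos i.2
  obtain ⟨G, hG⟩ := exists_glue (N := 2 * k + 1) (by omega) g fun j hj => by
    rcases Nat.even_or_odd' j with ⟨i, rfl | rfl⟩
    · have e0 := ge (⟨i, by omega⟩ : Fin k).castSucc
      have e1 := go ⟨i, by omega⟩
      simp only [Fin.val_castSucc] at e0 e1
      rw [e0, e1]
      exact h0 _
    · have e0 := ge (⟨i, by omega⟩ : Fin k).succ
      have e1 := go ⟨i, by omega⟩
      simp only [Fin.val_succ] at e0 e1
      rw [e1, show 2 * i + 1 + 1 = 2 * (i + 1) by ring, e0]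
      exact h1 _
  exact ⟨G, fun i t => by rw [hG _ (by omega), ge], fun i t => by rw [hG _ (by omega), go]⟩

theorem forall_sub_alternating {k : ℕ} {p : ℕ → Prop} (h0 : ∀ i : Fin (k + 1), p (2 * i))
    (h1 : ∀ i : Fin k, p (2 * i + 1)) : ∀ j < 2 * k + 1, p j := by
  intro j hj
  rcases Nat.even_or_odd' j with ⟨i, rfl | rfl⟩
  · exact h0 ⟨i, by omega⟩
  · exact h1 ⟨i, by omega⟩

theorem exists_sub_alternating (k : ℕ) (t : 𝕀) :
    (∃ (i : Fin (k + 1)) (s : 𝕀), sub (2 * k + 1) (2 * (i : ℕ)) s = t) ∨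
      ∃ (i : Fin k) (s : 𝕀), sub (2 * k + 1) (2 * (i : ℕ) + 1) s = t := by
  obtain ⟨j, hj, s, hs⟩ := exists_sub_eq (N := 2 * k + 1) (by omega) t
  rcases Nat.even_or_odd' j with ⟨i, rfl | rfl⟩
  · exact Or.inl ⟨⟨i, by omega⟩, s, hs⟩
  · exact Or.inr ⟨⟨i, by omega⟩, s, hs⟩

/-- The square retracts to the union of its bottom, right and top sides. -/
theorem exists_retraction : ∃ ρ : C(𝕀 × 𝕀, 𝕀 × 𝕀),
    (∀ z, (ρ z).1 = 1 ∨ (ρ z).2 = 0 ∨ (ρ z).2 = 1) ∧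
    ∀ z : 𝕀 × 𝕀, (z.1 = 1 ∨ z.2 = 0 ∨ z.2 = 1) → ρ z = z := by
  -- The radial projection from the point `(-1, 1/2)`, in the coordinates `x = s + 1` and
  -- `y = 2 t - 1`; the three sides are the part of the boundary on which `d = 1`.
  let d : 𝕀 × 𝕀 → ℝ := fun z => max (((z.1 : ℝ) + 1) / 2) |2 * (z.2 : ℝ) - 1|
  have hd : ∀ z, 0 < d z := fun z => lt_max_of_lt_left (by have := z.1.2.1; linarith)
  have hd1 : ∀ z, d z ≤ 1 := fun z => max_le (by have := z.1.2.2; linarith)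
    (abs_le.2 ⟨by have := z.2.2.1; linarith, by have := z.2.2.2; linarith⟩)
  have hdc : Continuous d := by fun_prop
  let x : 𝕀 × 𝕀 → ℝ := fun z => ((z.1 : ℝ) + 1) / d z - 1
  let y : 𝕀 × 𝕀 → ℝ := fun z => ((2 * (z.2 : ℝ) - 1) / d z + 1) / 2
  have hx : ∀ z, x z ∈ Icc (0 : ℝ) 1 := fun z => by
    have h0 := z.1.2.1
    have h1 : ((z.1 : ℝ) + 1) / 2 ≤ d z := le_max_left _ _
    constructor
    · simp only [x, sub_nonneg]
      rw [le_div_iff₀ (hd z)]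
      linarith [hd1 z]
    · simp only [x, sub_le_iff_le_add]
      rw [div_le_iff₀ (hd z)]
      linarith
  have hy : ∀ z, y z ∈ Icc (0 : ℝ) 1 := fun z => by
    have h1 : |2 * (z.2 : ℝ) - 1| ≤ d z := le_max_right _ _
    have h2 : |(2 * (z.2 : ℝ) - 1) / d z| ≤ 1 := by
      rw [abs_div, abs_of_pos (hd z), div_le_one (hd z)]
      exact h1
    obtain ⟨h3, h4⟩ := abs_le.1 h2
    constructor <;> simp only [y] <;> linarith
  refine ⟨⟨fun z => (⟨x z, hx z⟩, ⟨y z, hy z⟩), ?_⟩, fun z => ?_, fun z hz => ?_⟩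
  · have h1 : Continuous x := ((by fun_prop : Continuous fun z : 𝕀 × 𝕀 => (z.1 : ℝ) + 1).div hdc
      fun z => (hd z).ne').sub continuous_const
    have h2 : Continuous y :=
      (((by fun_prop : Continuous fun z : 𝕀 × 𝕀 => 2 * (z.2 : ℝ) - 1).div hdc
        fun z => (hd z).ne').add continuous_const).div_const 2
    exact (h1.subtype_mk _).prodMk (h2.subtype_mk _)
  · rcases max_choice (((z.1 : ℝ) + 1) / 2) |2 * (z.2 : ℝ) - 1| with h | h
    · refine Or.inl (Subtype.ext ?_)
      have h1 : d z = ((z.1 : ℝ) + 1) / 2 := h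
      have h2 := hd z
      change ((z.1 : ℝ) + 1) / d z - 1 = 1
      rw [h1] at h2 ⊢
      have h3 : (z.1 : ℝ) + 1 ≠ 0 := by linarith
      field_simp
      norm_num
    · right
      have h1 : d z = |2 * (z.2 : ℝ) - 1| := h
      have h2 := hd z
      rcases abs_choice (2 * (z.2 : ℝ) - 1) with h3 | h3
      · refine Or.inr (Subtype.ext ?_)
        change ((2 * (z.2 : ℝ) - 1) / d z + 1) / 2 = 1
        rw [h1, h3, div_self (by rw [← h3, ← h1]; exact h2.ne')]
        norm_num
      · refine Or.inl (Subtype.ext ?_)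
        change ((2 * (z.2 : ℝ) - 1) / d z + 1) / 2 = 0
        rw [h1, h3, div_neg, div_self (by
          rw [h1, h3] at h2
          linarith)]
        norm_num
  · have h1 : d z = 1 := by
      rcases hz with h | h | h
      · refine le_antisymm (hd1 z) (le_max_of_le_left ?_)
        rw [h]; norm_num
      · refine le_antisymm (hd1 z) (le_max_of_le_right ?_)
        rw [h]; norm_num
      · refine le_antisymm (hd1 z) (le_max_of_le_right ?_)
        rw [h]; norm_num
    refine Prod.ext (Subtype.ext ?_) (Subtype.ext ?_)
    · change ((z.1 : ℝ) + 1) / d z - 1 = z.1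
      rw [h1]; ring
    · change ((2 * (z.2 : ℝ) - 1) / d z + 1) / 2 = z.2
      rw [h1]; ring

/-- A map on three sides of the square extends to the square, with the same values. -/
theorem exists_fill {Z : Type*} [TopologicalSpace Z] (α β δ : C(𝕀, Z)) (hα : α 1 = δ 0)
    (hβ : β 1 = δ 1) : ∃ B : C(𝕀 × 𝕀, Z), (∀ s, B (s, 0) = α s) ∧ (∀ s, B (s, 1) = β s) ∧
      (∀ t, B (1, t) = δ t) ∧ ∀ z, B z ∈ range α ∪ range β ∪ range δ := by
  classical
  obtain ⟨ρ, hρ, hρ'⟩ := exists_retraction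
  let q : 𝕀 × 𝕀 → Z := fun z => if z.2 = 0 then α z.1 else if z.2 = 1 then β z.1 else δ z.2
  have q0 : ∀ z : 𝕀 × 𝕀, z.2 = 0 → q z = α z.1 := fun z hz => if_pos hz
  have q1 : ∀ z : 𝕀 × 𝕀, z.2 = 1 → q z = β z.1 := fun z hz => by
    simp only [q, hz, if_true, one_ne_zero, if_false]
  have q2 : ∀ z : 𝕀 × 𝕀, z.1 = 1 → q z = δ z.2 := fun z hz => by
    by_cases h0 : z.2 = 0
    · rw [q0 z h0, hz, h0, hα]
    · by_cases h1 : z.2 = 1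
      · rw [q1 z h1, hz, h1, hβ]
      · simp only [q, h0, h1, if_false]
  have c1 : IsClosed {z : 𝕀 × 𝕀 | z.1 = 1} := isClosed_eq continuous_fst continuous_const
  have c2 : IsClosed {z : 𝕀 × 𝕀 | z.2 = 0} := isClosed_eq continuous_snd continuous_const
  have c3 : IsClosed {z : 𝕀 × 𝕀 | z.2 = 1} := isClosed_eq continuous_snd continuous_const
  have hq : ContinuousOn q ({z | z.1 = 1} ∪ ({z | z.2 = 0} ∪ {z | z.2 = 1})) := by
    refine ContinuousOn.union_of_isClosed ?_ (ContinuousOn.union_of_isClosed ?_ ?_ c2 c3) c1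
      (c2.union c3)
    · exact (δ.continuous.comp continuous_snd).continuousOn.congr q2
    · exact (α.continuous.comp continuous_fst).continuousOn.congr q0
    · exact (β.continuous.comp continuous_fst).continuousOn.congr q1
  refine ⟨⟨fun z => q (ρ z), hq.comp_continuous ρ.continuous hρ⟩, fun s => ?_, fun s => ?_,
    fun t => ?_, fun z => ?_⟩
  · change q (ρ (s, 0)) = α s
    rw [hρ' _ (by simp), q0 _ rfl]
  · change q (ρ (s, 1)) = β s
    rw [hρ' _ (by simp), q1 _ rfl]
  · change q (ρ (1, t)) = δ t
    rw [hρ' _ (by simp), q2 _ rfl]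
  · change q (ρ z) ∈ _
    rcases hρ z with h | h | h
    · rw [q2 _ h]; exact Or.inr ⟨_, rfl⟩
    · rw [q0 _ h]; exact Or.inl (Or.inl ⟨_, rfl⟩)
    · rw [q1 _ h]; exact Or.inl (Or.inr ⟨_, rfl⟩)

end Strips

/-! ### Gluing of bounding squares and polygons -/

section Gluing

open Matrix

variable {n : ℕ} {M : Type*} [TopologicalSpace M] [ChartedSpace (Model n) M]
  [IsManifold (𝓡 (2 * n + 1)) ∞ M] {lam : ContactForm n M}

namespace SymplecticFrame

variable {X : Type*} [TopologicalSpace X] {w : X → M} (F : SymplecticFrame lam w)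

/-- The vector of `ξ` with given complex coordinates. -/
def ofCoord (z : X) (y : Fin n → ℂ) : Model n :=
  ∑ i, ((y i).re • F.ev i z + (y i).im • F.fv i z)

theorem zc_ofCoord (z : X) (y : Fin n → ℂ) (i : Fin n) : F.zc z i (F.ofCoord z y) = y i := by
  have he : ∀ j, F.zc z i (F.ev j z) = if i = j then 1 else 0 := fun j => by
    rw [zc, F.omegaAt_ev_ev, F.omegaAt_ev_fv]
    by_cases h : i = j
    · simp [h]
    · simp [h, Ne.symm h]
  have hf : ∀ j, F.zc z i (F.fv j z) = if i = j then Complex.I else 0 := fun j => by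
    rw [zc, F.omegaAt_fv_fv, F.omegaAt_ev_fv]
    by_cases h : i = j <;> simp [h]
  rw [ofCoord, F.zc_sum]
  simp only [F.zc_add, F.zc_smul, he, hf, mul_ite, mul_one, mul_zero, Finset.sum_add_distrib,
    Finset.sum_ite_eq, Finset.mem_univ, if_true]
  exact Complex.re_add_im (y i)

theorem ofCoord_zc {z : X} {v : Model n} (hv : lam.lamAt (w z) v = 0) :
    F.ofCoord z (fun i => F.zc z i v) = v := by
  refine Eq.trans ?_ (F.eq_sum hv).symm
  simp [ofCoord, zc]

/-- A family of Lagrangian planes whose Souriau matrix is continuous is a continuous section: the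
projection `z ↦ (z + U z̄) / 2` onto the plane with Souriau matrix `U` carries a basis of one plane
to bases of the nearby planes. -/
theorem isLagSec_of_continuous {P : X → Plane n M}
    (hP : ∀ z, (P z).1 = w z ∧ lam.IsLagrangian (P z).1 (P z).2)
    (hU : Continuous fun z => F.souriau z (P z).2) (hw : Continuous w) : IsLagSec lam w P := by
  refine ⟨hP, fun z₀ => ?_⟩
  have hPl : ∀ z, P z = plane (w z) (P z).2 := fun z => by
    have h := (hP z).1
    generalize P z = Q at h ⊢
    obtain ⟨x, V⟩ := Q
    subst h
    rfl
  have hL : ∀ z, lam.IsLagrangian (w z) (P z).2 := fun z => by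
    have h := (hP z).2
    rw [hPl z] at h
    exact h
  obtain ⟨b, hb⟩ := exists_basis (hL z₀)
  set Z₀ := F.zmat z₀ b
  let Z : X → CMat n := fun z => (2 : ℂ)⁻¹ • (Z₀ + F.souriau z (P z).2 * mconj Z₀)
  have hZc : Continuous Z := by
    have h1 : Continuous fun z => Z₀ + F.souriau z (P z).2 * mconj Z₀ :=
      continuous_const.add (hU.mul continuous_const)
    exact h1.const_smul (2 : ℂ)⁻¹
  have hZ0 : Z z₀ = Z₀ := by
    have h1 := F.souriau_mul_mconj (v := b) (z := z₀) (by
      exact Eq.subst (motive := fun V : Submodule ℝ (Model n) => lam.IsLagrangian (w z₀) V)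
        hb.symm (hL z₀))
    rw [hb] at h1
    simp only [Z, h1, Z₀]
    rw [← two_smul ℂ, smul_smul, inv_mul_cancel₀ two_ne_zero, one_smul]
  have hd0 : (Z z₀).det ≠ 0 := by
    rw [hZ0]
    exact F.det_zmat_ne_zero
      (Eq.subst (motive := fun V : Submodule ℝ (Model n) => lam.IsLagrangian (w z₀) V)
        hb.symm (hL z₀))
  have hev : ∀ᶠ z in 𝓝 z₀, (Z z).det ≠ 0 :=
    hZc.matrix_det.continuousAt.eventually (isOpen_ne.mem_nhds hd0)
  refine ⟨_, hev, fun j z => F.ofCoord z fun i => Z z i j, fun j => ?_, fun z hz => ?_⟩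
  · refine IsField.mono (S := univ) ?_ (subset_univ _)
    refine IsField.sum _ hw.continuousOn fun i _ => ?_
    have hij : Continuous fun z => Z z i j :=
      (continuous_apply j).comp ((continuous_apply i).comp hZc)
    exact ((F.isField_ev i).smul (Complex.continuous_re.comp hij).continuousOn).add
      ((F.isField_fv i).smul (Complex.continuous_im.comp hij).continuousOn)
  · refine (hPl z).trans (plane_inj.2 ⟨rfl, ?_⟩)
    have hLz := hL z
    obtain ⟨c, hc⟩ := exists_basis (hL z)
    have hmem : ∀ j, F.ofCoord z (fun i => Z z i j) ∈ (P z).2 := by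
      intro j
      rw [← hc] at hLz
      have hcd := F.det_zmat_ne_zero hLz
      have hU := F.souriau_eq (v := c) hLz rfl
      have hUm : mconj (F.zmat z c) * (mconj (F.zmat z c))⁻¹ = 1 :=
        mul_nonsing_inv _ (Ne.isUnit (by rw [det_mconj]; exact conj_ne_zero hcd))
      set C := F.zmat z c
      set x : CMat n := C⁻¹ * Z₀
      have hx : Z₀ = C * x := (mul_nonsing_inv_cancel_left _ _ (Ne.isUnit hcd)).symm
      have h1 : Z z = C * ((2 : ℂ)⁻¹ • (x + mconj x)) := by
        have h2 : F.souriau z (P z).2 * mconj Z₀ = C * mconj x := by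
          rw [← hc, hU, hx, mconj_mul, Matrix.mul_assoc, ← Matrix.mul_assoc (mconj C)⁻¹,
            nonsing_inv_mul _ (Ne.isUnit (by rw [det_mconj]; exact conj_ne_zero hcd)),
            Matrix.one_mul]
        simp only [Z]
        rw [h2, mul_smul_comm, mul_add, ← hx]
      have h3 : F.ofCoord z (fun i => Z z i j) = ∑ l, (x l j).re • c l := by
        have hl : lam.lamAt (w z) (∑ l, (x l j).re • c l) = 0 := by
          refine (isLagrangian_iff.1 hLz).1 _ (Submodule.sum_mem _ fun l _ =>
            Submodule.smul_mem _ _ (Submodule.subset_span ⟨l, rfl⟩))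
        rw [← F.ofCoord_zc hl]
        congr 1
        funext i
        rw [h1, mul_apply, F.zc_sum]
        refine Finset.sum_congr rfl fun l _ => ?_
        rw [F.zc_smul, Matrix.smul_apply, Matrix.add_apply, mconj, map_apply, Complex.add_conj,
          mul_comm]
        simp only [smul_eq_mul, C, zmat_apply]
        push_cast
        ring
      rw [h3, ← hc]
      exact Submodule.sum_mem _ fun l _ => Submodule.smul_mem _ _ (Submodule.subset_span ⟨l, rfl⟩)
    have hli : LinearIndependent ℝ fun j => F.ofCoord z fun i => Z z i j := by
      rw [Fintype.linearIndependent_iff]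
      intro a ha
      have h1 : Z z *ᵥ (fun j => (a j : ℂ)) = 0 := by
        funext i
        have h2 := congrArg (F.zc z i) ha
        rw [F.zc_sum] at h2
        simp only [F.zc_smul, F.zc_ofCoord] at h2
        have h3 : F.zc z i 0 = 0 := by simp [zc]
        rw [h3] at h2
        change ∑ j, Z z i j * (a j : ℂ) = 0
        rw [← h2]
        exact Finset.sum_congr rfl fun j _ => mul_comm (Z z i j) (a j : ℂ)
      intro j
      have h4 := congrFun (eq_zero_of_mulVec_eq_zero hz h1) j
      exact Complex.ofReal_eq_zero.1 h4
    exact (span_eq_of_finrank hli hmem (isLagrangian_iff.1 (hL z)).2.2).symm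

end SymplecticFrame

theorem exists_symplecticFrame_path (lam : ContactForm n M) (c : C(𝕀, M)) :
    Nonempty (SymplecticFrame lam c) := by
  obtain ⟨F⟩ := exists_symplecticFrame_square lam (c.comp ContinuousMap.fst)
  exact ⟨F.pull ⟨fun t => (t, 0), by fun_prop⟩⟩

/-- Sections of the Lagrangian Grassmannian over subintervals fit together. -/
theorem isLagSec_of_sub {c : C(𝕀, M)} {P : 𝕀 → Plane n M} {N : ℕ} (hN : 0 < N)
    (h : ∀ j < N, IsLagSec lam (fun t => c (sub N j t)) fun t => P (sub N j t)) :
    IsLagSec lam c P := by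
  obtain ⟨F⟩ := exists_symplecticFrame_path lam c
  refine F.isLagSec_of_continuous (fun t => ?_) ?_ c.continuous
  · obtain ⟨j, hj, s, rfl⟩ := exists_sub_eq hN t
    exact (h j hj).1 s
  · have h1 : Continuous fun z : Unit × 𝕀 => F.souriau z.2 (P z.2).2 :=
      continuous_of_sub hN fun j hj =>
        (F.continuous_souriau (continuous_sub N j) (h j hj)).comp continuous_snd
    exact h1.comp (by fun_prop : Continuous fun t : 𝕀 => ((), t))

variable {k : ℕ} {R : Fin (k + 2) → Legendrian lam}
  {ℓ : ∀ i : Fin (k + 1), GradedBridge (R i.castSucc) (R i.succ)}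
  {γ : ∀ i : Fin (k + 1), ReebChord (R i.castSucc) (R i.succ)}
  {γ₀ : ReebChord (R 0) (R (Fin.last (k + 1)))}

/-- Bounding squares and a polygon can be glued. The left side of the result is the concatenation of
the bridges with arcs in the Legendrian submanifolds. -/
theorem exists_gluing (w : ∀ i, Square (ℓ i) (γ i)) (u : Polygon R γ γ₀) :
    ∃ (ℓ₀ : GradedBridge (R 0) (R (Fin.last (k + 1)))) (W : Square ℓ₀ γ₀), IsGluing w u W := by
  -- The strips between the squares are filled inside the Legendrian submanifolds.
  have hfill : ∀ i : Fin k, ∃ B : C(𝕀 × 𝕀, M), (∀ s, B (s, 0) = (w i.castSucc).1 (s, 1)) ∧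
      (∀ s, B (s, 1) = (w i.succ).1 (s, 0)) ∧
      (∀ t, B (1, t) = u.1 (0, sub (2 * k + 1) (2 * (i : ℕ) + 1) t)) ∧
      ∀ z, B z ∈ (R i.succ.castSucc).carrier := by
    intro i
    have hs := continuous_sub (2 * k + 1) (2 * (i : ℕ) + 1)
    have e1 := u.2.2.2.2.1 i.castSucc 1
    have e2 := u.2.2.2.2.1 i.succ 0
    rw [Fin.val_castSucc, ← sub_succ_zero] at e1
    rw [Fin.val_succ, mul_add, mul_one, sub_succ_zero] at e2
    obtain ⟨B, h0, h1, h2, h3⟩ := exists_fill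
      (⟨fun s => (w i.castSucc).1 (s, 1), by fun_prop⟩ : C(𝕀, M))
      ⟨fun s => (w i.succ).1 (s, 0), by fun_prop⟩
      ⟨fun t => u.1 (0, sub (2 * k + 1) (2 * (i : ℕ) + 1) t), by fun_prop⟩
      (((w i.castSucc).2.2.2.2 1).trans e1.symm) (((w i.succ).2.2.2.2 0).trans e2.symm)
    refine ⟨B, h0, h1, h2, fun z => ?_⟩
    rcases h3 z with (⟨s, hs⟩ | ⟨s, hs⟩) | ⟨t, ht⟩
    · rw [← hs]; exact (w i.castSucc).2.2.1 s
    · rw [← hs]; exact (w i.succ).2.1 s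
    · rw [← ht]; exact u.2.2.2.2.2 i t
  -- `L t s` is the left half of the glued square, and `G s t` the whole square.
  choose B hB0 hB1 hB2 hBR using hfill
  obtain ⟨L, hLe, hLo⟩ := exists_glue_alternating (k := k) (fun i t s => (w i).1 (s, t))
    (fun i t s => B i (s, t)) (fun i => funext fun s => (hB0 i s).symm)
    (fun i => funext fun s => hB1 i s)
  have hLe' : ∀ i t s, L (sub (2 * k + 1) (2 * ((i : Fin (k + 1)) : ℕ)) t) s = (w i).1 (s, t) :=
    fun i t s => congrFun (hLe i t) s
  have hLo' : ∀ i t s, L (sub (2 * k + 1) (2 * ((i : Fin k) : ℕ) + 1) t) s = B i (s, t) :=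
    fun i t s => congrFun (hLo i t) s
  have hLu : ∀ t, L t 1 = u.1 (0, t) := fun t => by
    rcases exists_sub_alternating k t with ⟨i, s, rfl⟩ | ⟨i, s, rfl⟩
    · rw [hLe', (w i).2.2.2.2, u.2.2.2.2.1]
    · rw [hLo', hB2]
  obtain ⟨G, hG⟩ := exists_glue (N := 2) two_pos
    (fun j s t => if j = 0 then L t s else u.1 (s, t)) fun j hj => by
      obtain rfl : j = 0 := by omega
      exact funext hLu
  have hG0 : ∀ s t, G (sub 2 0 s) t = L t s := fun s t => congrFun (hG 0 two_pos s) t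
  have hG1 : ∀ s t, G (sub 2 1 s) t = u.1 (s, t) := fun s t => congrFun (hG 1 one_lt_two s) t
  have hLc : Continuous fun z : 𝕀 × 𝕀 => L z.2 z.1 := by
    refine continuous_of_sub (N := 2 * k + 1) (by omega) (forall_sub_alternating (fun i => ?_)
      fun i => ?_)
    · exact (w i).1.continuous.congr fun z => (hLe' i z.2 z.1).symm
    · exact (B i).continuous.congr fun z => (hLo' i z.2 z.1).symm
  have hGc : Continuous fun z : 𝕀 × 𝕀 => G z.2 z.1 := by
    refine continuous_of_sub two_pos fun j hj => ?_
    interval_cases j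
    · exact (hLc.comp continuous_swap).congr fun z => (hG0 z.2 z.1).symm
    · exact (u.1.continuous.comp continuous_swap).congr fun z => (hG1 z.2 z.1).symm
  let W : C(𝕀 × 𝕀, M) := ⟨fun z => G z.1 z.2, hGc.comp continuous_swap⟩
  have hW0 : ∀ s t, W (sub 2 0 s, t) = L t s := hG0
  have hW1 : ∀ s t, W (sub 2 1 s, t) = u.1 (s, t) := hG1
  have s00 : ∀ N, sub N 0 0 = 0 := sub_zero_zero
  have s11 : sub 2 1 1 = 1 := sub_last_one 1
  have hL0 : ∀ s, L 0 s = (w 0).1 (s, 0) := fun s => by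
    have h := hLe' 0 0 s
    rwa [Fin.val_zero, mul_zero, s00] at h
  have hL1 : ∀ s, L 1 s = (w (Fin.last k)).1 (s, 1) := fun s => by
    have h := hLe' (Fin.last k) 1 s
    rwa [Fin.val_last, sub_last_one] at h
  have hWl : ∀ t, W (0, t) = L t 0 := fun t => by
    have h := hW0 0 t
    rwa [s00] at h
  have hbot : ∀ s, W (s, 0) ∈ (R 0).carrier := fun s => by
    obtain ⟨j, hj, s, rfl⟩ := exists_sub_eq two_pos s
    interval_cases j
    · rw [hW0, hL0]; exact (w 0).2.1 s
    · rw [hW1]; exact u.2.1 s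
  have htop : ∀ s, W (s, 1) ∈ (R (Fin.last (k + 1))).carrier := fun s => by
    obtain ⟨j, hj, s, rfl⟩ := exists_sub_eq two_pos s
    interval_cases j
    · rw [hW0, hL1]; exact (w (Fin.last k)).2.2.1 s
    · rw [hW1]; exact u.2.2.1 s
  have hright : ∀ t, W (1, t) = γ₀.path t := fun t => by
    have h := hW1 1 t
    rw [s11] at h
    rw [h, u.2.2.2.1]
  have hBl0 : ∀ i, B i (0, 0) = (ℓ i.castSucc).path 1 := fun i =>
    (hB0 i 0).trans ((w i.castSucc).2.2.2.1 1)
  have hBl1 : ∀ i, B i (0, 1) = (ℓ i.succ).path 0 := fun i =>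
    (hB1 i 0).trans ((w i.succ).2.2.2.1 0)
  -- The grading of the composite bridge over the left side.
  obtain ⟨P, hPe, hPo⟩ := exists_glue_alternating (k := k) (fun i t => (ℓ i).grading t)
    (fun i t => (R i.succ.castSucc).gauss (B i (0, t)))
    (fun i => by rw [hBl0]; exact (ℓ i.castSucc).grading_one)
    (fun i => by rw [hBl1]; exact (ℓ i.succ).grading_zero.symm)
  let c : C(𝕀, M) := ⟨fun t => W (0, t), by fun_prop⟩
  have hce : ∀ i t, c (sub (2 * k + 1) (2 * ((i : Fin (k + 1)) : ℕ)) t) = (ℓ i).path t := fun i t =>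
    (hWl _).trans ((hLe' i t 0).trans ((w i).2.2.2.1 t))
  have hco : ∀ i t, c (sub (2 * k + 1) (2 * ((i : Fin k) : ℕ) + 1) t) = B i (0, t) := fun i t =>
    (hWl _).trans (hLo' i t 0)
  have hsec : IsLagSec lam c P := by
    refine isLagSec_of_sub (N := 2 * k + 1) (by omega) (forall_sub_alternating (fun i => ?_)
      fun i => ?_)
    · simp only [hce, hPe]
      exact (ℓ i).isSection
    · simp only [hco, hPo]
      exact (R i.succ.castSucc).isLagSec_gauss (c := fun t => B i (0, t)) (by fun_prop)
        fun t => hBR i _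
  have hc0 : c 0 = (ℓ 0).path 0 := by
    have h := hce 0 0
    rwa [Fin.val_zero, mul_zero, s00] at h
  have hc1 : c 1 = (ℓ (Fin.last k)).path 1 := by
    have h := hce (Fin.last k) 1
    rwa [Fin.val_last, sub_last_one] at h
  have hP0 : P 0 = (ℓ 0).grading 0 := by
    have h := hPe 0 0
    rwa [Fin.val_zero, mul_zero, s00] at h
  have hP1 : P 1 = (ℓ (Fin.last k)).grading 1 := by
    have h := hPe (Fin.last k) 1
    rwa [Fin.val_last, sub_last_one] at h
  refine ⟨⟨c, hbot 0, htop 0, P, hsec, ?_, ?_⟩, ⟨W, hbot, htop, fun _ => rfl, hright⟩,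
    ⟨fun i t => ⟨hce i t, hPe i t⟩, fun i t => ⟨?_, ?_⟩⟩, hW1, fun i s t => ?_, fun i s t => ?_⟩
  · rw [hP0, hc0]; exact (ℓ 0).grading_zero
  · rw [hP1, hc1]; exact (ℓ (Fin.last k)).grading_one
  · change c _ ∈ _
    rw [hco]; exact hBR i _
  · change P _ = (R i.succ.castSucc).gauss (c _)
    rw [hPo, hco]
  · exact (hW0 _ _).trans (hLe' _ _ _)
  · change W _ ∈ _
    rw [hW0, hLo']; exact hBR i _

end Gluing

/-! ### Additivity of the index -/

section Additivity

variable {n : ℕ} {M : Type*} [TopologicalSpace M] [ChartedSpace (Model n) M]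
  [IsManifold (𝓡 (2 * n + 1)) ∞ M] {lam : ContactForm n M}

/-- The index of a square in a given frame, where the square is given as a map that equals it. -/
theorem squareIndex_eq [T2Space M] {R R' : Legendrian lam} {ℓ : GradedBridge R R'}
    {γ : ReebChord R R'} {Φ : ℝ → M → M} {K : 𝕀 → Submodule ℝ (Model n)}
    (hΦ : γ.IsLocalFlow Φ) (hK : γ.IsClosingPath Φ K) {w : Square ℓ γ} {m : ℤ}
    (hm : IsSquareIndex w m) {w' : 𝕀 × 𝕀 → M} (hw : w' = w.1) {F : SymplecticFrame lam w'}
    {r : Fin 4 → ℝ} {l : ℝ} (hr : ∀ j, F.HasRotation (outerPath j) (outerPlane γ Φ K w' j) (r j))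
    (hl : F.HasRotation (fun t => (0, t)) ℓ.grading l) : (m : ℝ) = r 0 + r 1 - r 2 - r 3 - l := by
  subst hw
  obtain ⟨F', r', l', hr', hl', hm'⟩ := (isSquareIndex_iff hΦ hK).1 hm
  rw [hm', (square_rotation hΦ hK rfl hr' hr hl' hl).2]

variable {k : ℕ} {R : Fin (k + 2) → Legendrian lam}
  {ℓ : ∀ i : Fin (k + 1), GradedBridge (R i.castSucc) (R i.succ)}
  {γ : ∀ i : Fin (k + 1), ReebChord (R i.castSucc) (R i.succ)}
  {ℓ₀ : GradedBridge (R 0) (R (Fin.last (k + 1)))}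
  {γ₀ : ReebChord (R 0) (R (Fin.last (k + 1)))}

/-- The index of a polygon in a given frame, where the polygon is given as a map that equals it. -/
theorem polygonIndex_eq [T2Space M] {Φ₀ : ℝ → M → M} {K₀ : 𝕀 → Submodule ℝ (Model n)}
    {Φ : Fin (k + 1) → ℝ → M → M} {K : Fin (k + 1) → 𝕀 → Submodule ℝ (Model n)}
    (hΦ₀ : γ₀.IsLocalFlow Φ₀) (hK₀ : γ₀.IsClosingPath Φ₀ K₀) (hΦ : ∀ i, (γ i).IsLocalFlow (Φ i))
    (hK : ∀ i, (γ i).IsClosingPath (Φ i) (K i)) {u : Polygon R γ γ₀} {m : ℤ}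
    (hm : IsPolygonIndex u m) {w' : 𝕀 × 𝕀 → M} (hw : w' = u.1) {F : SymplecticFrame lam w'}
    {r : Fin 4 → ℝ} {l : Fin (k + 1) ⊕ Fin (k + 1) ⊕ Fin k → ℝ}
    (hr : ∀ j, F.HasRotation (outerPath j) (outerPlane γ₀ Φ₀ K₀ w' j) (r j))
    (hl : ∀ j, F.HasRotation (leftPath k j) (leftPlane γ Φ K w' j) (l j)) :
    (m : ℝ) = r 0 + r 1 - r 2 - r 3 - ∑ j, leftSign k j * l j := by
  subst hw
  obtain ⟨F', r', l', hr', hl', hm'⟩ := (isPolygonIndex_iff hΦ₀ hK₀ hΦ hK).1 hm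
  rw [hm', (polygon_rotation hΦ₀ hK₀ hΦ hK rfl hr' hr hl' hl).2]

/-- The rotation along a path is the sum of the rotations along its halves. -/
theorem rotation_halves {X : Type*} [TopologicalSpace X] {w : X → M} {F : SymplecticFrame lam w}
    {σ : 𝕀 → X} {P : 𝕀 → Plane n M} (hP : IsLagSec lam (fun t => w (σ t)) P) {r a b : ℝ}
    (h : F.HasRotation σ P r)
    (ha : F.HasRotation (fun t => σ (sub 2 0 t)) (fun t => P (sub 2 0 t)) a)
    (hb : F.HasRotation (fun t => σ (sub 2 1 t)) (fun t => P (sub 2 1 t)) b) : r = a + b := by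
  obtain ⟨θ, hθ, rfl⟩ := h
  have c0 := continuous_sub 2 0
  have c1 := continuous_sub 2 1
  have h0 := ha.eq_sub (hP.comp c0) (θ := fun t => θ (sub 2 0 t)) (by fun_prop) fun t => hθ _
  have h1 := hb.eq_sub (hP.comp c1) (θ := fun t => θ (sub 2 1 t)) (by fun_prop) fun t => hθ _
  rw [sub_zero_zero] at h0
  rw [sub_succ_zero, show sub 2 1 1 = 1 from sub_last_one 1] at h1
  rw [h0, h1]
  ring

/-- Additivity of the Maslov index under gluing. All rotations are computed in one frame over the
glued square. -/
theorem index_gluing [T2Space M] (hγ : ∀ i, (γ i).Nondegenerate) (hγ₀ : γ₀.Nondegenerate)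
    {w : ∀ i, Square (ℓ i) (γ i)} {u : Polygon R γ γ₀} {W : Square ℓ₀ γ₀} (hW : IsGluing w u W)
    {a : Fin (k + 1) → ℤ} {b c : ℤ} (ha : ∀ i, IsSquareIndex (w i) (a i)) (hb : IsPolygonIndex u b)
    (hc : IsSquareIndex W c) : ∑ i, a i + b = c := by
  obtain ⟨Φ₀, K₀, hΦ₀, hK₀⟩ := hγ₀.exists_closing
  choose Φ K hΦ hK using fun i => (hγ i).exists_closing
  obtain ⟨⟨hbe, hbo⟩, hWu, hWw, hWo⟩ := hW
  obtain ⟨F⟩ := exists_symplecticFrame_square lam W.1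
  have cs := continuous_sub
  have s11 : sub 2 1 1 = 1 := sub_last_one 1
  have s00 : ∀ N, sub N 0 0 = 0 := sub_zero_zero
  have s10 : sub 2 1 0 = sub 2 0 1 := sub_succ_zero 0
  -- The domains of the polygon and of the squares inside the domain of the glued square.
  let τ : C(𝕀 × 𝕀, 𝕀 × 𝕀) := ⟨fun z => (sub 2 1 z.1, z.2), by
    have := cs 2 1; fun_prop⟩
  let σ : Fin (k + 1) → C(𝕀 × 𝕀, 𝕀 × 𝕀) := fun i =>
    ⟨fun z => (sub 2 0 z.1, sub (2 * k + 1) (2 * (i : ℕ)) z.2), by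
      have := cs 2 0; have := cs (2 * k + 1) (2 * (i : ℕ)); fun_prop⟩
  have eu : ⇑(W.1.comp τ) = u.1 := funext fun z => hWu _ _
  have ew : ∀ i, ⇑(W.1.comp (σ i)) = (w i).1 := fun i => funext fun z => hWw _ _ _
  let Fu : SymplecticFrame lam (W.1.comp τ) := F.pull τ
  let Fw : ∀ i, SymplecticFrame lam (W.1.comp (σ i)) := fun i => F.pull (σ i)
  obtain ⟨rW, hrW⟩ := exists_outer_rotation hΦ₀ hK₀ W.2.1 W.2.2.1 W.2.2.2.2 F
  obtain ⟨ru, hru⟩ := exists_outer_rotation hΦ₀ hK₀ (w := W.1.comp τ)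
    (fun s => by rw [eu]; exact u.2.1 s) (fun s => by rw [eu]; exact u.2.2.1 s)
    (fun t => by rw [eu]; exact u.2.2.2.1 t) Fu
  have hex := fun i => exists_outer_rotation (hΦ i) (hK i) (w := W.1.comp (σ i))
    (fun s => by rw [ew]; exact (w i).2.1 s) (fun s => by rw [ew]; exact (w i).2.2.1 s)
    (fun t => by rw [ew]; exact (w i).2.2.2.2 t) (Fw i)
  choose rw' hrw using hex
  -- Rotations along the pieces of the left side of the polygon.
  have hWc : ∀ (i : Fin (k + 1)) t, W.1 (sub 2 0 1, sub (2 * k + 1) (2 * (i : ℕ)) t) =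
      (γ i).path t := fun i t => (hWw i 1 t).trans ((w i).2.2.2.2 t)
  have hlex : ∀ j, ∃ l, Fu.HasRotation (leftPath k j) (leftPlane γ Φ K (W.1.comp τ) j) l := by
    intro j
    refine Fu.exists_hasRotation (continuous_leftPath j) ?_
    have h := isLagSec_leftPlane hΦ hK (H := (W.1.comp τ).comp ContinuousMap.snd)
      (fun _ i t => by
        change (W.1.comp τ) _ = _
        rw [eu]; exact u.2.2.2.2.1 i t)
      (fun _ i t => by
        change (W.1.comp τ) _ ∈ _
        rw [eu]; exact u.2.2.2.2.2 i t) j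
    exact h.comp (σ := fun t => (0, t)) (by fun_prop)
  choose lu hlu using hlex
  -- The phase along the left side of the glued square.
  have hsec : IsLagSec lam (fun t => W.1 (0, t)) ℓ₀.grading := by
    have e : (fun t => W.1 (0, t)) = ℓ₀.path := funext W.2.2.2.1
    rw [e]
    exact ℓ₀.isSection
  obtain ⟨θ, hθ⟩ := F.exists_phase_along (σ := fun t => (0, t)) (by fun_prop) hsec
  have hlW : F.HasRotation (fun t => (0, t)) ℓ₀.grading (θ 1 - θ 0) := ⟨θ, hθ, rfl⟩
  let B : Fin (k + 1) → ℝ := fun i => θ (sub (2 * k + 1) (2 * (i : ℕ)) 1)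
  let A : Fin (k + 1) → ℝ := fun i => θ (sub (2 * k + 1) (2 * (i : ℕ)) 0)
  have hlw : ∀ i, (Fw i).HasRotation (fun t => (0, t)) (ℓ i).grading (B i - A i) := by
    intro i
    have := cs (2 * k + 1) (2 * (i : ℕ))
    refine ⟨⟨fun t => θ (sub (2 * k + 1) (2 * (i : ℕ)) t), by fun_prop⟩, fun t => ?_, rfl⟩
    have h := hθ (sub (2 * k + 1) (2 * (i : ℕ)) t)
    have h2 := (hbe i t).2
    rw [← h2]
    change F.HasPhase (sub 2 0 0, _) _ _
    rw [s00]
    exact h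
  have i1 := fun i => squareIndex_eq (hΦ i) (hK i) (ha i) (ew i) (hrw i) (hlw i)
  have i2 := polygonIndex_eq hΦ₀ hK₀ hΦ hK hb eu hru hlu
  have i3 := squareIndex_eq hΦ₀ hK₀ hc rfl hrW hlW
  have hbotW : IsLagSec lam (fun s => W.1 (s, 0)) fun s => (R 0).gauss (W.1 (s, 0)) :=
    (R 0).isLagSec_gauss (c := fun s => W.1 (s, 0)) (by fun_prop) W.2.1
  have htopW : IsLagSec lam (fun s => W.1 (s, 1))
      fun s => (R (Fin.last (k + 1))).gauss (W.1 (s, 1)) :=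
    (R (Fin.last (k + 1))).isLagSec_gauss (c := fun s => W.1 (s, 1)) (by fun_prop) W.2.2.1
  -- The bottom and the top side of the glued square have one half in a square and one in
  -- the polygon.
  have e0 : rW 0 = rw' 0 0 + ru 0 := by
    refine rotation_halves hbotW (hrW 0) ?_ (hru 0)
    have h : F.HasRotation (fun s => (sub 2 0 s, sub (2 * k + 1) (2 * ((0 : Fin (k + 1)) : ℕ)) 0))
      (fun s => (R 0).gauss (W.1 (sub 2 0 s, sub (2 * k + 1) (2 * ((0 : Fin (k + 1)) : ℕ)) 0)))
      (rw' 0 0) := hrw 0 0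
    rwa [Fin.val_zero, mul_zero, s00] at h
  have e3 : rW 3 = rw' (Fin.last k) 3 + ru 3 := by
    refine rotation_halves htopW (hrW 3) ?_ (hru 3)
    have h : F.HasRotation
      (fun s => (sub 2 0 s, sub (2 * k + 1) (2 * ((Fin.last k : Fin (k + 1)) : ℕ)) 1))
      (fun s => (R (Fin.last (k + 1))).gauss
        (W.1 (sub 2 0 s, sub (2 * k + 1) (2 * ((Fin.last k : Fin (k + 1)) : ℕ)) 1)))
      (rw' (Fin.last k) 3) := hrw (Fin.last k) 3
    rwa [Fin.val_last, sub_last_one] at h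
  have hWr : ∀ t, W.1 (1, t) = γ₀.path t := W.2.2.2.2
  -- The output chord, with its closing path, is the right side of both the glued square and the
  -- polygon.
  have e1 : rW 1 = ru 1 := by
    have h : F.HasRotation (fun t => (sub 2 1 1, t)) (γ₀.transport Φ₀) (ru 1) := hru 1
    rw [s11] at h
    refine SymplecticFrame.HasRotation.unique ?_ (hrW 1) h
    simp only [outerPath, Matrix.cons_val, hWr]
    exact isLagSec_transport hΦ₀
  have e2 : rW 2 = ru 2 := by
    have h : F.HasRotation (fun _ => (sub 2 1 1, 1)) (fun t => plane (γ₀.path 1) (K₀ t)) (ru 2) :=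
      hru 2
    rw [s11] at h
    refine SymplecticFrame.HasRotation.unique ?_ (hrW 2) h
    simp only [outerPath, Matrix.cons_val, hWr]
    exact hK₀.isClosing.sec
  -- The input chords, with their closing paths, are common sides of the squares and the polygon.
  have e4 : ∀ i, rw' i 1 = lu (Sum.inl i) := by
    intro i
    have h : F.HasRotation (fun t => (sub 2 1 0, sub (2 * k + 1) (2 * (i : ℕ)) t))
      ((γ i).transport (Φ i)) (lu (Sum.inl i)) := hlu (Sum.inl i)
    have h' : F.HasRotation (fun t => (sub 2 0 1, sub (2 * k + 1) (2 * (i : ℕ)) t))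
      ((γ i).transport (Φ i)) (rw' i 1) := hrw i 1
    rw [s10] at h
    refine SymplecticFrame.HasRotation.unique ?_ h' h
    simp only [hWc]
    exact isLagSec_transport (hΦ i)
  have e5 : ∀ i, rw' i 2 = lu (Sum.inr (Sum.inl i)) := by
    intro i
    have h : F.HasRotation (fun _ => (sub 2 1 0, sub (2 * k + 1) (2 * (i : ℕ)) 1))
      (fun t => plane ((γ i).path 1) (K i t)) (lu (Sum.inr (Sum.inl i))) :=
      hlu (Sum.inr (Sum.inl i))
    have h' : F.HasRotation (fun _ => (sub 2 0 1, sub (2 * k + 1) (2 * (i : ℕ)) 1))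
      (fun t => plane ((γ i).path 1) (K i t)) (rw' i 2) := hrw i 2
    rw [s10] at h
    refine SymplecticFrame.HasRotation.unique ?_ h' h
    simp only [hWc]
    exact (hK i).isClosing.sec
  -- Each rectangle between two squares maps into one Legendrian submanifold, so that the rotation
  -- of its tangent planes around the boundary of the rectangle vanishes.
  have e6 : ∀ i : Fin k, rw' i.succ 0 + (A i.succ - B i.castSucc) =
      rw' i.castSucc 3 + lu (Sum.inr (Sum.inr i)) := by
    intro i
    have c0 := cs 2 0
    have c1 := cs (2 * k + 1) (2 * (i : ℕ) + 1)
    have hs : IsLagSec lam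
        (fun z : 𝕀 × 𝕀 => W.1 (sub 2 0 z.1, sub (2 * k + 1) (2 * (i : ℕ) + 1) z.2))
        fun z => (R i.succ.castSucc).gauss
          (W.1 (sub 2 0 z.1, sub (2 * k + 1) (2 * (i : ℕ) + 1) z.2)) :=
      (R i.succ.castSucc).isLagSec_gauss
        (c := fun z : 𝕀 × 𝕀 => W.1 (sub 2 0 z.1, sub (2 * k + 1) (2 * (i : ℕ) + 1) z.2))
        (by fun_prop) fun z => hWo _ _ _
    obtain ⟨η, hη⟩ := F.exists_phase_along
      (σ := fun z : 𝕀 × 𝕀 => (sub 2 0 z.1, sub (2 * k + 1) (2 * (i : ℕ) + 1) z.2)) (by fun_prop) hs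
    have t1 : sub (2 * k + 1) (2 * (i.succ : ℕ)) 0 = sub (2 * k + 1) (2 * (i : ℕ) + 1) 1 :=
      sub_succ_zero _
    have t0 : sub (2 * k + 1) (2 * (i : ℕ) + 1) 0 = sub (2 * k + 1) (2 * (i.castSucc : ℕ)) 1 :=
      sub_succ_zero _
    have h1 : rw' i.succ 0 = η (1, 1) - η (0, 1) := by
      have h : F.HasRotation (fun s => (sub 2 0 s, sub (2 * k + 1) (2 * (i.succ : ℕ)) 0))
        (fun s => (R i.succ.castSucc).gauss (W.1 (sub 2 0 s, sub (2 * k + 1) (2 * (i.succ : ℕ)) 0)))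
        (rw' i.succ 0) := hrw i.succ 0
      rw [t1] at h
      exact h.eq_sub (hs.comp (σ := fun s => (s, 1)) (by fun_prop)) (θ := fun s => η (s, 1))
        (by fun_prop) fun s => hη (s, 1)
    have h2 : rw' i.castSucc 3 = η (1, 0) - η (0, 0) := by
      have h : F.HasRotation (fun s => (sub 2 0 s, sub (2 * k + 1) (2 * (i.castSucc : ℕ)) 1))
        (fun s => (R i.succ.castSucc).gauss
          (W.1 (sub 2 0 s, sub (2 * k + 1) (2 * (i.castSucc : ℕ)) 1)))
        (rw' i.castSucc 3) := hrw i.castSucc 3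
      rw [← t0] at h
      exact h.eq_sub (hs.comp (σ := fun s => (s, 0)) (by fun_prop)) (θ := fun s => η (s, 0))
        (by fun_prop) fun s => hη (s, 0)
    have h3 : lu (Sum.inr (Sum.inr i)) = η (1, 1) - η (1, 0) := by
      have h : F.HasRotation (fun t => (sub 2 1 0, sub (2 * k + 1) (2 * (i : ℕ) + 1) t))
        (fun t => (R i.succ.castSucc).gauss
          (W.1 (sub 2 1 0, sub (2 * k + 1) (2 * (i : ℕ) + 1) t)))
        (lu (Sum.inr (Sum.inr i))) := hlu (Sum.inr (Sum.inr i))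
      rw [s10] at h
      exact h.eq_sub (hs.comp (σ := fun t => (1, t)) (by fun_prop)) (θ := fun t => η (1, t))
        (by fun_prop) fun t => hη (1, t)
    have h4 : A i.succ - B i.castSucc = η (0, 1) - η (0, 0) := by
      have h : F.HasRotation (fun t => (sub 2 0 0, sub (2 * k + 1) (2 * (i : ℕ) + 1) t))
          (fun t => (R i.succ.castSucc).gauss
            (W.1 (sub 2 0 0, sub (2 * k + 1) (2 * (i : ℕ) + 1) t))) (A i.succ - B i.castSucc) := by
        refine ⟨⟨fun t => θ (sub (2 * k + 1) (2 * (i : ℕ) + 1) t), by fun_prop⟩, fun t => ?_, ?_⟩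
        · have h5 := hθ (sub (2 * k + 1) (2 * (i : ℕ) + 1) t)
          rw [(hbo i t).2, ← W.2.2.2.1] at h5
          rw [s00]
          exact h5
        · simp only [A, B, t1, ← t0, ContinuousMap.coe_mk]
      exact h.eq_sub (hs.comp (σ := fun t => (0, t)) (by fun_prop)) (θ := fun t => η (0, t))
        (by fun_prop) fun t => hη (0, t)
    rw [h1, h2, h3, h4]
    ring
  have a0 : A 0 = θ 0 := by simp only [A, Fin.val_zero, mul_zero, s00]
  have b1 : B (Fin.last k) = θ 1 := by simp only [B, Fin.val_last, sub_last_one]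
  have ht := sum_telescope A B
  rw [a0, b1] at ht
  have hsum : ∑ i, rw' i 0 - ∑ i, rw' i 3 + ∑ i : Fin k, (A i.succ - B i.castSucc) =
      rw' 0 0 - rw' (Fin.last k) 3 + ∑ i : Fin k, lu (Sum.inr (Sum.inr i)) := by
    rw [Fin.sum_univ_succ fun i => rw' i 0, Fin.sum_univ_castSucc fun i => rw' i 3]
    have h := Finset.sum_congr rfl fun i (_ : i ∈ (Finset.univ : Finset (Fin k))) => e6 i
    rw [Finset.sum_add_distrib, Finset.sum_add_distrib] at h
    linarith
  have hai : ∑ i, (a i : ℝ) = ∑ i, rw' i 0 + ∑ i, (lu (Sum.inl i) - lu (Sum.inr (Sum.inl i))) -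
      ∑ i, rw' i 3 - ∑ i, (B i - A i) := by
    rw [← Finset.sum_add_distrib, ← Finset.sum_sub_distrib, ← Finset.sum_sub_distrib]
    refine Finset.sum_congr rfl fun i _ => ?_
    rw [i1 i, e4, e5]
    ring
  have hfin : ∑ i, (a i : ℝ) + b = c := by
    rw [hai, i2, i3, leftSign_sum, e0, e1, e2, e3]
    linarith
  exact_mod_cast hfin

end Additivity

end LegendrianIndex

end

open LegendrianIndex in
theorem mainTheorem10 {n : ℕ} {M : Type*} [TopologicalSpace M] [T2Space M]
    [ChartedSpace (Model n) M] [IsManifold (𝓡 (2 * n + 1)) ∞ M] (lam : ContactForm n M) :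
    (∀ (k : ℕ) (R : Fin (k + 2) → Legendrian lam)
      (ℓ : ∀ i : Fin (k + 1), GradedBridge (R i.castSucc) (R i.succ))
      (γ : ∀ i : Fin (k + 1), ReebChord (R i.castSucc) (R i.succ))
      (γ₀ : ReebChord (R 0) (R (Fin.last (k + 1))))
      (a : ∀ i, SquareClass (ℓ i) (γ i)) (B : PolygonClass R γ γ₀),
      ∃ (ℓ₀ : GradedBridge (R 0) (R (Fin.last (k + 1)))) (c : SquareClass ℓ₀ γ₀),
        IsGluedClass a B c) ∧
    ∃ μ : IndexSystem lam ℤ, μ.IsMaslov ∧ μ.IsAbstractIndex := by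
  classical
  refine ⟨fun k R ℓ γ γ₀ a B => ?_, ?_⟩
  · choose w hw using fun i => Quotient.exists_rep (a i)
    obtain ⟨u, hu⟩ := Quotient.exists_rep B
    obtain ⟨ℓ₀, W, hW⟩ := exists_gluing w u
    exact ⟨ℓ₀, Quotient.mk _ W, w, u, W, hw, hu, rfl, hW⟩
  · -- Classes with a degenerate chord get the value `0`; no condition is imposed on them.
    let μ : IndexSystem lam ℤ :=
      { one := fun ℓ γ => if h : γ.Nondegenerate then (exists_squareIndex ℓ h).choose else 0
        poly := fun _ γ γ₀ =>
          if h : (∀ i, (γ i).Nondegenerate) ∧ γ₀.Nondegenerate then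
            (exists_polygonIndex h.1 h.2).choose
          else 0 }
    have hone : ∀ (R R' : Legendrian lam) (ℓ : GradedBridge R R') (γ : ReebChord R R'),
        γ.Nondegenerate → ∀ (w : Square ℓ γ) (m : ℤ),
          IsSquareIndex w m ↔ μ.one ℓ γ (Quotient.mk _ w) = m := by
      intro R R' ℓ γ h
      simp only [μ, dif_pos h]
      exact (exists_squareIndex ℓ h).choose_spec
    have hpoly : ∀ (k : ℕ) (E : GradedBridgedLink lam k)
        (γ : ∀ i : Fin (k + 1), ReebChord (E.comp i.castSucc) (E.comp i.succ))
        (γ₀ : ReebChord (E.comp 0) (E.comp (Fin.last (k + 1)))),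
        (∀ i, (γ i).Nondegenerate) → γ₀.Nondegenerate →
        ∀ (u : Polygon E.comp γ γ₀) (m : ℤ),
          IsPolygonIndex u m ↔ μ.poly E γ γ₀ (Quotient.mk _ u) = m := by
      intro k E γ γ₀ h h₀
      have hh : (∀ i, (γ i).Nondegenerate) ∧ γ₀.Nondegenerate := ⟨h, h₀⟩
      simp only [μ, dif_pos hh]
      exact (exists_polygonIndex h h₀).choose_spec
    refine ⟨μ, ⟨hone, hpoly⟩, ?_⟩
    rintro k E γ γ₀ h h₀ a B c ⟨w, u, W, hw, rfl, rfl, hW⟩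
    obtain rfl : (fun i => Quotient.mk _ (w i)) = a := funext hw
    rw [List.sum_ofFn]
    exact index_gluing h h₀ hW (fun i => (hone _ _ _ _ (h i) _ _).2 rfl)
      ((hpoly _ _ _ _ h h₀ _ _).2 rfl) ((hone _ _ _ _ h₀ _ _).2 rfl)
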